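/- **Setting.** Let $\mathsf N\ge 0$, $2s_1,\dots,2s_{\mathsf N}\in\mathbb Z_{>0}$, $\eta\in\mathbb C\setminus\{0\}$, $\xi_1,\dots,\xi_{\mathsf N}\in\mathbb C$, $K\in\mathrm{End}(\mathbb C^2)$ with eigenvalues $k_1,k_2$, and $\mathcal H=\bigotimes_{n=1}^{\mathsf N}\mathbb C^{2s_n+1}$. Let $S^z_n=\mathrm{diag}(s_n,s_n-1,\dots,-s_n)$, let $S_n^+$ have the entries $\sqrt{j(2s_n+1-j)}$, $1\le j\le 2s_n$, directly above the diagonal and zeros elsewhere, and let $S^-_n=(S^+_n)^t$. Put $$L_{0n}(\lambda)=\begin{pmatrix}\lambda+\eta(\tfrac12+S^z_n)&\eta S^-_n\\ \eta S^+_n&\lambda+\eta(\tfrac12-S^z_n)\end{pmatrix},\qquad M_0(\lambda)=K_0L_{0\mathsf N}(\lambda-\xi_{\mathsf N})\cdots L_{01}(\lambda-\xi_1)=\begin{pmatrix}A(\lambda)&B(\lambda)\\ C(\lambda)&D(\lambda)\end{pmatrix},$$ $T(\lambda)=A(\lambda)+D(\lambda)$ and $\det_q M(\lambda)=A(\lambda)D(\lambda-\eta)-B(\lambda)C(\lambda-\eta)$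 (a multiple of the identity). For $l\ge 0$ let $$T^{(l)}(\lambda)=\mathrm{tr}\big[P^+_{1\dots l}M_1(\lambda+(l-1)\eta)\cdots M_{l-1}(\lambda+\eta)M_l(\lambda)P^+_{1\dots l}\big],$$ where the trace is over $l$ auxiliary copies of $\mathbb C^2$, $M_j$ acts on the $j$-th copy, and $P^+_{1\dots l}$ is the symmetric projector; so $T^{(0)}=1$ and $T^{(1)}=T$. Put $\xi_n^{(k)}=\xi_n-\tfrac{\eta}{2}+(s_n-k)\eta$, $\ a(\lambda)=\prod_n(\lambda-\xi_n+\tfrac{\eta}{2}+s_n\eta)$, $\ d(\lambda)=\prod_n(\lambda-\xi_n+\tfrac{\eta}{2}-s_n\eta)$, $\ \beta(\lambda)=k_1a(\lambda)$, $\ \alpha(\lambda)=\beta(\lambda)\beta(\lambda-\eta)$, $\ \mathsf N_s=2\sum_n s_n$. Let $\Sigma_T$ be the set of transfer-matrix eigenvalues: the functions $t:\mathbb C\to\mathbb C$ for which there is a nonzero $v\in\mathcal H$ with $T(\lambda)v=t(\lambda)v$ for all $\lambda$; such a $v$ is called an eigenvector with eigenvalue $t$. For an entire function $t$, a *$Q$-function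 of $t$* is a monic polynomial $Q$ of degree at most $\mathsf N_s$ with $Q(\xi_b^{(2s_b)})\neq0$ for all $b$ and, for all $\lambda\in\mathbb C$, $$\alpha(\lambda)Q(\lambda-2\eta)-\beta(\lambda)t(\lambda-\eta)Q(\lambda-\eta)+\det{}_q M(\lambda)\,Q(\lambda)=0 .$$ For a covector $\langle S|$ on $\mathcal H$ put $$\langle h_1,\dots,h_{\mathsf N}|=\langle S|\prod_{n=1}^{\mathsf N}\frac{k_2^{\,h_n-2s_n}\,T^{(2s_n-h_n)}(\xi_n^{(2s_n)})}{\prod_{k=0}^{2s_n-h_n-1}d(\xi_n^{(2s_n-k)})},\qquad 0\le h_n\le 2s_n ;$$ when these covectors form a basis of the dual of $\mathcal H$, they are called the SoV basis generated by $\langle S|$. **Theorem.** Assume that for all $a\ne b$ one has $\xi_a-\xi_b\notin\eta\mathbb Z$ and $\xi_a^{(h)}\neq\xi_b^{(k)}$ for $0\le h\le 2s_a$, $0\le k\le 2s_b$. Then there is a finite set $E\subset\mathbb C$, depending only on $\eta$, $(s_n)_n$ and $(\xi_n)_n$, such that for every $K$ with eigenvalues $k_1\ne k_2$, $k_1\neq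 0$, $k_2\ne0$, the following hold. 1. If $k_1/k_2\notin E$, then an entire function $t$ belongs to $\Sigma_T$ if and only if $t$ has a unique $Q$-function. 2. Also when $k_1/k_2\in E$: if an entire function $t$ has a $Q$-function, then this $Q$-function is unique and $t\in\Sigma_T$. 3. There is a covector $\langle S|$ that generates an SoV basis. For every such $\langle S|$, every entire function $t$ with a $Q$-function $Q_t$, and every eigenvector $|t\rangle$ with eigenvalue $t$, there is a constant $c\neq0$ with $$\langle h_1,\dots,h_{\mathsf N}|t\rangle=c\prod_{n=1}^{\mathsf N}Q_t(\xi_n^{(h_n)})\qquad\text{for all } 0\le h_n\le 2s_n .$$ -/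

import Mathlib

/-! Quasi-periodic higher spin chains of the rational `gl₂` Yang-Baxter algebra.

The chain has `N` sites; `d n = 2 s_n` is twice the spin at the site `n : Fin N`. The quantum space
`⊗_n ℂ^(d n + 1)` is used in coordinates with respect to the product basis: vectors and covectors
are functions on `Conf d`, operators are matrices indexed by `Conf d`. -/

namespace HigherSpin

noncomputable section

/-- Diagonal spin matrix `diag (s, s - 1, …, -s)` with `m = 2 s`. -/
def Sz (m : ℕ) : Matrix (Fin (m + 1)) (Fin (m + 1)) ℂ :=
  Matrix.diagonal fun i => (m : ℂ) / 2 - ((i : ℕ) : ℂ)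

/-- Raising matrix, with the entries `x j = √(j (2 s + 1 - j))`, `j = 1, …, 2 s`, above the
diagonal. -/
def Sp (m : ℕ) : Matrix (Fin (m + 1)) (Fin (m + 1)) ℂ :=
  Matrix.of fun i j =>
    if (i : ℕ) + 1 = (j : ℕ) then
      ((Real.sqrt (((j : ℕ) : ℝ) * ((m : ℝ) + 1 - ((j : ℕ) : ℝ))) : ℝ) : ℂ)
    else 0

/-- Lowering matrix. -/
def Sm (m : ℕ) : Matrix (Fin (m + 1)) (Fin (m + 1)) ℂ := (Sp m).transpose

/-- Index set of the product basis of the quantum space. -/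
abbrev Conf {N : ℕ} (d : Fin N → ℕ) : Type := (n : Fin N) → Fin (d n + 1)

/-- Operators on the quantum space. -/
abbrev Op {N : ℕ} (d : Fin N → ℕ) : Type := Matrix (Conf d) (Conf d) ℂ

/-- The matrix `A` acting on the factor at the site `n`, the identity on the other factors. -/
def siteOp {N : ℕ} (d : Fin N → ℕ) (n : Fin N)
    (A : Matrix (Fin (d n + 1)) (Fin (d n + 1)) ℂ) : Op d :=
  Matrix.of fun h h' => if ∀ m, m ≠ n → h m = h' m then A (h n) (h' n) else 0

/-- Lax operator at the site `n`: a `2 × 2` matrix in the auxiliary space with operator entries. -/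
def lax {N : ℕ} (d : Fin N → ℕ) (η : ℂ) (n : Fin N) (x : ℂ) : Matrix (Fin 2) (Fin 2) (Op d) :=
  !![siteOp d n ((x + η / 2) • (1 : Matrix (Fin (d n + 1)) (Fin (d n + 1)) ℂ) + η • Sz (d n)),
      siteOp d n (η • Sm (d n));
    siteOp d n (η • Sp (d n)),
      siteOp d n ((x + η / 2) • (1 : Matrix (Fin (d n + 1)) (Fin (d n + 1)) ℂ) - η • Sz (d n))]

/-- Monodromy matrix `K₀ L_N(x - ξ_N) ⋯ L_1(x - ξ_1)` with the twist `K`. -/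
def monodromy {N : ℕ} (d : Fin N → ℕ) (η : ℂ) (ξ : Fin N → ℂ) (K : Matrix (Fin 2) (Fin 2) ℂ)
    (x : ℂ) : Matrix (Fin 2) (Fin 2) (Op d) :=
  (K.map fun c => c • (1 : Op d)) *
    (List.ofFn fun n : Fin N => lax d η n (x - ξ n)).reverse.prod

/-- Transfer matrix: trace of the monodromy matrix over the auxiliary space. -/
def transfer {N : ℕ} (d : Fin N → ℕ) (η : ℂ) (ξ : Fin N → ℂ) (K : Matrix (Fin 2) (Fin 2) ℂ)
    (x : ℂ) : Op d :=
  (monodromy d η ξ K x).trace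

/-- Quantum determinant `A(x) D(x - η) - B(x) C(x - η)`, an operator on the quantum space. -/
def qdet {N : ℕ} (d : Fin N → ℕ) (η : ℂ) (ξ : Fin N → ℂ) (K : Matrix (Fin 2) (Fin 2) ℂ)
    (x : ℂ) : Op d :=
  monodromy d η ξ K x 0 0 * monodromy d η ξ K (x - η) 1 1 -
    monodromy d η ξ K x 0 1 * monodromy d η ξ K (x - η) 1 0

/-- A `2 × 2` matrix with operator entries, acting on the `j`-th of `l` auxiliary spaces `ℂ²`. -/
def auxOp {N : ℕ} (d : Fin N → ℕ) (l : ℕ) (j : Fin l) (M : Matrix (Fin 2) (Fin 2) (Op d)) :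
    Matrix (Fin l → Fin 2) (Fin l → Fin 2) (Op d) :=
  Matrix.of fun i i' => if ∀ k, k ≠ j → i k = i' k then M (i j) (i' j) else 0

/-- Symmetric projector `(1 / l!) ∑_π P_π` on `(ℂ²)^⊗l`, where
`P_π (v_1 ⊗ ⋯ ⊗ v_l) = v_(π 1) ⊗ ⋯ ⊗ v_(π l)`. -/
def symProj (l : ℕ) : Matrix (Fin l → Fin 2) (Fin l → Fin 2) ℂ :=
  ((Nat.factorial l : ℕ) : ℂ)⁻¹ •
    ∑ π : Equiv.Perm (Fin l), Matrix.of fun i i' => if i = i' ∘ π then (1 : ℂ) else 0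

/-- Fused monodromy matrix `P⁺ M_1(x + (l - 1) η) ⋯ M_(l-1)(x + η) M_l(x) P⁺`. -/
def fusedMonodromy {N : ℕ} (d : Fin N → ℕ) (η : ℂ) (ξ : Fin N → ℂ)
    (K : Matrix (Fin 2) (Fin 2) ℂ) (l : ℕ) (x : ℂ) :
    Matrix (Fin l → Fin 2) (Fin l → Fin 2) (Op d) :=
  ((symProj l).map fun c => c • (1 : Op d)) *
    (List.ofFn fun j : Fin l =>
      auxOp d l j (monodromy d η ξ K (x + ((l : ℂ) - 1 - ((j : ℕ) : ℂ)) * η))).prod *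
    ((symProj l).map fun c => c • (1 : Op d))

/-- Fused transfer matrix. As the fused monodromy matrix vanishes on the kernel of `P⁺` and maps
into its range, its trace over the range of `P⁺` is its trace over `(ℂ²)^⊗l`. -/
def fusedTransfer {N : ℕ} (d : Fin N → ℕ) (η : ℂ) (ξ : Fin N → ℂ)
    (K : Matrix (Fin 2) (Fin 2) ℂ) (l : ℕ) (x : ℂ) : Op d :=
  (fusedMonodromy d η ξ K l x).trace

/-- The points `ξ_n^(k) = ξ_n - η / 2 + (s_n - k) η`. -/
def xi {N : ℕ} (d : Fin N → ℕ) (η : ℂ) (ξ : Fin N → ℂ) (n : Fin N) (k : ℕ) : ℂ :=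
  ξ n - η / 2 + ((d n : ℂ) / 2 - (k : ℂ)) * η

/-- `a(x) = ∏ (x - (ξ_n - η / 2) + s_n η)`. -/
def aFun {N : ℕ} (d : Fin N → ℕ) (η : ℂ) (ξ : Fin N → ℂ) (x : ℂ) : ℂ :=
  ∏ n : Fin N, (x - (ξ n - η / 2) + (d n : ℂ) / 2 * η)

/-- `d(x) = ∏ (x - (ξ_n - η / 2) - s_n η)`. -/
def dFun {N : ℕ} (d : Fin N → ℕ) (η : ℂ) (ξ : Fin N → ℂ) (x : ℂ) : ℂ :=
  ∏ n : Fin N, (x - (ξ n - η / 2) - (d n : ℂ) / 2 * η)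

/-- `v` is a common eigenvector of the transfer matrices, with eigenvalue `t(x)` at `x`. -/
def IsEigenvector {N : ℕ} (d : Fin N → ℕ) (η : ℂ) (ξ : Fin N → ℂ)
    (K : Matrix (Fin 2) (Fin 2) ℂ) (t : ℂ → ℂ) (v : Conf d → ℂ) : Prop :=
  v ≠ 0 ∧ ∀ x : ℂ, (transfer d η ξ K x).mulVec v = t x • v

/-- The set of the transfer matrix eigenvalues, as functions of the spectral parameter. -/
def spectrumT {N : ℕ} (d : Fin N → ℕ) (η : ℂ) (ξ : Fin N → ℂ)
    (K : Matrix (Fin 2) (Fin 2) ℂ) : Set (ℂ → ℂ) :=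
  {t | ∃ v, IsEigenvector d η ξ K t v}

/-- The coefficient `β(x) = k₁ a(x)` of the quantum spectral curve equation. -/
def betaFun {N : ℕ} (d : Fin N → ℕ) (η : ℂ) (ξ : Fin N → ℂ) (k₁ x : ℂ) : ℂ :=
  k₁ * aFun d η ξ x

/-- The coefficient `α(x) = β(x) β(x - η)` of the quantum spectral curve equation. -/
def alphaFun {N : ℕ} (d : Fin N → ℕ) (η : ℂ) (ξ : Fin N → ℂ) (k₁ x : ℂ) : ℂ :=
  betaFun d η ξ k₁ x * betaFun d η ξ k₁ (x - η)

/-- The quantum spectral curve equation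
`α(x) Q(x - 2η) - β(x) t(x - η) Q(x - η) + det_q M(x) Q(x) = 0` (an identity of operators: the
first two terms are multiples of the identity). -/
def SpectralCurve {N : ℕ} (d : Fin N → ℕ) (η : ℂ) (ξ : Fin N → ℂ)
    (K : Matrix (Fin 2) (Fin 2) ℂ) (k₁ : ℂ) (t : ℂ → ℂ) (Q : Polynomial ℂ) : Prop :=
  ∀ x : ℂ,
    (alphaFun d η ξ k₁ x * Q.eval (x - 2 * η)
        - betaFun d η ξ k₁ x * t (x - η) * Q.eval (x - η)) • (1 : Op d)
      + Q.eval x • qdet d η ξ K x = 0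

/-- `Q` is a monic polynomial of degree at most `2 ∑ s_n`, without zeros at the points
`ξ_b^(2 s_b)`, that solves the quantum spectral curve equation for `t`. -/
structure IsQFunction {N : ℕ} (d : Fin N → ℕ) (η : ℂ) (ξ : Fin N → ℂ)
    (K : Matrix (Fin 2) (Fin 2) ℂ) (k₁ : ℂ) (t : ℂ → ℂ) (Q : Polynomial ℂ) : Prop where
  monic : Q.Monic
  natDegree_le : Q.natDegree ≤ ∑ n : Fin N, d n
  eval_ne_zero : ∀ b : Fin N, Q.eval (xi d η ξ b (d b)) ≠ 0
  curve : SpectralCurve d η ξ K k₁ t Q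

/-- The covector
`⟨h| = ⟨S| ∏_n k₂^(h_n - 2 s_n) T^(2 s_n - h_n)(ξ_n^(2 s_n)) / ∏_(k < 2 s_n - h_n) d(ξ_n^(2 s_n - k))`. -/
def sovCovector {N : ℕ} (d : Fin N → ℕ) (η : ℂ) (ξ : Fin N → ℂ)
    (K : Matrix (Fin 2) (Fin 2) ℂ) (k₂ : ℂ) (S : Conf d → ℂ) (h : Conf d) : Conf d → ℂ :=
  Matrix.vecMul S (List.ofFn fun n : Fin N =>
    (k₂ ^ (d n - (h n : ℕ)) *
        ∏ k ∈ Finset.range (d n - (h n : ℕ)), dFun d η ξ (xi d η ξ n (d n - k)))⁻¹ •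
      fusedTransfer d η ξ K (d n - (h n : ℕ)) (xi d η ξ n (d n))).prod

/-- The covectors generated from `⟨S|` form a basis of the dual of the quantum space. -/
def IsSoVBasis {N : ℕ} (d : Fin N → ℕ) (η : ℂ) (ξ : Fin N → ℂ)
    (K : Matrix (Fin 2) (Fin 2) ℂ) (k₂ : ℂ) (S : Conf d → ℂ) : Prop :=
  LinearIndependent ℂ (sovCovector d η ξ K k₂ S) ∧
    Submodule.span ℂ (Set.range (sovCovector d η ξ K k₂ S)) = ⊤

end

end HigherSpin

/-! The proof is separation of variables. In a suitable triangular gauge, the upper right entry of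
the monodromy matrix has an extremal left eigencovector with eigenvalue a nonzero multiple of d(x).
By the exchange relations, the upper left entry, applied at a zero of the eigenvalue, moves that
zero by -η. This produces one eigencovector for each choice of a point on every string ξ_n^(0), …,
ξ_n^(2s_n). The quantum determinant provides the inverse moves and shows that none of these
covectors vanish. Disjointness of the strings makes their eigenvalues distinct, so they form a
basis, and at the string points the transfer matrix acts on it by shifts (`exists_separated_basis`).

Pairing this basis with an eigenvector shows that t is an eigenvalue exactly when it is a polynomial
of degree at most N with coefficient k₁ + k₂ in degree N, and a second-order difference equation is
solvable on each string (`mem_spectrumT_iff`). After division by k₁ a(x) and a shift, the spectral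
curve becomes the TQ equation t(x)Q(x) = k₁ a(x)Q(x - η) + k₂ d(x)Q(x + η), so a Q-function gives
the string solutions. Its uniqueness follows from the Casoratian of two solutions, because k₁ ≠ k₂
(`TQ.unique`). Conversely, a count of unknowns yields a polynomial solution for every eigenvalue
(`IsSeparatedEigenvalue.exists_tq`).

What may fail is Q(ξ_b^(2s_b)) ≠ 0. If it does, then v ⊗ Q, with v an eigenvector for the twist
diag(κ, 1), κ = k₁/k₂, lies in the kernel of a linear pencil in κ. At κ = 0 the pencil is injective
(`degenerateTQ_injective`), so it fails to be injective for finitely many κ only; these form the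
exceptional set.

For the SoV bases, fusion gives a three-term recursion for the higher transfer matrices
(`fusedTransfer_succ_succ`). Through it they act on the bottom of a string as pure jumps, and on
eigenvectors by quotients of values of Q. -/

namespace HigherSpin

/-! ### Exchange relations and the quantum determinant -/

section YangBaxter

variable {R : Type*} [Ring R]

/-- All entries of `X` commute with all entries of `Y`. -/
def EntriesCommute (X Y : Matrix (Fin 2) (Fin 2) R) : Prop :=
  ∀ i j k l, Commute (X i j) (Y k l)

theorem EntriesCommute.symm {X Y : Matrix (Fin 2) (Fin 2) R} (h : EntriesCommute X Y) :
    EntriesCommute Y X := fun i j k l => (h k l i j).symm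

theorem EntriesCommute.mul_left {X Y Z : Matrix (Fin 2) (Fin 2) R} (hX : EntriesCommute X Z)
    (hY : EntriesCommute Y Z) : EntriesCommute (X * Y) Z := by
  intro i j k l
  rw [Matrix.mul_apply]
  exact Commute.sum_left _ _ _ fun p _ => (hX _ _ _ _).mul_left (hY _ _ _ _)

theorem EntriesCommute.mul_right {X Y Z : Matrix (Fin 2) (Fin 2) R} (hX : EntriesCommute Z X)
    (hY : EntriesCommute Z Y) : EntriesCommute Z (X * Y) :=
  (hX.symm.mul_left hY.symm).symm

theorem EntriesCommute.mul_mul_apply {X Y X' Y' : Matrix (Fin 2) (Fin 2) R}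
    (h : EntriesCommute X' Y) (i j k l : Fin 2) :
    (X * Y) i j * (X' * Y') k l = ∑ p, ∑ q, (X i p * X' k q) * (Y p j * Y' q l) := by
  rw [Matrix.mul_apply, Matrix.mul_apply, Finset.sum_mul_sum]
  refine Finset.sum_congr rfl fun p _ => Finset.sum_congr rfl fun q _ => ?_
  rw [mul_assoc, mul_assoc, ← mul_assoc (Y p j), ← (h k q p j).eq, mul_assoc]

variable [Algebra ℂ R]

/-- The Yang-Baxter exchange relations for the rational `gl₂` R-matrix. -/
def RTT (η : ℂ) (M : ℂ → Matrix (Fin 2) (Fin 2) R) : Prop :=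
  ∀ x y i j k l, (x - y) • (M x i j * M y k l) + η • (M x k j * M y i l) =
    (x - y) • (M y k l * M x i j) + η • (M y k j * M x i l)

/-- Commuting entries allow the product of two monodromy matrices to be sorted with both `X` factors
on the left. The relation for `X` exchanges the inner summation indices, and the relation for `Y`
exchanges them back. -/
theorem RTT.mul {η : ℂ} {X Y : ℂ → Matrix (Fin 2) (Fin 2) R} (hX : RTT η X) (hY : RTT η Y)
    (h : ∀ x y, EntriesCommute (X x) (Y y)) : RTT η fun x => X x * Y x := by
  intro x y i j k l
  have e (x y : ℂ) := (h y x).mul_mul_apply (X := X x) (Y' := Y y)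
  calc (x - y) • ((X x * Y x) i j * (X y * Y y) k l) + η • ((X x * Y x) k j * (X y * Y y) i l)
      = ∑ p, ∑ q, ((x - y) • (X x i p * X y k q) + η • (X x k p * X y i q)) *
          (Y x p j * Y y q l) := by
        rw [e, e]
        simp only [Fin.sum_univ_two, add_mul, smul_mul_assoc, smul_add]
        abel
    _ = ∑ p, ∑ q, ((x - y) • (X y k q * X x i p) + η • (X y k p * X x i q)) *
          (Y x p j * Y y q l) := by simp only [hX x y]
    _ = ∑ p, ∑ q, (X y k q * X x i p) *
          ((x - y) • (Y x p j * Y y q l) + η • (Y x q j * Y y p l)) := by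
        simp only [Fin.sum_univ_two, add_mul, mul_add, smul_mul_assoc, mul_smul_comm]
        abel
    _ = ∑ p, ∑ q, (X y k q * X x i p) *
          ((x - y) • (Y y q l * Y x p j) + η • (Y y q j * Y x p l)) := by simp only [hY x y]
    _ = _ := by
        rw [e, e]
        simp only [Fin.sum_univ_two, mul_add, mul_smul_comm, smul_add]
        abel

/-- A `2 × 2` matrix of numbers, as a matrix with operator entries. -/
def scalarAux (R : Type*) [Ring R] [Algebra ℂ R] (K : Matrix (Fin 2) (Fin 2) ℂ) :
    Matrix (Fin 2) (Fin 2) R :=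
  K.map fun c => c • (1 : R)

theorem scalarAux_apply (K : Matrix (Fin 2) (Fin 2) ℂ) (i j : Fin 2) :
    scalarAux R K i j = K i j • (1 : R) := rfl

theorem entriesCommute_scalarAux (K : Matrix (Fin 2) (Fin 2) ℂ) (X : Matrix (Fin 2) (Fin 2) R) :
    EntriesCommute (scalarAux R K) X := by
  intro i j k l
  rw [scalarAux_apply]
  exact (Commute.one_left _).smul_left _

theorem rtt_scalarAux (η : ℂ) (K : Matrix (Fin 2) (Fin 2) ℂ) :
    RTT η fun _ => scalarAux R K := by
  intro x y i j k l
  simp only [scalarAux_apply, smul_mul_smul_comm, one_mul, mul_comm (K i j)]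

/-- The two-row minors of the quantum determinant. -/
def qminor (η : ℂ) (M : ℂ → Matrix (Fin 2) (Fin 2) R) (x : ℂ) (i k j l : Fin 2) : R :=
  M x i j * M (x - η) k l - M x i l * M (x - η) k j

/-- At spectral parameters differing by η the R-matrix is proportional to 1 + P. The two instances
of the exchange relation with `j` and `l` interchanged then share a right-hand side, and equating
the left-hand sides is the antisymmetry. -/
theorem RTT.qminor_swap {η : ℂ} (hη : η ≠ 0) {M : ℂ → Matrix (Fin 2) (Fin 2) R} (h : RTT η M)
    (x : ℂ) (i k j l : Fin 2) : qminor η M x k i j l = - qminor η M x i k j l := by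
  have h1 := h x (x - η) i j k l
  have h2 := h x (x - η) i l k j
  rw [sub_sub_cancel, ← smul_add, ← smul_add] at h1 h2
  have h1' := smul_right_injective R hη h1
  have h2' := smul_right_injective R hη h2
  simp only [qminor]
  rw [add_comm (M (x - η) k j * _)] at h2'
  have := h1'.trans h2'.symm
  rw [eq_neg_iff_add_eq_zero, ← sub_eq_zero.2 this]
  abel

theorem RTT.qminor_self {η : ℂ} (hη : η ≠ 0) {M : ℂ → Matrix (Fin 2) (Fin 2) R} (h : RTT η M)
    (x : ℂ) (i j l : Fin 2) : qminor η M x i i j l = 0 := by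
  have := h.qminor_swap hη x i i j l
  rw [eq_neg_iff_add_eq_zero, ← two_smul ℂ] at this
  exact (smul_eq_zero.1 this).resolve_left two_ne_zero

/-- A Cauchy-Binet argument: the minor of the product is a sum over `p`, `q` of entries of `X` times
the minor of `Y` in the rows `p`, `q`, which is antisymmetric in these rows. -/
theorem RTT.qminor_mul {η : ℂ} (hη : η ≠ 0) {X Y : ℂ → Matrix (Fin 2) (Fin 2) R} (hY : RTT η Y)
    (h : ∀ x y, EntriesCommute (X x) (Y y)) (x : ℂ) :
    qminor η (fun x => X x * Y x) x 0 1 0 1 = qminor η X x 0 1 0 1 * qminor η Y x 0 1 0 1 := by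
  have e (x y : ℂ) := (h y x).mul_mul_apply (X := X x) (Y' := Y y)
  have s := hY.qminor_swap hη x 0 1 0 1
  have s0 := hY.qminor_self hη x 0 0 1
  have s1 := hY.qminor_self hη x 1 0 1
  have : qminor η (fun x => X x * Y x) x 0 1 0 1 =
      ∑ p, ∑ q, (X x 0 p * X (x - η) 1 q) * qminor η Y x p q 0 1 := by
    simp only [qminor, mul_sub, Finset.sum_sub_distrib, e]
  rw [this]
  simp only [Fin.sum_univ_two, s, s0, s1]
  simp only [qminor]
  noncomm_ring

theorem qminor_scalarAux (η : ℂ) (K : Matrix (Fin 2) (Fin 2) ℂ) (x : ℂ) :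
    qminor η (fun _ => scalarAux R K) x 0 1 0 1 = K.det • (1 : R) := by
  simp only [qminor, scalarAux_apply, smul_mul_smul_comm, one_mul, Matrix.det_fin_two, sub_smul]

/-- If the `gl₂` relations hold then `x + η X` solves the exchange relations. -/
theorem RTT.of_gl2 (η : ℂ) (X : Matrix (Fin 2) (Fin 2) R)
    (hX : ∀ i j k l, X i j * X k l - X k l * X i j =
      (1 : Matrix (Fin 2) (Fin 2) ℂ) i l • X k j - (1 : Matrix (Fin 2) (Fin 2) ℂ) k j • X i l)
    (c : ℂ) : RTT η fun x => scalarAux R ((x - c) • 1) + η • X := by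
  intro x y i j k l
  have h := hX i j k l
  rw [sub_eq_iff_eq_add] at h
  simp only [Matrix.add_apply, Matrix.smul_apply, scalarAux_apply, mul_add, add_mul,
    smul_mul_assoc, mul_smul_comm, smul_add, smul_smul, h, mul_one, one_mul, smul_eq_mul]
  module

end YangBaxter
end HigherSpin

namespace HigherSpin

/-! ### Operators acting at a single site -/

section Sites

variable {N : ℕ} {d : Fin N → ℕ}

theorem siteOp_mul (n : Fin N) (A B : Matrix (Fin (d n + 1)) (Fin (d n + 1)) ℂ) :
    siteOp d n (A * B) = siteOp d n A * siteOp d n B := by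
  ext h h'
  rw [Matrix.mul_apply]
  simp only [siteOp, Matrix.of_apply]
  by_cases hh : ∀ m, m ≠ n → h m = h' m
  · rw [if_pos hh, Matrix.mul_apply]
    refine Fintype.sum_of_injective (fun j => Function.update h n j)
      (Function.update_injective h n) _ _ (fun g hg => ?_) fun j => ?_
    · rw [if_neg, zero_mul]
      intro hg'
      refine hg ⟨g n, ?_⟩
      ext m
      by_cases hm : m = n
      · subst hm; simp
      · simp [hm, hg' m hm]
    · rw [if_pos fun m hm => by simp [hm], if_pos fun m hm => by simp [hm, hh m hm]]
      simp
  · rw [if_neg hh]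
    symm
    refine Finset.sum_eq_zero fun g _ => ?_
    by_cases h1 : ∀ m, m ≠ n → h m = g m
    · rw [if_neg (c := ∀ m, m ≠ n → g m = h' m) fun h2 =>
        hh fun m hm => (h1 m hm).trans (h2 m hm), mul_zero]
    · rw [if_neg h1, zero_mul]

theorem siteOp_one (n : Fin N) : siteOp d n 1 = 1 := by
  ext h h'
  simp only [siteOp, Matrix.of_apply, Matrix.one_apply]
  by_cases hh : h = h'
  · simp [hh]
  · rw [if_neg hh]
    split_ifs with h1 h2
    · exact absurd (funext fun m => if hm : m = n then hm ▸ h2 else h1 m hm) hh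
    · rfl
    · rfl

theorem siteOp_add (n : Fin N) (A B : Matrix (Fin (d n + 1)) (Fin (d n + 1)) ℂ) :
    siteOp d n (A + B) = siteOp d n A + siteOp d n B := by
  ext h h'
  simp only [siteOp, Matrix.of_apply, Matrix.add_apply]
  split_ifs <;> simp

theorem siteOp_smul (n : Fin N) (c : ℂ) (A : Matrix (Fin (d n + 1)) (Fin (d n + 1)) ℂ) :
    siteOp d n (c • A) = c • siteOp d n A := by
  ext h h'
  simp [siteOp, Matrix.of_apply, Matrix.smul_apply]

theorem siteOp_sub (n : Fin N) (A B : Matrix (Fin (d n + 1)) (Fin (d n + 1)) ℂ) :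
    siteOp d n (A - B) = siteOp d n A - siteOp d n B := by
  rw [sub_eq_add_neg, ← neg_one_smul ℂ B, siteOp_add, siteOp_smul, neg_one_smul, sub_eq_add_neg]

theorem siteOp_mul_siteOp_apply {n m : Fin N} (hnm : n ≠ m)
    (A : Matrix (Fin (d n + 1)) (Fin (d n + 1)) ℂ) (B : Matrix (Fin (d m + 1)) (Fin (d m + 1)) ℂ)
    (h h' : Conf d) : (siteOp d n A * siteOp d m B) h h' =
      if ∀ k, k ≠ n → k ≠ m → h k = h' k then A (h n) (h' n) * B (h m) (h' m) else 0 := by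
  rw [Matrix.mul_apply, Finset.sum_eq_single (Function.update h n (h' n))]
  · simp only [siteOp, Matrix.of_apply]
    rw [if_pos fun k hk => by simp [hk]]
    simp only [Function.update_self, Function.update_of_ne hnm.symm]
    by_cases hh : ∀ k, k ≠ n → k ≠ m → h k = h' k
    · rw [if_pos hh, if_pos]
      intro k hk
      by_cases hkn : k = n
      · subst hkn; simp
      · simp [hkn, hh k hkn hk]
    · rw [if_neg hh, if_neg, mul_zero]
      intro h1
      exact hh fun k hkn hk => by simpa [hkn] using h1 k hk
  · intro g _ hg
    simp only [siteOp, Matrix.of_apply]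
    by_cases h1 : ∀ k, k ≠ n → h k = g k
    · rw [if_neg (c := ∀ k, k ≠ m → g k = h' k), mul_zero]
      intro h2
      refine hg (funext fun k => ?_)
      by_cases hkn : k = n
      · subst hkn; simp [h2 k hnm]
      · simp [hkn, h1 k hkn]
    · rw [if_neg h1, zero_mul]
  · simp

theorem siteOp_commute {n m : Fin N} (hnm : n ≠ m)
    (A : Matrix (Fin (d n + 1)) (Fin (d n + 1)) ℂ)
    (B : Matrix (Fin (d m + 1)) (Fin (d m + 1)) ℂ) :
    Commute (siteOp d n A) (siteOp d m B) := by
  ext h h'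
  rw [siteOp_mul_siteOp_apply hnm, siteOp_mul_siteOp_apply hnm.symm, mul_comm]
  exact if_congr ⟨fun H k a b => H k b a, fun H k a b => H k b a⟩ rfl rfl

/-- The product covector with the given local factors. -/
def prodCovector (w : (n : Fin N) → Fin (d n + 1) → ℂ) : Conf d → ℂ := fun h => ∏ n, w n (h n)

theorem prodCovector_vecMul_siteOp (w : (n : Fin N) → Fin (d n + 1) → ℂ) (n : Fin N)
    (A : Matrix (Fin (d n + 1)) (Fin (d n + 1)) ℂ) (c : ℂ)
    (hA : Matrix.vecMul (w n) A = c • w n) :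
    Matrix.vecMul (prodCovector w) (siteOp d n A) = c • prodCovector w := by
  ext h'
  have hs : Matrix.vecMul (prodCovector w) (siteOp d n A) h' =
      ∑ j, prodCovector w (Function.update h' n j) * A j (h' n) := by
    rw [Matrix.vecMul, dotProduct]
    symm
    refine Fintype.sum_of_injective (fun j => Function.update h' n j)
      (Function.update_injective h' n) _ _ (fun g hg => ?_) fun j => ?_
    · simp only [siteOp, Matrix.of_apply]
      rw [if_neg, mul_zero]
      intro hg'
      refine hg ⟨g n, ?_⟩
      ext m
      by_cases hm : m = n
      · subst hm; simp
      · simp [hm, hg' m hm]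
    · simp only [siteOp, Matrix.of_apply]
      rw [if_pos fun m hm => by simp [hm]]
      simp
  have hp (j : Fin (d n + 1)) : prodCovector w (Function.update h' n j) =
      w n j * ∏ m ∈ Finset.univ.erase n, w m (h' m) := by
    rw [prodCovector, ← Finset.mul_prod_erase _ _ (Finset.mem_univ n), Function.update_self]
    congr 1
    refine Finset.prod_congr rfl fun m hm => ?_
    rw [Function.update_of_ne (Finset.ne_of_mem_erase hm)]
  rw [hs]
  have := congrFun hA (h' n)
  rw [Matrix.vecMul, dotProduct] at this
  have h2 := hp (h' n)
  rw [Function.update_eq_self] at h2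
  simp only [Pi.smul_apply, smul_eq_mul, h2, hp] at this ⊢
  rw [← mul_assoc, ← this, Finset.sum_mul]
  exact Finset.sum_congr rfl fun j _ => by ring

end Sites

/-! ### Spin matrices and the extremal covector -/

section Spin

theorem Sp_apply_sq (m : ℕ) (i j : Fin (m + 1)) (hij : (i : ℕ) + 1 = j) :
    Sp m i j * Sp m i j = (j : ℂ) * (m + 1 - j) := by
  simp only [Sp, Matrix.of_apply, if_pos hij]
  rw [← Complex.ofReal_mul, Real.mul_self_sqrt]
  · push_cast; rfl
  · have : (j : ℝ) ≤ m + 1 := by exact_mod_cast j.2.le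
    have h0 : (0 : ℝ) ≤ (j : ℕ) := Nat.cast_nonneg _
    exact mul_nonneg h0 (by linarith)

theorem Sp_apply_of_ne (m : ℕ) (i j : Fin (m + 1)) (hij : (i : ℕ) + 1 ≠ j) : Sp m i j = 0 := by
  simp [Sp, hij]

theorem Sp_mul_Sm (m : ℕ) :
    Sp m * Sm m = Matrix.diagonal fun i : Fin (m + 1) => ((i : ℕ) + 1 : ℂ) * (m - (i : ℕ)) := by
  ext i j
  rw [Matrix.mul_apply]
  by_cases hi : (i : ℕ) + 1 < m + 1
  · rw [Finset.sum_eq_single (⟨i + 1, hi⟩ : Fin (m + 1))]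
    · by_cases hij : i = j
      · subst hij
        rw [Matrix.diagonal_apply_eq, Sm, Matrix.transpose_apply, Sp_apply_sq _ _ _ rfl]
        push_cast; ring
      · rw [Matrix.diagonal_apply_ne _ hij, Sm, Matrix.transpose_apply, Sp_apply_of_ne m j,
          mul_zero]
        intro h
        exact hij (Fin.ext (by simpa using h.symm))
    · intro k _ hk
      rw [Sp_apply_of_ne, zero_mul]
      intro h
      exact hk (Fin.ext h.symm)
    · simp
  · rw [Finset.sum_eq_zero]
    · have : (i : ℕ) = m := by omega
      by_cases hij : i = j
      · subst hij; simp [this]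
      · rw [Matrix.diagonal_apply_ne _ hij]
    · intro k _
      rw [Sp_apply_of_ne, zero_mul]
      omega

theorem Sm_mul_Sp (m : ℕ) :
    Sm m * Sp m = Matrix.diagonal fun i : Fin (m + 1) => ((i : ℕ) : ℂ) * (m + 1 - (i : ℕ)) := by
  ext i j
  rw [Matrix.mul_apply]
  by_cases hi : 0 < (i : ℕ)
  · have hi' : (i : ℕ) - 1 < m + 1 := by omega
    rw [Finset.sum_eq_single (⟨i - 1, hi'⟩ : Fin (m + 1))]
    · by_cases hij : i = j
      · subst hij
        rw [Matrix.diagonal_apply_eq, Sm, Matrix.transpose_apply, Sp_apply_sq]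
        simp only; omega
      · rw [Matrix.diagonal_apply_ne _ hij, Sp_apply_of_ne m _ j, mul_zero]
        intro h
        simp only at h
        exact hij (Fin.ext (by omega))
    · intro k _ hk
      rw [Sm, Matrix.transpose_apply, Sp_apply_of_ne, zero_mul]
      intro h
      exact hk (Fin.ext (by simp only; omega))
    · simp
  · rw [Finset.sum_eq_zero]
    · have : (i : ℕ) = 0 := by omega
      by_cases hij : i = j
      · subst hij; simp [this]
      · rw [Matrix.diagonal_apply_ne _ hij]
    · intro k _
      rw [Sm, Matrix.transpose_apply, Sp_apply_of_ne, zero_mul]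
      omega

theorem Sp_Sm_comm (m : ℕ) : Sp m * Sm m - Sm m * Sp m = (2 : ℂ) • Sz m := by
  rw [Sp_mul_Sm, Sm_mul_Sp, Sz, Matrix.diagonal_sub, ← Matrix.diagonal_smul]
  congr 1
  ext i
  simp only [Pi.smul_apply, smul_eq_mul]
  ring

theorem Sz_Sp_comm (m : ℕ) : Sz m * Sp m - Sp m * Sz m = Sp m := by
  ext i j
  rw [Matrix.sub_apply, Sz, Matrix.diagonal_mul, Matrix.mul_diagonal]
  by_cases hij : (i : ℕ) + 1 = j
  · rw [← hij]; push_cast; ring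
  · rw [Sp_apply_of_ne m i j hij]; ring

theorem Sz_Sm_comm (m : ℕ) : Sz m * Sm m - Sm m * Sz m = - Sm m := by
  have h := congrArg Matrix.transpose (Sz_Sp_comm m)
  rw [Matrix.transpose_sub, Matrix.transpose_mul, Matrix.transpose_mul] at h
  have hz : (Sz m).transpose = Sz m := by rw [Sz, Matrix.diagonal_transpose]
  rw [hz] at h
  rw [Sm, ← neg_sub, h]

/-- Components of the covector extremal for the spin algebra rotated by `[[1, g], [0, 1]]`. -/
noncomputable def extremal (m : ℕ) (g : ℂ) : ℕ → ℂ
  | 0 => 1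
  | j + 1 => -g * ((Real.sqrt (((j + 1 : ℕ) : ℝ) * ((m : ℝ) + 1 - ((j + 1 : ℕ) : ℝ))) : ℝ) : ℂ) /
      ((j : ℂ) + 1) * extremal m g j

theorem extremal_succ (m : ℕ) (g : ℂ) (i j : Fin (m + 1)) (hij : (i : ℕ) + 1 = j) :
    extremal m g j = -g * Sp m i j / (j : ℂ) * extremal m g i := by
  simp only [Sp, Matrix.of_apply, if_pos hij]
  rw [← hij, extremal]
  push_cast
  rfl

theorem extremal_vecMul_Sp (m : ℕ) (g : ℂ) (j : Fin (m + 1)) :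
    g * Matrix.vecMul (fun i : Fin (m + 1) => extremal m g i) (Sp m) j =
      - (j : ℂ) * extremal m g j := by
  rw [Matrix.vecMul, dotProduct]
  by_cases hj : 0 < (j : ℕ)
  · have hj' : (j : ℕ) - 1 < m + 1 := by omega
    have hs : ((⟨j - 1, hj'⟩ : Fin (m + 1)) : ℕ) + 1 = j := by simp only; omega
    rw [Finset.sum_eq_single (⟨j - 1, hj'⟩ : Fin (m + 1)), extremal_succ m g _ j hs]
    · have : ((j : ℕ) : ℂ) ≠ 0 := by exact_mod_cast hj.ne'
      field_simp
    · intro k _ hk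
      rw [Sp_apply_of_ne, mul_zero]
      intro h
      exact hk (Fin.ext (by simp only; omega))
    · simp
  · rw [Finset.sum_eq_zero]
    · have : (j : ℕ) = 0 := by omega
      simp [this]
    · intro k _
      rw [Sp_apply_of_ne, mul_zero]
      omega

/-- The recursion contributes one square root and `Sm` the other; their product j (m + 1 - j)
cancels the denominator of the recursion. The last component needs no neighbour, because its
coefficient m - j is zero. -/
theorem extremal_vecMul_Sm (m : ℕ) (g : ℂ) (j : Fin (m + 1)) :
    Matrix.vecMul (fun i : Fin (m + 1) => extremal m g i) (Sm m) j =
      - g * (m - (j : ℂ)) * extremal m g j := by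
  rw [Matrix.vecMul, dotProduct]
  by_cases hj : (j : ℕ) + 1 < m + 1
  · rw [Finset.sum_eq_single (⟨j + 1, hj⟩ : Fin (m + 1)), extremal_succ m g j ⟨j + 1, hj⟩ rfl]
    · have : ((j : ℕ) : ℂ) + 1 ≠ 0 := by exact_mod_cast (Nat.succ_ne_zero j)
      rw [Sm, Matrix.transpose_apply]
      have h2 := Sp_apply_sq m j ⟨j + 1, hj⟩ rfl
      push_cast at h2 ⊢
      field_simp
      rw [pow_two, h2]
      ring
    · intro k _ hk
      rw [Sm, Matrix.transpose_apply, Sp_apply_of_ne, mul_zero]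
      intro h
      exact hk (Fin.ext h.symm)
    · simp
  · rw [Finset.sum_eq_zero]
    · have : (j : ℕ) = m := by omega
      simp [this]
    · intro k _
      rw [Sm, Matrix.transpose_apply, Sp_apply_of_ne, mul_zero]
      omega

theorem vecMul_Sz (m : ℕ) (w : Fin (m + 1) → ℂ) (j : Fin (m + 1)) :
    Matrix.vecMul w (Sz m) j = ((m : ℂ) / 2 - (j : ℂ)) * w j := by
  rw [Sz, Matrix.vecMul_diagonal, mul_comm]

end Spin

end HigherSpin

namespace HigherSpin

/-! ### Lax operators, the monodromy matrix and its reference covector -/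

section Lax

variable {N : ℕ} (d : Fin N → ℕ) (η : ℂ) (ξ : Fin N → ℂ)

/-- The `gl₂` generators at the site `n`. -/
noncomputable def spinAux (n : Fin N) : Matrix (Fin 2) (Fin 2) (Op d) :=
  !![siteOp d n (Sz (d n)), siteOp d n (Sm (d n)); siteOp d n (Sp (d n)), - siteOp d n (Sz (d n))]

theorem lax_eq (n : Fin N) (x : ℂ) :
    lax d η n x = scalarAux (Op d) ((x - -(η / 2)) • 1) + η • spinAux d n := by
  ext1 i j
  fin_cases i <;> fin_cases j <;>
    simp [lax, spinAux, scalarAux_apply, siteOp_add, siteOp_sub, siteOp_smul, siteOp_one]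
  abel

theorem lax_rtt (n : Fin N) (c : ℂ) : RTT η fun x => lax d η n (x - c) := by
  have h := RTT.of_gl2 (R := Op d) η (spinAux d n) ?_ (c - η / 2)
  · have e : (fun x => lax d η n (x - c)) =
        fun x => scalarAux (Op d) ((x - (c - η / 2)) • 1) + η • spinAux d n := by
      funext x
      rw [lax_eq]
      congr 3
      ring
    rw [e]
    exact h
  · have hz : Commute (siteOp d n (Sz (d n))) (siteOp d n (Sz (d n))) := Commute.refl _
    have h1 := congrArg (siteOp d n) (Sp_Sm_comm (d n))
    have h2 := congrArg (siteOp d n) (Sz_Sp_comm (d n))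
    have h3 := congrArg (siteOp d n) (Sz_Sm_comm (d n))
    rw [← neg_one_smul ℂ (Sm (d n))] at h3
    rw [siteOp_sub, siteOp_mul, siteOp_mul] at h1 h2 h3
    rw [siteOp_smul] at h1 h3
    rw [sub_eq_iff_eq_add] at h1 h2 h3
    intro i j k l
    fin_cases i <;> fin_cases j <;> fin_cases k <;> fin_cases l <;>
      simp [spinAux, h1, h2, h3] <;> module

theorem lax_entriesCommute {n m : Fin N} (h : n ≠ m) (x y : ℂ) :
    EntriesCommute (lax d η n x) (lax d η m y) := by
  intro i j k l
  fin_cases i <;> fin_cases j <;> fin_cases k <;> fin_cases l <;> exact siteOp_commute h _ _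

/-- This is the Casimir of the spin algebra: Sm Sp is diagonal, and its quadratic dependence on the
weight cancels against the product of the diagonal entries. -/
theorem lax_qminor (n : Fin N) (c x : ℂ) : qminor η (fun x => lax d η n (x - c)) x 0 1 0 1 =
    ((x - (c - η / 2) + (d n : ℂ) / 2 * η) * (x - η - (c - η / 2) - (d n : ℂ) / 2 * η)) •
      (1 : Op d) := by
  simp only [qminor, lax, Matrix.of_apply, Matrix.cons_val', Matrix.cons_val_zero,
    Matrix.cons_val_one, Matrix.cons_val_fin_one]
  rw [← siteOp_mul, ← siteOp_mul, ← siteOp_sub, ← siteOp_one n, ← siteOp_smul]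
  congr 1
  rw [smul_mul_smul_comm, Sm_mul_Sp, Sz]
  simp only [Matrix.smul_one_eq_diagonal, ← Matrix.diagonal_smul, Matrix.diagonal_add,
    Matrix.diagonal_sub, Matrix.diagonal_mul_diagonal]
  congr 1
  ext i
  simp only [Pi.smul_apply, smul_eq_mul]
  ring

/-- Ordered product of the Lax operators at the sites in a list. -/
noncomputable def laxProd (L : List (Fin N)) (x : ℂ) : Matrix (Fin 2) (Fin 2) (Op d) :=
  (L.map fun n => lax d η n (x - ξ n)).prod

theorem laxProd_cons (n : Fin N) (L : List (Fin N)) :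
    laxProd d η ξ (n :: L) = fun x => lax d η n (x - ξ n) * laxProd d η ξ L x := by
  funext x
  rw [laxProd, List.map_cons, List.prod_cons, laxProd]

theorem laxProd_nil : laxProd d η ξ [] = fun _ => scalarAux (Op d) 1 := by
  funext x
  ext1 i j
  rw [laxProd, List.map_nil, List.prod_nil, scalarAux_apply, Matrix.one_apply, Matrix.one_apply]
  split_ifs <;> simp

theorem lax_entriesCommute_laxProd {n : Fin N} {L : List (Fin N)} (h : n ∉ L) (x y : ℂ) :
    EntriesCommute (lax d η n x) (laxProd d η ξ L y) := by
  induction L with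
  | nil => rw [laxProd_nil]; exact (entriesCommute_scalarAux _ _).symm
  | cons m L ih =>
    rw [List.mem_cons, not_or] at h
    rw [laxProd_cons]
    exact (lax_entriesCommute d η h.1 _ _).mul_right (ih h.2)

theorem laxProd_rtt {L : List (Fin N)} (hL : L.Nodup) : RTT η (laxProd d η ξ L) := by
  induction L with
  | nil => rw [laxProd_nil]; exact rtt_scalarAux _ _
  | cons n L ih =>
    rw [List.nodup_cons] at hL
    rw [laxProd_cons]
    exact (lax_rtt d η n (ξ n)).mul (ih hL.2) fun x y => lax_entriesCommute_laxProd d η ξ hL.1 _ _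

theorem laxProd_qminor (hη : η ≠ 0) {L : List (Fin N)} (hL : L.Nodup) (x : ℂ) :
    qminor η (laxProd d η ξ L) x 0 1 0 1 =
      (L.map fun n => (x - (ξ n - η / 2) + (d n : ℂ) / 2 * η) *
        (x - η - (ξ n - η / 2) - (d n : ℂ) / 2 * η)).prod • (1 : Op d) := by
  induction L with
  | nil => rw [laxProd_nil, qminor_scalarAux]; simp
  | cons n L ih =>
    rw [List.nodup_cons] at hL
    rw [laxProd_cons, (laxProd_rtt d η ξ hL.2).qminor_mul hη
      fun x y => lax_entriesCommute_laxProd d η ξ hL.1 _ _, lax_qminor, ih hL.2, List.map_cons,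
      List.prod_cons, smul_mul_smul_comm, one_mul]

/-- The extremal covector of the quantum space. -/
noncomputable def refCovector (g : ℂ) : Conf d → ℂ :=
  prodCovector fun n (i : Fin (d n + 1)) => extremal (d n) g i

theorem refCovector_ne_zero (g : ℂ) : refCovector d g ≠ 0 := by
  intro h
  have := congrFun h fun _ => 0
  simp [refCovector, prodCovector, extremal] at this

/-- The covector is extremal for the spin algebra rotated so that the auxiliary vector (g, 1) is
preserved: both rows then reduce to the lowest weight -s_n. -/
theorem lax_vecMul_ref (g : ℂ) (n : Fin N) (x : ℂ) (i : Fin 2) :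
    Matrix.vecMul (refCovector d g) (∑ p, (![g, 1] : Fin 2 → ℂ) p • lax d η n (x - ξ n) i p) =
      ((x - (ξ n - η / 2) - (d n : ℂ) / 2 * η) * (![g, 1] : Fin 2 → ℂ) i) • refCovector d g := by
  have e1 := extremal_vecMul_Sp (d n) g
  have e2 := extremal_vecMul_Sm (d n) g
  have e3 := vecMul_Sz (d n) fun i : Fin (d n + 1) => extremal (d n) g i
  rw [Fin.sum_univ_two]
  fin_cases i
  · simp only [lax, Matrix.of_apply, Matrix.cons_val', Matrix.cons_val_zero,
      Matrix.cons_val_one, Matrix.cons_val_fin_one, Fin.zero_eta]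
    rw [← siteOp_smul, ← siteOp_smul, ← siteOp_add]
    refine prodCovector_vecMul_siteOp _ n _ _ ?_
    ext j
    simp only [Matrix.vecMul_add, Matrix.vecMul_smul, Pi.add_apply, Pi.smul_apply, smul_eq_mul,
      Matrix.vecMul_one, e2, e3, smul_add]
    ring
  · simp only [lax, Matrix.of_apply, Matrix.cons_val', Matrix.cons_val_zero,
      Matrix.cons_val_one, Matrix.cons_val_fin_one, Fin.mk_one]
    rw [← siteOp_smul, ← siteOp_smul, ← siteOp_add]
    refine prodCovector_vecMul_siteOp _ n _ _ ?_
    ext j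
    simp only [Matrix.vecMul_add, Matrix.vecMul_sub, Matrix.vecMul_smul, Pi.add_apply,
      Pi.sub_apply, Pi.smul_apply, smul_eq_mul, Matrix.vecMul_one, e3]
    linear_combination η * e1 j

/-- Entries at different sites commute, so the tail of the product may act on the covector first. It
returns the same auxiliary vector (g, 1), on which the head factor then acts. -/
theorem laxProd_vecMul_ref (g : ℂ) {L : List (Fin N)} (hL : L.Nodup) (x : ℂ) (i : Fin 2) :
    Matrix.vecMul (refCovector d g) (∑ p, (![g, 1] : Fin 2 → ℂ) p • laxProd d η ξ L x i p) =
      ((L.map fun n => x - (ξ n - η / 2) - (d n : ℂ) / 2 * η).prod * (![g, 1] : Fin 2 → ℂ) i) •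
        refCovector d g := by
  induction L generalizing i with
  | nil =>
    rw [laxProd_nil]
    fin_cases i <;> simp [scalarAux_apply, Fin.sum_univ_two, Matrix.vecMul_smul]
  | cons n L ih =>
    rw [List.nodup_cons] at hL
    have hc := lax_entriesCommute_laxProd d η ξ hL.1 (x - ξ n) x
    have h1 : ∑ p, (![g, 1] : Fin 2 → ℂ) p • laxProd d η ξ (n :: L) x i p =
        ∑ q, (∑ p, (![g, 1] : Fin 2 → ℂ) p • laxProd d η ξ L x q p) * lax d η n (x - ξ n) i q := by
      rw [laxProd_cons]
      simp only [Matrix.mul_apply, Fin.sum_univ_two, (hc _ _ _ _).eq, smul_add, add_mul,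
        smul_mul_assoc]
      abel
    have h2 := lax_vecMul_ref d η ξ g n x i
    rw [Fin.sum_univ_two, Matrix.vecMul_add, Matrix.vecMul_smul, Matrix.vecMul_smul] at h2
    rw [h1, Fin.sum_univ_two, Matrix.vecMul_add, ← Matrix.vecMul_vecMul, ← Matrix.vecMul_vecMul,
      ih hL.2, ih hL.2, Matrix.smul_vecMul, Matrix.smul_vecMul, mul_smul, mul_smul, ← smul_add, h2,
      smul_smul, List.map_cons, List.prod_cons]
    congr 1
    ring

/-- The monodromy matrix without twist. -/
noncomputable def untwisted (x : ℂ) : Matrix (Fin 2) (Fin 2) (Op d) :=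
  laxProd d η ξ (List.finRange N).reverse x

theorem nodup_sites : (List.finRange N).reverse.Nodup :=
  List.nodup_reverse.2 (List.nodup_finRange N)

theorem prod_map_sites (f : Fin N → ℂ) : ((List.finRange N).reverse.map f).prod = ∏ n, f n := by
  rw [List.map_reverse, List.prod_reverse, ← List.ofFn_eq_map, List.prod_ofFn]

theorem monodromy_eq (K : Matrix (Fin 2) (Fin 2) ℂ) (x : ℂ) :
    monodromy d η ξ K x = scalarAux (Op d) K * untwisted d η ξ x := by
  rw [monodromy, untwisted, laxProd, List.ofFn_eq_map, List.map_reverse]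
  rfl

theorem monodromy_rtt (K : Matrix (Fin 2) (Fin 2) ℂ) : RTT η (monodromy d η ξ K) := by
  have e : monodromy d η ξ K = fun x => scalarAux (Op d) K * untwisted d η ξ x :=
    funext (monodromy_eq d η ξ K)
  rw [e]
  exact (rtt_scalarAux η K).mul (laxProd_rtt d η ξ nodup_sites)
    fun _ _ => entriesCommute_scalarAux _ _

theorem monodromy_qminor (hη : η ≠ 0) (K : Matrix (Fin 2) (Fin 2) ℂ) (x : ℂ) :
    qminor η (monodromy d η ξ K) x 0 1 0 1 =
      (K.det * (aFun d η ξ x * dFun d η ξ (x - η))) • (1 : Op d) := by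
  have e : monodromy d η ξ K = fun x => scalarAux (Op d) K * untwisted d η ξ x :=
    funext (monodromy_eq d η ξ K)
  have hu : qminor η (untwisted d η ξ) x 0 1 0 1 =
      (aFun d η ξ x * dFun d η ξ (x - η)) • (1 : Op d) := by
    have := laxProd_qminor d η ξ hη nodup_sites x
    rw [prod_map_sites, Finset.prod_mul_distrib] at this
    exact this
  have hr : RTT η (untwisted d η ξ) := laxProd_rtt d η ξ nodup_sites
  rw [e, hr.qminor_mul hη (X := fun _ => scalarAux (Op d) K)
    fun _ _ => entriesCommute_scalarAux _ _, qminor_scalarAux, hu, smul_mul_smul_comm, one_mul]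

theorem qdet_eq (hη : η ≠ 0) (K : Matrix (Fin 2) (Fin 2) ℂ) (x : ℂ) :
    qdet d η ξ K x = (K.det * (aFun d η ξ x * dFun d η ξ (x - η))) • (1 : Op d) :=
  monodromy_qminor d η ξ hη K x

theorem untwisted_vecMul_ref (g x : ℂ) (i : Fin 2) :
    Matrix.vecMul (refCovector d g) (∑ p, (![g, 1] : Fin 2 → ℂ) p • untwisted d η ξ x i p) =
      (dFun d η ξ x * (![g, 1] : Fin 2 → ℂ) i) • refCovector d g := by
  have := laxProd_vecMul_ref d η ξ g nodup_sites x i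
  rw [prod_map_sites] at this
  exact this

end Lax

/-! ### Polynomial dependence on the spectral parameter -/

section TopCoeff

/-- `f` is polynomial of degree at most `n` with coefficient `c` in degree `n`. -/
def HasTopCoeff {V : Type*} [AddCommGroup V] [Module ℂ V] (n : ℕ) (f : ℂ → V) (c : V) : Prop :=
  ∃ g : ℕ → V, ∀ x, f x = (∑ k ∈ Finset.range n, x ^ k • g k) + x ^ n • c

theorem HasTopCoeff.map {V W : Type*} [AddCommGroup V] [Module ℂ V] [AddCommGroup W] [Module ℂ W]
    {n : ℕ} {f : ℂ → V} {c : V} (h : HasTopCoeff n f c) (φ : V →ₗ[ℂ] W) :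
    HasTopCoeff n (fun x => φ (f x)) (φ c) := by
  obtain ⟨g, hg⟩ := h
  exact ⟨fun k => φ (g k), fun x => by simp [hg x]⟩

theorem HasTopCoeff.linear_mul {R : Type*} [Ring R] [Algebra ℂ R] {n : ℕ} {f : ℂ → R} {c : R}
    (h : HasTopCoeff n f c) (e : R) : HasTopCoeff (n + 1) (fun x => (x • 1 + e) * f x) c := by
  obtain ⟨g, hg⟩ := h
  -- The coefficient of degree k is e times the old coefficient of degree k, which is `c` when k =
  -- n, plus the old coefficient of degree k - 1, absent when k = 0.
  refine ⟨fun k => (if k < n then e * g k else e * c) + if k = 0 then 0 else g (k - 1),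
    fun x => ?_⟩
  have hs : ∑ k ∈ Finset.range n, x ^ k • (if k < n then e * g k else e * c) =
      ∑ k ∈ Finset.range n, x ^ k • (e * g k) :=
    Finset.sum_congr rfl fun k hk => by rw [if_pos (Finset.mem_range.1 hk)]
  simp only [hg x, smul_add, Finset.sum_add_distrib]
  rw [Finset.sum_range_succ, if_neg (lt_irrefl n), hs, Finset.sum_range_succ', if_pos rfl,
    smul_zero, add_zero]
  simp only [Nat.succ_ne_zero, if_false, Nat.add_sub_cancel, add_mul, mul_add, smul_mul_assoc,
    one_mul, mul_smul_comm, Finset.mul_sum, smul_add, Finset.sum_add_distrib, smul_smul, pow_succ]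
  abel

theorem HasTopCoeff.exists_polynomial {n : ℕ} {f : ℂ → ℂ} {c : ℂ} (h : HasTopCoeff n f c) :
    ∃ p : Polynomial ℂ, p.natDegree ≤ n ∧ p.coeff n = c ∧ ∀ x, f x = p.eval x := by
  obtain ⟨g, hg⟩ := h
  refine ⟨(∑ k ∈ Finset.range n, Polynomial.C (g k) * Polynomial.X ^ k) +
    Polynomial.C c * Polynomial.X ^ n, ?_, ?_, fun x => ?_⟩
  · refine Polynomial.natDegree_add_le_of_degree_le ?_ (Polynomial.natDegree_C_mul_X_pow_le _ _)
    refine Polynomial.natDegree_sum_le_of_forall_le _ _ fun k hk => ?_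
    exact (Polynomial.natDegree_C_mul_X_pow_le _ _).trans (Finset.mem_range.1 hk).le
  · rw [Polynomial.coeff_add, Polynomial.finsetSum_coeff, Finset.sum_eq_zero]
    · simp
    · intro k hk
      rw [Polynomial.coeff_C_mul_X_pow, if_neg (Finset.mem_range.1 hk).ne']
  · rw [hg x]
    simp only [Polynomial.eval_add, Polynomial.eval_finsetSum, Polynomial.eval_mul, Polynomial.eval_C,
      Polynomial.eval_X_pow, smul_eq_mul, mul_comm (x ^ _)]

variable {N : ℕ} (d : Fin N → ℕ) (η : ℂ) (ξ : Fin N → ℂ)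

theorem laxProd_hasTopCoeff (L : List (Fin N)) : HasTopCoeff L.length (laxProd d η ξ L) 1 := by
  induction L with
  | nil => exact ⟨0, fun x => by simp [laxProd]⟩
  | cons n L ih =>
    have hl (x : ℂ) : lax d η n (x - ξ n) =
        x • 1 + (scalarAux (Op d) ((-ξ n - -(η / 2)) • 1) + η • spinAux d n) := by
      rw [lax_eq, ← add_assoc]
      congr 1
      ext1 i j
      simp only [scalarAux_apply, Matrix.add_apply, Matrix.smul_apply, smul_eq_mul]
      by_cases hij : i = j
      · subst hij
        simp only [Matrix.one_apply_eq]
        module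
      · simp [Matrix.one_apply_ne hij]
    rw [laxProd_cons, List.length_cons]
    simp only [hl]
    exact ih.linear_mul _

theorem untwisted_hasTopCoeff : HasTopCoeff N (untwisted d η ξ) 1 := by
  have := laxProd_hasTopCoeff d η ξ (List.finRange N).reverse
  rwa [List.length_reverse, List.length_finRange] at this

theorem monodromy_hasTopCoeff (K : Matrix (Fin 2) (Fin 2) ℂ) :
    HasTopCoeff N (monodromy d η ξ K) (scalarAux (Op d) K) := by
  have := (untwisted_hasTopCoeff d η ξ).map (LinearMap.mulLeft ℂ (scalarAux (Op d) K))
  simp only [LinearMap.mulLeft_apply, mul_one, ← monodromy_eq] at this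
  exact this

theorem monodromy_exists_polynomial (K : Matrix (Fin 2) (Fin 2) ℂ) (i j : Fin 2) (h h' : Conf d) :
    ∃ p : Polynomial ℂ, ∀ x, monodromy d η ξ K x i j h h' = p.eval x := by
  have := (monodromy_hasTopCoeff d η ξ K).map
    ((Matrix.entryLinearMap ℂ ℂ h h').comp (Matrix.entryLinearMap ℂ (Op d) i j))
  obtain ⟨p, -, -, hp⟩ := this.exists_polynomial
  exact ⟨p, hp⟩

theorem monodromy_continuous (K : Matrix (Fin 2) (Fin 2) ℂ) (i j : Fin 2) :
    Continuous fun x => monodromy d η ξ K x i j := by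
  refine continuous_matrix fun h h' => ?_
  obtain ⟨p, hp⟩ := monodromy_exists_polynomial d η ξ K i j h h'
  simp only [hp]
  exact p.continuous

/-- Since the leading coefficient depends on the trace of the twist only, a matrix element of the
transfer matrix is determined by its values at N distinct points. -/
theorem transfer_exists_polynomial (K : Matrix (Fin 2) (Fin 2) ℂ) (u v : Conf d → ℂ) :
    ∃ p : Polynomial ℂ, p.natDegree ≤ N ∧ p.coeff N = K.trace * (u ⬝ᵥ v) ∧
      ∀ x, u ⬝ᵥ (transfer d η ξ K x).mulVec v = p.eval x := by
  let φ : Matrix (Fin 2) (Fin 2) (Op d) →ₗ[ℂ] ℂ :=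
    { toFun := fun A => u ⬝ᵥ A.trace.mulVec v
      map_add' := fun A B => by rw [Matrix.trace_add, Matrix.add_mulVec, dotProduct_add]
      map_smul' := fun c A => by
        rw [Matrix.trace_smul, Matrix.smul_mulVec, dotProduct_smul, RingHom.id_apply] }
  obtain ⟨p, h1, h2, h3⟩ := ((monodromy_hasTopCoeff d η ξ K).map φ).exists_polynomial
  refine ⟨p, h1, h2.trans ?_, h3⟩
  change u ⬝ᵥ (scalarAux (Op d) K).trace.mulVec v = _
  have : (scalarAux (Op d) K).trace = K.trace • (1 : Op d) := by
    simp only [Matrix.trace, Matrix.diag_apply, scalarAux_apply, Finset.sum_smul]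
  rw [this, Matrix.smul_mulVec, Matrix.one_mulVec, dotProduct_smul, smul_eq_mul]

end TopCoeff

end HigherSpin

namespace HigherSpin

/-! ### Matrix elements of the symmetric projector -/

section Symmetrizer

/-- Number of coordinates equal to `1`. -/
def ones {l : ℕ} (i : Fin l → Fin 2) : ℕ := ∑ m, (i m : ℕ)

theorem ones_eq_card {l : ℕ} (i : Fin l → Fin 2) :
    ones i = (Finset.univ.filter fun m => i m = 1).card := by
  rw [ones, Finset.card_filter]
  refine Finset.sum_congr rfl fun m _ => ?_
  generalize i m = a
  fin_cases a <;> rfl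

theorem ones_le {l : ℕ} (i : Fin l → Fin 2) : ones i ≤ l := by
  rw [ones_eq_card]
  exact (Finset.card_le_univ _).trans_eq (Fintype.card_fin l)

theorem ones_cons {l : ℕ} (a : Fin 2) (i : Fin l → Fin 2) :
    ones (Fin.cons a i : Fin (l + 1) → Fin 2) = a + ones i := by
  rw [ones, Fin.sum_univ_succ]
  simp [ones]

theorem card_fiber_one {l : ℕ} (i : Fin l → Fin 2) :
    Fintype.card {m // i m = 1} = ones i := by
  rw [ones_eq_card, Fintype.card_subtype]

theorem card_fiber_zero {l : ℕ} (i : Fin l → Fin 2) :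
    Fintype.card {m // i m = 0} = l - ones i := by
  have h : Fintype.card {m // ¬ i m = 1} = _ := Fintype.card_subtype_compl fun m => i m = 1
  rw [card_fiber_one, Fintype.card_fin] at h
  rw [← h]
  refine Fintype.card_congr (Equiv.subtypeEquivRight fun m => ?_)
  generalize i m = a
  fin_cases a <;> simp

theorem ones_comp {l : ℕ} (i : Fin l → Fin 2) (π : Equiv.Perm (Fin l)) : ones (i ∘ π) = ones i :=
  Equiv.sum_comp π fun m => (i m : ℕ)

theorem exists_perm_of_ones_eq {l : ℕ} {i i' : Fin l → Fin 2} (h : ones i = ones i') :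
    ∃ π : Equiv.Perm (Fin l), i = i' ∘ π := by
  have e : ∀ c, Fintype.card {m // i m = c} = Fintype.card {m // i' m = c} := by
    intro c
    fin_cases c
    · change Fintype.card {m // i m = 0} = Fintype.card {m // i' m = 0}
      rw [card_fiber_zero, card_fiber_zero, h]
    · change Fintype.card {m // i m = 1} = Fintype.card {m // i' m = 1}
      rw [card_fiber_one, card_fiber_one, h]
  refine ⟨Equiv.ofFiberEquiv fun c => Fintype.equivOfCardEq (e c), ?_⟩
  exact funext fun m => (Equiv.ofFiberEquiv_map _ m).symm

/-- These permutations form a coset of the stabilizer of `i'`, which permutes the zeros and the ones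
separately. -/
theorem card_perm_comp_eq {l : ℕ} {i i' : Fin l → Fin 2} (h : ones i = ones i') :
    Fintype.card {π : Equiv.Perm (Fin l) // i = i' ∘ π} =
      (l - ones i).factorial * (ones i).factorial := by
  obtain ⟨σ, rfl⟩ := exists_perm_of_ones_eq h
  have hc := DomMulAct.stabilizer_card i'
  rw [Fin.prod_univ_two, card_fiber_zero, card_fiber_one] at hc
  rw [ones_comp, ← hc]
  refine Fintype.card_congr
    { toFun := fun π => ⟨π.1 * σ⁻¹, ?_⟩
      invFun := fun π => ⟨π.1 * σ, ?_⟩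
      left_inv := fun π => by simp
      right_inv := fun π => by simp }
  · have := π.2
    rw [Equiv.Perm.coe_mul, ← Function.comp_assoc, ← this, Function.comp_assoc,
      ← Equiv.Perm.coe_mul, mul_inv_cancel, Equiv.Perm.coe_one, Function.comp_id]
  · rw [Equiv.Perm.coe_mul, ← Function.comp_assoc, π.2]

theorem symProj_apply (l : ℕ) (i i' : Fin l → Fin 2) :
    symProj l i i' = if ones i = ones i' then ((l.choose (ones i) : ℕ) : ℂ)⁻¹ else 0 := by
  have hs : symProj l i i' = ((Nat.factorial l : ℕ) : ℂ)⁻¹ *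
      (Fintype.card {π : Equiv.Perm (Fin l) // i = i' ∘ π} : ℂ) := by
    rw [symProj, Matrix.smul_apply, Matrix.sum_apply, smul_eq_mul, Fintype.card_subtype]
    simp only [Matrix.of_apply, Finset.sum_boole]
  rw [hs]
  split_ifs with h
  · rw [card_perm_comp_eq h]
    have h1 := Nat.choose_mul_factorial_mul_factorial (ones_le i)
    have h2 : ((l.choose (ones i) : ℕ) : ℂ) ≠ 0 := by
      exact_mod_cast (Nat.choose_pos (ones_le i)).ne'
    have h3 : ((Nat.factorial l : ℕ) : ℂ) ≠ 0 := by exact_mod_cast Nat.factorial_ne_zero l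
    rw [inv_mul_eq_iff_eq_mul₀ h3, eq_mul_inv_iff_mul_eq₀ h2]
    rw [← h1]
    push_cast
    ring
  · have : IsEmpty {π : Equiv.Perm (Fin l) // i = i' ∘ π} :=
      ⟨fun π => h (by rw [π.2, ones_comp])⟩
    simp

theorem sum_ones {V : Type*} [AddCommMonoid V] (l : ℕ) (f : ℕ → V) :
    ∑ i : Fin l → Fin 2, f (ones i) = ∑ k ∈ Finset.range (l + 1), l.choose k • f k := by
  have := Finset.sum_powerset_apply_card f (x := (Finset.univ : Finset (Fin l)))
  rw [Finset.card_univ, Fintype.card_fin, Finset.powerset_univ] at this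
  rw [← this]
  refine Finset.sum_bij' (fun i _ => Finset.univ.filter fun m => i m = 1)
    (fun s _ m => if m ∈ s then 1 else 0) (by simp) (by simp) ?_ ?_ ?_
  · intro i _
    ext m
    simp only [Finset.mem_filter, Finset.mem_univ, true_and]
    generalize i m = a
    fin_cases a <;> simp
  · intro s _
    ext m
    simp
  · intro i _
    rw [ones_eq_card]

theorem symProj_mul_self (l : ℕ) : symProj l * symProj l = symProj l := by
  ext i i''
  rw [Matrix.mul_apply]
  have h1 : ∀ i' : Fin l → Fin 2, symProj l i i' * symProj l i' i'' =
      symProj l i i'' * if ones i' = ones i then ((l.choose (ones i) : ℕ) : ℂ)⁻¹ else 0 := by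
    intro i'
    simp only [symProj_apply]
    by_cases h : ones i' = ones i
    · simp only [h, if_true]
      ring
    · rw [if_neg (Ne.symm h), if_neg h]
      simp
  have h2 : ((l.choose (ones i) : ℕ) : ℂ) ≠ 0 := by
    exact_mod_cast (Nat.choose_pos (ones_le i)).ne'
  have h3 := sum_ones l fun k => if k = ones i then ((l.choose (ones i) : ℕ) : ℂ)⁻¹ else 0
  rw [Finset.sum_congr rfl fun i' _ => h1 i', ← Finset.mul_sum, h3, Finset.sum_eq_single (ones i)]
  · rw [if_pos rfl, nsmul_eq_mul, mul_inv_cancel₀ h2, mul_one]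
  · intro k _ hk
    rw [if_neg hk, smul_zero]
  · intro h
    exact absurd (Finset.mem_range.2 (Nat.lt_succ_of_le (ones_le i))) h

end Symmetrizer

/-! ### Column products and the fusion recursion -/

section Columns

open Polynomial

variable {R : Type*} [Ring R]

/-- The row `(1, X)` times the `b`-th column of a `2 × 2` matrix. -/
noncomputable def column (A : Matrix (Fin 2) (Fin 2) R) (b : Fin 2) : R[X] :=
  C (A 0 b) + X * C (A 1 b)

theorem coeff_zero_column_mul (A : Matrix (Fin 2) (Fin 2) R) (b : Fin 2) (p : R[X]) :
    (column A b * p).coeff 0 = A 0 b * p.coeff 0 := by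
  rw [column, add_mul, coeff_add, coeff_C_mul, mul_assoc, coeff_X_mul_zero, add_zero]

theorem coeff_succ_column_mul (A : Matrix (Fin 2) (Fin 2) R) (b : Fin 2) (p : R[X]) (n : ℕ) :
    (column A b * p).coeff (n + 1) = A 0 b * p.coeff (n + 1) + A 1 b * p.coeff n := by
  rw [column, add_mul, coeff_add, coeff_C_mul, mul_assoc, coeff_X_mul, coeff_C_mul]

/-- The variable X counts how often the row index 1 is chosen, so a coefficient collects exactly the
row indices over which the symmetric projector averages. -/
theorem coeff_prod_column {l : ℕ} (A : Fin l → Matrix (Fin 2) (Fin 2) R) (k : Fin l → Fin 2)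
    (n : ℕ) : ((List.ofFn fun m => column (A m) (k m)).prod).coeff n =
      ∑ j : Fin l → Fin 2,
        if ones j = n then (List.ofFn fun m => A m (j m) (k m)).prod else 0 := by
  induction l generalizing n with
  | zero =>
    simp [ones, coeff_one, eq_comm]
  | succ l ih =>
    rw [List.ofFn_succ, List.prod_cons, ← (Fin.consEquiv fun _ => Fin 2).sum_comp,
      Fintype.sum_prod_type, Fin.sum_univ_two]
    have hc (a : Fin 2) (j : Fin l → Fin 2) :
        ones ((Fin.consEquiv fun _ => Fin 2) (a, j)) = a + ones j := ones_cons a j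
    simp only [hc, Fin.consEquiv_apply, List.ofFn_succ, List.prod_cons, Fin.cons_zero,
      Fin.cons_succ, Fin.val_zero, zero_add, Fin.val_one]
    cases n with
    | zero =>
      rw [coeff_zero_column_mul, ih, Finset.mul_sum]
      simp only [mul_ite, mul_zero, Nat.add_eq_zero_iff, one_ne_zero, false_and, if_false,
        Finset.sum_const_zero, add_zero]
    | succ n =>
      rw [coeff_succ_column_mul, ih, ih, Finset.mul_sum, Finset.mul_sum]
      simp only [mul_ite, mul_zero, add_comm 1, Nat.add_right_cancel_iff]

variable (η : ℂ) (M : ℂ → Matrix (Fin 2) (Fin 2) R) (x : ℂ)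

/-- Ordered product of `p` first columns followed by `q` second columns, at the points
`x + (p + q - 1) η, …, x + η, x`. -/
noncomputable def colProd : ℕ → ℕ → R[X]
  | 0, 0 => 1
  | 0, q + 1 => column (M (x + q * η)) 1 * colProd 0 q
  | p + 1, q => column (M (x + (p + q : ℕ) * η)) 0 * colProd p q

theorem coeff_colProd_eq_zero (p q n : ℕ) (h : p + q < n) : (colProd η M x p q).coeff n = 0 := by
  induction p generalizing n with
  | zero =>
    induction q generalizing n with
    | zero => rw [colProd, coeff_one, if_neg (by omega)]
    | succ q ih =>
      obtain ⟨n, rfl⟩ : ∃ n', n = n' + 1 := ⟨n - 1, by omega⟩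
      rw [colProd, coeff_succ_column_mul, ih _ (by omega), ih _ (by omega), mul_zero, mul_zero,
        add_zero]
  | succ p ih =>
    obtain ⟨n, rfl⟩ : ∃ n', n = n' + 1 := ⟨n - 1, by omega⟩
    rw [colProd, coeff_succ_column_mul, ih _ (by omega), ih _ (by omega), mul_zero, mul_zero,
      add_zero]

/-- The transfer matrix of spin `l / 2` in terms of column products. -/
noncomputable def colTrace (l : ℕ) : R :=
  ∑ pq ∈ Finset.HasAntidiagonal.antidiagonal l, (colProd η M x pq.1 pq.2).coeff pq.2

theorem colTrace_zero : colTrace η M x 0 = 1 := by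
  simp [colTrace, colProd]

variable {η M}

/-- The leftmost column is split off each product. The term without first columns has no
contribution from `M 0 1`, as the remaining product has too small a degree; the case `pq.2 = 0` is
separated because there is no coefficient of degree -1. -/
theorem colTrace_succ_aux (l : ℕ) : colTrace η M x (l + 1) =
    M (x + l * η) 1 1 * (colProd η M x 0 l).coeff l + M (x + l * η) 0 0 * colTrace η M x l +
      ∑ pq ∈ Finset.HasAntidiagonal.antidiagonal l, if pq.2 = 0 then 0 else
        M (x + l * η) 1 0 * (colProd η M x pq.1 pq.2).coeff (pq.2 - 1) := by
  rw [colTrace, Finset.Nat.sum_antidiagonal_succ, colProd, coeff_succ_column_mul,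
    coeff_colProd_eq_zero _ _ _ _ _ _ (by omega), mul_zero, zero_add, add_assoc, colTrace,
    Finset.mul_sum, ← Finset.sum_add_distrib]
  congr 1
  refine Finset.sum_congr rfl fun pq hpq => ?_
  rw [Finset.HasAntidiagonal.mem_antidiagonal] at hpq
  rw [colProd, hpq]
  rcases h : pq.2 with _ | q
  · rw [coeff_zero_column_mul, if_pos rfl, add_zero]
  · rw [coeff_succ_column_mul, if_neg (Nat.succ_ne_zero q), Nat.add_sub_cancel]

theorem colTrace_one : colTrace η M x 1 = (M x).trace := by
  rw [colTrace_succ_aux, colTrace_zero]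
  simp [colProd, Matrix.trace, Fin.sum_univ_two, add_comm]

variable [Algebra ℂ R]

/-- Coefficient by coefficient: degrees 0 and 2 are the vanishing minors with equal rows, and degree
1 is the antisymmetry of the minor in its rows. -/
theorem RTT.column_exchange (hη : η ≠ 0) (h : RTT η M) (y : ℂ) :
    column (M (y + η)) 0 * column (M y) 1 = column (M (y + η)) 1 * column (M y) 0 := by
  have h0 := h.qminor_self hη (y + η) 0 0 1
  have h1 := h.qminor_self hη (y + η) 1 0 1
  have h2 := h.qminor_swap hη (y + η) 0 1 0 1
  simp only [qminor, add_sub_cancel_right] at h0 h1 h2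
  rw [sub_eq_zero] at h0 h1
  have h3 : M (y + η) 1 0 * M y 0 1 + M (y + η) 0 0 * M y 1 1 =
      M (y + η) 1 1 * M y 0 0 + M (y + η) 0 1 * M y 1 0 := by
    rw [← sub_eq_zero] at h2 ⊢
    rw [← h2]
    abel
  ext n
  rcases n with _ | _ | _ | n
  · simp [column, h0]
  · simp only [zero_add, coeff_succ_column_mul]
    simp [column, coeff_X, coeff_C, h3, add_comm (M (y + η) 0 0 * M y 1 1),
      add_comm (M (y + η) 0 1 * M y 1 0)]
  · simp only [coeff_succ_column_mul]
    simp [column, coeff_C, h1]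
  · simp only [coeff_succ_column_mul]
    simp [column]

/-- A quantum Cramer rule: the X-coefficient is a minor with equal rows and vanishes, and the
constant term is the quantum determinant. -/
theorem RTT.column_qdet (hη : η ≠ 0) (h : RTT η M) (y : ℂ) :
    C (M (y + η) 1 1) * column (M y) 0 - C (M (y + η) 1 0) * column (M y) 1 =
      C (qminor η M (y + η) 0 1 0 1) := by
  have h1 := h.qminor_self hη (y + η) 1 0 1
  have h2 := h.qminor_swap hη (y + η) 0 1 0 1
  simp only [qminor, add_sub_cancel_right] at h1 h2 ⊢
  rw [sub_eq_zero] at h1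
  rw [neg_eq_iff_eq_neg.1 h2.symm]
  simp only [column, mul_add, X_mul_C, ← mul_assoc, ← C_mul]
  rw [← h1]
  simp only [C_sub, C_neg]
  abel

theorem RTT.column_one_mul_colProd (hη : η ≠ 0) (h : RTT η M) (p q : ℕ) :
    column (M (x + (p + q : ℕ) * η)) 1 * colProd η M x p q = colProd η M x p (q + 1) := by
  induction p with
  | zero => rw [colProd, zero_add]
  | succ p ih =>
    have e : x + ((p + 1 + q : ℕ) : ℂ) * η = x + ((p + q : ℕ) : ℂ) * η + η := by
      push_cast; ring
    have e' : x + ((p + (q + 1) : ℕ) : ℂ) * η = x + ((p + q : ℕ) : ℂ) * η + η := by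
      push_cast; ring
    rw [colProd, colProd, e, e', ← mul_assoc, ← h.column_exchange hη, mul_assoc, ih]

/-- Second columns are carried to the right through first columns while the spectral parameters stay
in place, so only the number of second columns matters. -/
theorem RTT.prod_column_eq (hη : η ≠ 0) (h : RTT η M) {l : ℕ} (k : Fin l → Fin 2) :
    (List.ofFn fun m : Fin l =>
      column (M (x + ((l : ℂ) - 1 - ((m : ℕ) : ℂ)) * η)) (k m)).prod =
      colProd η M x (l - ones k) (ones k) := by
  induction l with
  | zero => simp [ones, colProd]
  | succ l ih =>
    rw [← Fin.cons_self_tail k, List.ofFn_succ, List.prod_cons, ones_cons]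
    have e (m : Fin l) : x + (((l + 1 : ℕ) : ℂ) - 1 - ((m.succ : ℕ) : ℂ)) * η =
        x + ((l : ℂ) - 1 - ((m : ℕ) : ℂ)) * η := by
      rw [Fin.val_succ]; push_cast; ring
    have hk := ones_le (Fin.tail k)
    have e0 : x + (((l + 1 : ℕ) : ℂ) - 1 - (((0 : Fin (l + 1)) : ℕ) : ℂ)) * η =
        x + ((l - ones (Fin.tail k) + ones (Fin.tail k) : ℕ) : ℂ) * η := by
      rw [Nat.sub_add_cancel hk, Fin.val_zero]; push_cast; ring
    simp only [Fin.cons_succ, Fin.cons_zero, e, ih, e0]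
    generalize k 0 = a
    fin_cases a
    · have : l + 1 - ones (Fin.tail k) = l - ones (Fin.tail k) + 1 := by omega
      simp only [Fin.zero_eta, zero_add, this, colProd]
    · have : l + 1 - (1 + ones (Fin.tail k)) = l - ones (Fin.tail k) := by omega
      simp only [Fin.mk_one, this]
      rw [h.column_one_mul_colProd x hη, add_comm 1]

/-- Subtracting the trace times the previous term leaves sums in which the two leftmost columns
enter through the combination of `RTT.column_qdet`. This replaces them by the quantum determinant.
-/
theorem RTT.colTrace_succ_succ (hη : η ≠ 0) (h : RTT η M) (l : ℕ) :
    colTrace η M x (l + 2) = (M (x + (l + 1 : ℕ) * η)).trace * colTrace η M x (l + 1) -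
      qminor η M (x + (l + 1 : ℕ) * η) 0 1 0 1 * colTrace η M x l := by
  rw [colTrace_succ_aux, Matrix.trace, Fin.sum_univ_two, Matrix.diag_apply, Matrix.diag_apply,
    add_mul]
  have e : x + ((l + 1 : ℕ) : ℂ) * η = x + (l : ℂ) * η + η := by push_cast; ring
  have h1 : M (x + (l + 1 : ℕ) * η) 1 1 * colTrace η M x (l + 1) =
      M (x + (l + 1 : ℕ) * η) 1 1 * (colProd η M x 0 (l + 1)).coeff (l + 1) +
      ∑ pq ∈ Finset.HasAntidiagonal.antidiagonal l, (C (M (x + l * η + η) 1 1) * (column (M (x + l * η)) 0 *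
        colProd η M x pq.1 pq.2)).coeff pq.2 := by
    rw [colTrace, Finset.Nat.sum_antidiagonal_succ, mul_add, Finset.mul_sum]
    congr 1
    refine Finset.sum_congr rfl fun pq hpq => ?_
    rw [Finset.HasAntidiagonal.mem_antidiagonal] at hpq
    rw [colProd, hpq, coeff_C_mul, e]
  have h2 : (∑ pq ∈ Finset.HasAntidiagonal.antidiagonal (l + 1), if pq.2 = 0 then 0 else
        M (x + (l + 1 : ℕ) * η) 1 0 * (colProd η M x pq.1 pq.2).coeff (pq.2 - 1)) =
      ∑ pq ∈ Finset.HasAntidiagonal.antidiagonal l, (C (M (x + l * η + η) 1 0) * (column (M (x + l * η)) 1 *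
        colProd η M x pq.1 pq.2)).coeff pq.2 := by
    rw [Finset.Nat.sum_antidiagonal_succ', if_pos rfl, zero_add]
    refine Finset.sum_congr rfl fun pq hpq => ?_
    rw [Finset.HasAntidiagonal.mem_antidiagonal] at hpq
    rw [if_neg (Nat.succ_ne_zero _), Nat.add_sub_cancel, coeff_C_mul,
      ← h.column_one_mul_colProd x hη, hpq, e]
  have h3 : qminor η M (x + (l + 1 : ℕ) * η) 0 1 0 1 * colTrace η M x l =
      (∑ pq ∈ Finset.HasAntidiagonal.antidiagonal l, (C (M (x + l * η + η) 1 1) * (column (M (x + l * η)) 0 *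
        colProd η M x pq.1 pq.2)).coeff pq.2) -
      ∑ pq ∈ Finset.HasAntidiagonal.antidiagonal l, (C (M (x + l * η + η) 1 0) * (column (M (x + l * η)) 1 *
        colProd η M x pq.1 pq.2)).coeff pq.2 := by
    rw [colTrace, Finset.mul_sum, ← Finset.sum_sub_distrib]
    refine Finset.sum_congr rfl fun pq _ => ?_
    rw [← coeff_sub, ← mul_assoc, ← mul_assoc, ← sub_mul, h.column_qdet hη, coeff_C_mul, e]
  rw [h1, h2, h3]
  abel

end Columns

/-! ### The fused transfer matrices satisfy the fusion recursion -/

section Fusion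

variable {N : ℕ} (d : Fin N → ℕ) (η : ℂ) (ξ : Fin N → ℂ)

theorem prod_auxOp_apply {l : ℕ} (A : Fin l → Matrix (Fin 2) (Fin 2) (Op d)) (L : List (Fin l))
    (hL : L.Nodup) (i i' : Fin l → Fin 2) : (L.map fun j => auxOp d l j (A j)).prod i i' =
      if ∀ k, k ∉ L → i k = i' k then (L.map fun j => A j (i j) (i' j)).prod else 0 := by
  induction L generalizing i with
  | nil => simp [Matrix.one_apply, funext_iff]
  | cons j L ih =>
    rw [List.nodup_cons] at hL
    rw [List.map_cons, List.prod_cons, Matrix.mul_apply,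
      Finset.sum_eq_single (Function.update i j (i' j))]
    · have hm : (L.map fun k => A k (Function.update i j (i' j) k) (i' k)) =
          L.map fun k => A k (i k) (i' k) := by
        refine List.map_congr_left fun k hk => ?_
        rw [Function.update_of_ne]
        rintro rfl
        exact hL.1 hk
      rw [ih hL.2, hm, auxOp, Matrix.of_apply, if_pos fun k hk => by simp [hk],
        Function.update_self, List.map_cons, List.prod_cons, mul_ite, mul_zero]
      refine if_congr ⟨fun H k hk => ?_, fun H k hk => ?_⟩ rfl rfl
      · rw [List.mem_cons, not_or] at hk
        simpa [hk.1] using H k hk.2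
      · by_cases hkj : k = j
        · subst hkj; simp
        · simpa [hkj] using H k (by simp [hkj, hk])
    · intro g _ hg
      rw [ih hL.2, auxOp, Matrix.of_apply]
      by_cases h1 : ∀ k, k ≠ j → i k = g k
      · rw [if_neg (c := ∀ k, k ∉ L → g k = i' k), mul_zero]
        intro h2
        refine hg (funext fun k => ?_)
        by_cases hkj : k = j
        · subst hkj; simp [h2 k hL.1]
        · simp [hkj, h1 k hkj]
      · rw [if_neg h1, zero_mul]
    · simp

/-- The projector entries are scalars, so under the trace the two projectors meet and merge into one
by idempotence. -/
theorem fusedTransfer_eq_sum (K : Matrix (Fin 2) (Fin 2) ℂ) (l : ℕ) (x : ℂ) :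
    fusedTransfer d η ξ K l x = ∑ k : Fin l → Fin 2, ∑ j : Fin l → Fin 2, symProj l k j •
      (List.ofFn fun m : Fin l =>
        monodromy d η ξ K (x + ((l : ℂ) - 1 - ((m : ℕ) : ℂ)) * η) (j m) (k m)).prod := by
  have hX (j k : Fin l → Fin 2) : (List.ofFn fun m : Fin l =>
      auxOp d l m (monodromy d η ξ K (x + ((l : ℂ) - 1 - ((m : ℕ) : ℂ)) * η))).prod j k =
      (List.ofFn fun m : Fin l =>
        monodromy d η ξ K (x + ((l : ℂ) - 1 - ((m : ℕ) : ℂ)) * η) (j m) (k m)).prod := by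
    rw [List.ofFn_eq_map, prod_auxOp_apply d
      (fun m : Fin l => monodromy d η ξ K (x + ((l : ℂ) - 1 - ((m : ℕ) : ℂ)) * η)) _
      (List.nodup_finRange l), if_pos fun k hk => absurd (List.mem_finRange k) hk,
      List.ofFn_eq_map]
  rw [fusedTransfer, fusedMonodromy, Matrix.trace]
  simp only [Matrix.diag_apply, Matrix.mul_apply, hX, Matrix.map_apply, smul_mul_assoc, one_mul,
    mul_smul_comm, mul_one, Finset.smul_sum]
  rw [Finset.sum_comm]
  refine Finset.sum_congr rfl fun k _ => ?_
  rw [Finset.sum_comm]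
  refine Finset.sum_congr rfl fun j _ => ?_
  simp only [smul_smul]
  rw [← Finset.sum_smul]
  congr 1
  conv_rhs => rw [← symProj_mul_self, Matrix.mul_apply]

/-- All column indices with k ones contribute the same coefficient, with weight the inverse of a
binomial coefficient. Their number is that binomial coefficient, so the weights cancel. -/
theorem fusedTransfer_eq_colTrace (hη : η ≠ 0) (K : Matrix (Fin 2) (Fin 2) ℂ) (l : ℕ) (x : ℂ) :
    fusedTransfer d η ξ K l x = colTrace η (monodromy d η ξ K) x l := by
  have h := monodromy_rtt d η ξ K
  rw [fusedTransfer_eq_sum, colTrace, Finset.Nat.sum_antidiagonal_eq_sum_range_succ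
    fun p q => (colProd η (monodromy d η ξ K) x p q).coeff q, ← Finset.sum_range_reflect]
  have hk (k : Fin l → Fin 2) : ∑ j : Fin l → Fin 2, symProj l k j • (List.ofFn fun m : Fin l =>
        monodromy d η ξ K (x + ((l : ℂ) - 1 - ((m : ℕ) : ℂ)) * η) (j m) (k m)).prod =
      ((l.choose (ones k) : ℕ) : ℂ)⁻¹ •
        (colProd η (monodromy d η ξ K) x (l - ones k) (ones k)).coeff (ones k) := by
    rw [← h.prod_column_eq x hη, coeff_prod_column, Finset.smul_sum]
    refine Finset.sum_congr rfl fun j _ => ?_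
    rw [symProj_apply]
    by_cases hj : ones k = ones j
    · rw [if_pos hj, if_pos hj.symm]
    · rw [if_neg hj, if_neg (Ne.symm hj), zero_smul, smul_zero]
  rw [Finset.sum_congr rfl fun k _ => hk k, sum_ones l fun k => ((l.choose k : ℕ) : ℂ)⁻¹ •
        (colProd η (monodromy d η ξ K) x (l - k) k).coeff k]
  refine Finset.sum_congr rfl fun k hk => ?_
  have hkl : k ≤ l := Nat.lt_succ_iff.1 (Finset.mem_range.1 hk)
  have hc : ((l.choose k : ℕ) : ℂ) ≠ 0 := by exact_mod_cast (Nat.choose_pos hkl).ne'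
  rw [← Nat.cast_smul_eq_nsmul ℂ, smul_smul, mul_inv_cancel₀ hc, one_smul]
  have e1 : l + 1 - 1 - k = l - k := by omega
  have e2 : l - (l - k) = k := by omega
  rw [e1, e2]

theorem fusedTransfer_zero (hη : η ≠ 0) (K : Matrix (Fin 2) (Fin 2) ℂ) (x : ℂ) :
    fusedTransfer d η ξ K 0 x = 1 := by
  rw [fusedTransfer_eq_colTrace d η ξ hη, colTrace_zero]

theorem fusedTransfer_one (hη : η ≠ 0) (K : Matrix (Fin 2) (Fin 2) ℂ) (x : ℂ) :
    fusedTransfer d η ξ K 1 x = transfer d η ξ K x := by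
  rw [fusedTransfer_eq_colTrace d η ξ hη, colTrace_one, transfer]

theorem fusedTransfer_succ_succ (hη : η ≠ 0) (K : Matrix (Fin 2) (Fin 2) ℂ) (l : ℕ) (x : ℂ) :
    fusedTransfer d η ξ K (l + 2) x =
      transfer d η ξ K (x + (l + 1 : ℕ) * η) * fusedTransfer d η ξ K (l + 1) x -
        (K.det * (aFun d η ξ (x + (l + 1 : ℕ) * η) * dFun d η ξ (x + l * η))) •
          fusedTransfer d η ξ K l x := by
  simp only [fusedTransfer_eq_colTrace d η ξ hη]
  rw [(monodromy_rtt d η ξ K).colTrace_succ_succ x hη, monodromy_qminor d η ξ hη, smul_mul_assoc,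
    one_mul, transfer]
  congr 5
  push_cast
  ring

end Fusion

end HigherSpin

namespace HigherSpin

/-! ### Commuting products and eigenvectors with polynomial eigenvalues -/

section Generic

theorem exists_commuting_product {ι R : Type*} [Fintype ι] [DecidableEq ι] [Monoid R]
    (X : ι → ℕ → R) (hX : ∀ i k j l, Commute (X i k) (X j l)) :
    ∃ P : (ι → ℕ) → R, P 0 = 1 ∧
      ∀ h i, P (Function.update h i (h i + 1)) = P h * X i (h i) := by
  -- As the generators commute pairwise, the product is formed in the commutative submonoid
  -- generated by them, where the order of the sites is immaterial.
  let S := Submonoid.closure (Set.range fun ik : ι × ℕ => X ik.1 ik.2)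
  have : IsMulCommutative S := Submonoid.isMulCommutative_closure _ (by
    rintro _ ⟨a, rfl⟩ _ ⟨b, rfl⟩
    exact hX _ _ _ _)
  let : CommMonoid S :=
    { (inferInstance : Monoid S) with mul_comm := fun a b => this.is_comm.comm a b }
  let Y : ι → ℕ → S := fun i k => ⟨X i k, Submonoid.subset_closure ⟨(i, k), rfl⟩⟩
  let P : (ι → ℕ) → S := fun h => ∏ i, ∏ k ∈ Finset.range (h i), Y i k
  have hP (h : ι → ℕ) (i : ι) : P (Function.update h i (h i + 1)) = P h * Y i (h i) := by
    simp only [P]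
    rw [← Finset.mul_prod_erase _ _ (Finset.mem_univ i),
      ← Finset.mul_prod_erase Finset.univ (fun i => ∏ k ∈ Finset.range (h i), Y i k)
        (Finset.mem_univ i), Function.update_self, Finset.prod_range_succ, mul_right_comm]
    congr 2
    refine Finset.prod_congr rfl fun j hj => ?_
    rw [Function.update_of_ne (Finset.ne_of_mem_erase hj)]
  refine ⟨fun h => (P h : R), ?_, fun h i => congrArg Subtype.val (hP h i)⟩
  have : P 0 = 1 := Finset.prod_eq_one fun i _ => by simp
  exact congrArg Subtype.val this

theorem nat_update_induction {ι : Type*} [Fintype ι] [DecidableEq ι] {P : (ι → ℕ) → Prop}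
    (h0 : P 0) (hs : ∀ h i, P h → P (Function.update h i (h i + 1))) (h : ι → ℕ) : P h := by
  induction hn : ∑ i, h i generalizing h with
  | zero =>
    have : h = 0 := funext fun i => by
      simpa using (Finset.sum_eq_zero_iff.1 hn) i (Finset.mem_univ i)
    exact this ▸ h0
  | succ n ih =>
    obtain ⟨i, -, hi⟩ : ∃ i ∈ Finset.univ, h i ≠ 0 := by
      by_contra! hc
      rw [Finset.sum_eq_zero hc] at hn
      exact absurd hn (Nat.succ_ne_zero n).symm
    have e : h = Function.update (Function.update h i (h i - 1)) i
        (Function.update h i (h i - 1) i + 1) := by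
      rw [Function.update_self, Function.update_idem, Nat.sub_add_cancel (Nat.pos_of_ne_zero hi),
        Function.update_eq_self]
    rw [e]
    refine hs _ _ (ih _ ?_)
    have hu : ∑ j ∈ Finset.univ.erase i, Function.update h i (h i - 1) j =
        ∑ j ∈ Finset.univ.erase i, h j :=
      Finset.sum_congr rfl fun j hj => by
        rw [Function.update_of_ne (Finset.ne_of_mem_erase hj)]
    rw [← Finset.add_sum_erase _ _ (Finset.mem_univ i)] at hn ⊢
    rw [Function.update_self, hu]
    omega

/-- Distinct polynomials take distinct values at some common point, since the product of their
differences is a nonzero polynomial. At that point the usual independence of eigenvectors applies.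
-/
theorem linearIndependent_of_polynomial_eigenvalues {ι V : Type*} [Finite ι] [AddCommGroup V]
    [Module ℂ V] (f : ℂ → Module.End ℂ V) (v : ι → V) (p : ι → Polynomial ℂ)
    (hp : Function.Injective p) (hv : ∀ i, v i ≠ 0) (hf : ∀ x i, f x (v i) = (p i).eval x • v i) :
    LinearIndependent ℂ v := by
  classical
  have := Fintype.ofFinite ι
  obtain ⟨x, hx⟩ : ∃ x, (∏ ij ∈ (Finset.univ : Finset ι).offDiag, (p ij.1 - p ij.2)).eval x ≠ 0 := by
    by_contra! hc
    have : ∏ ij ∈ (Finset.univ : Finset ι).offDiag, (p ij.1 - p ij.2) = 0 :=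
      Polynomial.funext fun x => by rw [hc x, Polynomial.eval_zero]
    obtain ⟨ij, hij, h0⟩ := Finset.prod_eq_zero_iff.1 this
    exact (Finset.mem_offDiag.1 hij).2.2 (hp (sub_eq_zero.1 h0))
  refine Module.End.eigenvectors_linearIndependent' (f x) (fun i => (p i).eval x) ?_ v fun i =>
    ⟨Module.End.mem_eigenspace_iff.2 (hf x i), hv i⟩
  intro i j hij
  by_contra hne
  rw [Polynomial.eval_prod, Finset.prod_ne_zero_iff] at hx
  exact hx (i, j) (by simp [hne]) (by simpa [sub_eq_zero] using hij)

end Generic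

/-! ### The strings of points and their node polynomials -/

section Nodes

variable {N : ℕ} {d : Fin N → ℕ} {η : ℂ} {ξ : Fin N → ℂ}

theorem xi_succ (n : Fin N) (k : ℕ) : xi d η ξ n (k + 1) = xi d η ξ n k - η := by
  simp only [xi]; push_cast; ring

theorem xi_injective (hη : η ≠ 0) (n : Fin N) : Function.Injective (xi d η ξ n) := by
  intro h k e
  simp only [xi, add_right_inj, mul_eq_mul_right_iff, hη, or_false, sub_right_inj] at e
  exact_mod_cast e

theorem aFun_eq (x : ℂ) : aFun d η ξ x = ∏ n, (x - xi d η ξ n (d n)) :=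
  Finset.prod_congr rfl fun n _ => by simp only [xi]; ring

theorem dFun_eq (x : ℂ) : dFun d η ξ x = ∏ n, (x - xi d η ξ n 0) :=
  Finset.prod_congr rfl fun n _ => by simp only [xi]; push_cast; ring

theorem aFun_xi_top (n : Fin N) : aFun d η ξ (xi d η ξ n (d n)) = 0 := by
  rw [aFun_eq]
  exact Finset.prod_eq_zero (Finset.mem_univ n) (sub_self _)

theorem dFun_xi_zero (n : Fin N) : dFun d η ξ (xi d η ξ n 0) = 0 := by
  rw [dFun_eq]
  exact Finset.prod_eq_zero (Finset.mem_univ n) (sub_self _)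

/-- The strings `ξ_n^(k)`, `0 ≤ k ≤ d n`, are pairwise disjoint. -/
def DisjointStrings (d : Fin N → ℕ) (η : ℂ) (ξ : Fin N → ℂ) : Prop :=
  ∀ a b : Fin N, a ≠ b → ∀ h k : ℕ, h ≤ d a → k ≤ d b → xi d η ξ a h ≠ xi d η ξ b k

theorem DisjointStrings.eq_of_xi_eq (hs : DisjointStrings d η ξ) (hη : η ≠ 0) {a b : Fin N}
    {h k : ℕ} (hh : h ≤ d a) (hk : k ≤ d b) (e : xi d η ξ a h = xi d η ξ b k) : a = b ∧ h = k := by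
  by_cases hab : a = b
  · subst hab
    exact ⟨rfl, xi_injective hη a e⟩
  · exact absurd e (hs a b hab h k hh hk)

theorem DisjointStrings.aFun_ne_zero (hs : DisjointStrings d η ξ) (hη : η ≠ 0) {n : Fin N} {k : ℕ}
    (hk : k < d n) : aFun d η ξ (xi d η ξ n k) ≠ 0 := by
  rw [aFun_eq, Finset.prod_ne_zero_iff]
  intro m _ h
  obtain ⟨rfl, h2⟩ := hs.eq_of_xi_eq hη hk.le le_rfl (sub_eq_zero.1 h)
  exact hk.ne h2

theorem DisjointStrings.dFun_ne_zero (hs : DisjointStrings d η ξ) (hη : η ≠ 0) {n : Fin N} {k : ℕ}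
    (hk : k ≤ d n) (hk0 : k ≠ 0) : dFun d η ξ (xi d η ξ n k) ≠ 0 := by
  rw [dFun_eq, Finset.prod_ne_zero_iff]
  intro m _ h
  exact hk0 (hs.eq_of_xi_eq hη hk (Nat.zero_le _) (sub_eq_zero.1 h)).2

/-- The polynomial `b ∏ (X - z_n)`. -/
noncomputable def nodePoly (b : ℂ) (z : Fin N → ℂ) : Polynomial ℂ :=
  Polynomial.C b * ∏ n, (Polynomial.X - Polynomial.C (z n))

theorem nodePoly_eval (b : ℂ) (z : Fin N → ℂ) (x : ℂ) :
    (nodePoly b z).eval x = b * ∏ n, (x - z n) := by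
  simp [nodePoly, Polynomial.eval_prod]

theorem exists_node_eq {b : ℂ} (hb : b ≠ 0) {z z' : Fin N → ℂ} (h : nodePoly b z = nodePoly b z')
    (n : Fin N) : ∃ m, z n = z' m := by
  have := congrArg (Polynomial.eval (z n)) h
  rw [nodePoly_eval, nodePoly_eval, Finset.prod_eq_zero (Finset.mem_univ n) (sub_self _), mul_zero,
    zero_eq_mul, Finset.prod_eq_zero_iff] at this
  obtain ⟨m, -, hm⟩ := this.resolve_left hb
  exact ⟨m, sub_eq_zero.1 hm⟩

theorem DisjointStrings.nodePoly_injective (hs : DisjointStrings d η ξ) (hη : η ≠ 0) {b : ℂ}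
    (hb : b ≠ 0) :
    Function.Injective fun h : Conf d => nodePoly b fun n => xi d η ξ n (h n : ℕ) := by
  intro h h' e
  ext n
  obtain ⟨m, hm⟩ := exists_node_eq hb e n
  obtain ⟨rfl, h2⟩ := hs.eq_of_xi_eq hη (Nat.lt_succ_iff.1 (h n).2) (Nat.lt_succ_iff.1 (h' m).2) hm
  exact h2

theorem DisjointStrings.nodePoly_update_ne (hs : DisjointStrings d η ξ) {b : ℂ}
    (hb : b ≠ 0) {h : Fin N → ℕ} (hh : ∀ n, h n ≤ d n) (n : Fin N) (y : ℂ)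
    (hy : ∀ k ≤ d n, y ≠ xi d η ξ n k) (h' : Conf d) :
    nodePoly b (Function.update (fun m => xi d η ξ m (h m)) n y) ≠
      nodePoly b fun n => xi d η ξ n (h' n : ℕ) := by
  intro e
  obtain ⟨m, hm⟩ := exists_node_eq hb e.symm n
  have hn := Nat.lt_succ_iff.1 (h' n).2
  by_cases hmn : m = n
  · subst hmn
    rw [Function.update_self] at hm
    exact hy _ hn hm.symm
  · rw [Function.update_of_ne hmn] at hm
    exact hs n m (Ne.symm hmn) _ _ hn (hh m) hm

end Nodes

/-! ### Shift operators and separated states -/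

section SoV

open Matrix

variable {N : ℕ} {d : Fin N → ℕ} {η : ℂ} {ξ : Fin N → ℂ} {M : ℂ → Matrix (Fin 2) (Fin 2) (Op d)}

/-- At a zero of the eigenvalue the term of the exchange relation with `M (z n) 0 1` leftmost dies.
What remains replaces the factor x - z_n by x - z_n + η. The relation carries a factor x - z_n, so
the point x = z_n is reached by continuity. -/
theorem RTT.shift_A (hM : RTT η M) (hc : Continuous fun x => M x 0 1) {b : ℂ} {z : Fin N → ℂ}
    {u : Conf d → ℂ} (hu : ∀ x, u ᵥ* M x 0 1 = (b * ∏ n, (x - z n)) • u) (n : Fin N) (x : ℂ) :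
    (u ᵥ* M (z n) 0 0) ᵥ* M x 0 1 =
      (b * ∏ m, (x - Function.update z n (z n - η) m)) • (u ᵥ* M (z n) 0 0) := by
  have hp (y x : ℂ) : ∏ m, (x - Function.update z n y m) =
      (x - y) * ∏ m ∈ Finset.univ.erase n, (x - z m) := by
    rw [← Finset.mul_prod_erase _ _ (Finset.mem_univ n), Function.update_self]
    congr 1
    refine Finset.prod_congr rfl fun m hm => ?_
    rw [Function.update_of_ne (Finset.ne_of_mem_erase hm)]
  have hz (x : ℂ) : ∏ m, (x - z m) = (x - z n) * ∏ m ∈ Finset.univ.erase n, (x - z m) := by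
    rw [← hp, Function.update_eq_self]
  have h0 : u ᵥ* M (z n) 0 1 = 0 := by rw [hu, hz]; simp
  refine congrFun (Continuous.ext_on (dense_compl_singleton (z n))
    (f := fun x => (u ᵥ* M (z n) 0 0) ᵥ* M x 0 1)
    (g := fun x => (b * ∏ m, (x - Function.update z n (z n - η) m)) • (u ᵥ* M (z n) 0 0))
    (continuous_const.matrix_vecMul hc) (by fun_prop) fun x hx => ?_) x
  have hx' : x - z n ≠ 0 := sub_ne_zero.2 hx
  have h := congrArg (u ᵥ* ·) (hM x (z n) 0 1 0 0)
  simp only [vecMul_add, vecMul_smul, ← vecMul_vecMul, h0, zero_vecMul, smul_zero, add_zero,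
    hu x, smul_vecMul] at h
  refine smul_right_injective _ hx' ?_
  simp only
  rw [← h, hz, hp, smul_smul, smul_smul, smul_smul, ← add_smul]
  congr 1
  ring

theorem RTT.shift_D (hM : RTT η M) (hc : Continuous fun x => M x 0 1) {b : ℂ} {z : Fin N → ℂ}
    {u : Conf d → ℂ} (hu : ∀ x, u ᵥ* M x 0 1 = (b * ∏ n, (x - z n)) • u) (n : Fin N) (x : ℂ) :
    (u ᵥ* M (z n) 1 1) ᵥ* M x 0 1 =
      (b * ∏ m, (x - Function.update z n (z n + η) m)) • (u ᵥ* M (z n) 1 1) := by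
  have hp (y x : ℂ) : ∏ m, (x - Function.update z n y m) =
      (x - y) * ∏ m ∈ Finset.univ.erase n, (x - z m) := by
    rw [← Finset.mul_prod_erase _ _ (Finset.mem_univ n), Function.update_self]
    congr 1
    refine Finset.prod_congr rfl fun m hm => ?_
    rw [Function.update_of_ne (Finset.ne_of_mem_erase hm)]
  have hz (x : ℂ) : ∏ m, (x - z m) = (x - z n) * ∏ m ∈ Finset.univ.erase n, (x - z m) := by
    rw [← hp, Function.update_eq_self]
  have h0 : u ᵥ* M (z n) 0 1 = 0 := by rw [hu, hz]; simp
  refine congrFun (Continuous.ext_on (dense_compl_singleton (z n))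
    (f := fun x => (u ᵥ* M (z n) 1 1) ᵥ* M x 0 1)
    (g := fun x => (b * ∏ m, (x - Function.update z n (z n + η) m)) • (u ᵥ* M (z n) 1 1))
    (continuous_const.matrix_vecMul hc) (by fun_prop) fun x hx => ?_) x
  have hx' : z n - x ≠ 0 := sub_ne_zero.2 (Ne.symm hx)
  have h := congrArg (u ᵥ* ·) (hM (z n) x 1 1 0 1)
  simp only [vecMul_add, vecMul_smul, ← vecMul_vecMul, h0, zero_vecMul, smul_zero, add_zero,
    hu x, smul_vecMul] at h
  refine smul_right_injective _ hx' ?_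
  simp only
  rw [h, hz, hp, smul_smul, smul_smul, smul_smul, ← add_smul]
  congr 1
  ring

/-- The exchange relation carries the factor x - y + η in one order of the arguments and y - x + η
in the other; both cannot vanish. -/
theorem RTT.commute_diag (hη : η ≠ 0) (hM : RTT η M) (x y : ℂ) (i : Fin 2) :
    Commute (M x i i) (M y i i) := by
  have h1 := hM x y i i i i
  have h2 := hM y x i i i i
  rw [← add_smul, ← add_smul] at h1 h2
  by_cases hxy : x - y + η = 0
  · have : y - x + η ≠ 0 := by
      intro h
      apply hη
      linear_combination (h + hxy) / 2
    exact (smul_right_injective _ this h2).symm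
  · exact smul_right_injective _ hxy h1

/-- A nonzero `u` would extend the family to an independent one with more members than the
dimension. -/
theorem eq_zero_of_nodePoly_ne {ι : Type*} [Fintype ι] {V : Type*} [AddCommGroup V] [Module ℂ V]
    [Module.Finite ℂ V] (hι : Fintype.card ι = Module.finrank ℂ V)
    (f : ℂ → Module.End ℂ V) (v : ι → V) (p : ι → Polynomial ℂ)
    (hp : Function.Injective p) (hv : ∀ i, v i ≠ 0) (hf : ∀ x i, f x (v i) = (p i).eval x • v i)
    (u : V) (q : Polynomial ℂ) (hq : ∀ i, q ≠ p i) (hu : ∀ x, f x u = q.eval x • u) : u = 0 := by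
  by_contra hu0
  have := linearIndependent_of_polynomial_eigenvalues f (fun o : Option ι => o.elim u v)
    (fun o => o.elim q p) ?_ ?_ ?_
  · have := this.fintype_card_le_finrank
    rw [Fintype.card_option, hι] at this
    omega
  · rintro (_ | i) (_ | j) h
    · rfl
    · exact absurd h (hq j)
    · exact absurd h.symm (hq i)
    · exact congrArg some (hp h)
  · rintro (_ | i)
    · exact hu0
    · exact hv i
  · rintro x (_ | i)
    · exact hu x
    · exact hf x i

/-- Separated states: left eigenvectors of the `B` operator, with shift actions of the diagonal
entries of the monodromy matrix. -/
theorem RTT.exists_separated_states (hη : η ≠ 0) (hs : DisjointStrings d η ξ) (hM : RTT η M)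
    (hc : Continuous fun x => M x 0 1) {k₁ k₂ b : ℂ} (hk₁ : k₁ ≠ 0) (hk₂ : k₂ ≠ 0) (hb : b ≠ 0)
    (hq : ∀ x, qminor η M x 0 1 0 1 =
      (k₁ * k₂ * (aFun d η ξ x * dFun d η ξ (x - η))) • (1 : Op d))
    {w : Conf d → ℂ} (hw : w ≠ 0) (hwB : ∀ x, w ᵥ* M x 0 1 = (b * dFun d η ξ x) • w) :
    ∃ Ψ : (Fin N → ℕ) → Conf d → ℂ,
      (∀ h x, Ψ h ᵥ* M x 0 1 = (b * ∏ n, (x - xi d η ξ n (h n))) • Ψ h) ∧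
      LinearIndependent ℂ (fun h : Conf d => Ψ fun n => h n) ∧
      ∀ h : Fin N → ℕ, (∀ n, h n ≤ d n) → ∀ n,
        Ψ h ᵥ* M (xi d η ξ n (h n)) 0 0 =
          (k₁ * aFun d η ξ (xi d η ξ n (h n))) • Ψ (Function.update h n (h n + 1)) ∧
        Ψ h ᵥ* M (xi d η ξ n (h n)) 1 1 =
          (k₂ * dFun d η ξ (xi d η ξ n (h n))) • Ψ (Function.update h n (h n - 1)) := by
  -- The separated states are the normalized images of `w` under the raising operators. At the end
  -- of a string a vanishes, and the convention 0⁻¹ = 0 makes the states beyond it zero; they only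
  -- ever occur with coefficient zero.
  obtain ⟨P, hP0, hP⟩ := exists_commuting_product
    (fun n k => (k₁ * aFun d η ξ (xi d η ξ n k))⁻¹ • M (xi d η ξ n k) 0 0)
    fun i k j l => ((hM.commute_diag hη _ _ 0).smul_left _).smul_right _
  obtain ⟨Ψ, hΨ⟩ : ∃ Ψ : (Fin N → ℕ) → Conf d → ℂ, Ψ = fun h => w ᵥ* P h := ⟨_, rfl⟩
  have hΨ0 : Ψ 0 = w := by rw [hΨ]; simp [hP0]
  have hΨs (h : Fin N → ℕ) (n : Fin N) : Ψ (Function.update h n (h n + 1)) =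
      (k₁ * aFun d η ξ (xi d η ξ n (h n)))⁻¹ • (Ψ h ᵥ* M (xi d η ξ n (h n)) 0 0) := by
    rw [hΨ]
    simp only [hP, vecMul_smul, ← vecMul_vecMul]
  have hnode (h : Fin N → ℕ) (n : Fin N) (k : ℕ) :
      (fun m => xi d η ξ m (Function.update h n k m)) =
        Function.update (fun m => xi d η ξ m (h m)) n (xi d η ξ n k) := by
    funext m
    by_cases hm : m = n
    · subst hm; simp
    · simp [hm]
  have hB (h : Fin N → ℕ) : ∀ x, Ψ h ᵥ* M x 0 1 = (b * ∏ n, (x - xi d η ξ n (h n))) • Ψ h := by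
    induction h using nat_update_induction with
    | h0 => intro x; rw [hΨ0, hwB, dFun_eq]; rfl
    | hs h n ih =>
      intro x
      have e (m : Fin N) : xi d η ξ m (Function.update h n (h n + 1) m) = _ :=
        congrFun (hnode h n (h n + 1)) m
      rw [hΨs, smul_vecMul, hM.shift_A hc (z := fun m => xi d η ξ m (h m)) ih n x,
        smul_comm, ← xi_succ]
      simp only [e]
  -- In the quantum determinant at a zero of the eigenvalue the `M 0 1` term vanishes, so the
  -- lowering entry inverts the raising entry up to a scalar.
  have hD (h : Fin N → ℕ) (n : Fin N) (hn : h n < d n) :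
      Ψ (Function.update h n (h n + 1)) ᵥ* M (xi d η ξ n (h n + 1)) 1 1 =
        (k₂ * dFun d η ξ (xi d η ξ n (h n + 1))) • Ψ h := by
    have hB0 : Ψ h ᵥ* M (xi d η ξ n (h n)) 0 1 = 0 := by
      rw [hB, Finset.prod_eq_zero (Finset.mem_univ n) (sub_self _), mul_zero, zero_smul]
    have h1 := congrArg (Ψ h ᵥ* ·) (hq (xi d η ξ n (h n)))
    simp only [qminor, vecMul_sub, ← vecMul_vecMul, hB0, zero_vecMul, sub_zero, vecMul_smul,
      vecMul_one] at h1
    have ha := hs.aFun_ne_zero hη hn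
    rw [hΨs, smul_vecMul, xi_succ, h1, smul_smul]
    congr 1
    field_simp
  -- A vanishing state would be lowered to a vanishing predecessor, because the lowering coefficient
  -- is nonzero inside the string, and eventually to `w = 0`.
  have hne (h : Fin N → ℕ) : (∀ n, h n ≤ d n) → Ψ h ≠ 0 := by
    induction h using nat_update_induction with
    | h0 => intro _; rwa [hΨ0]
    | hs h n ih =>
      intro hh h0
      have hn : h n + 1 ≤ d n := by simpa using hh n
      have hle : ∀ m, h m ≤ d m := by
        intro m
        by_cases hm : m = n
        · subst hm; omega
        · simpa [hm] using hh m
      have h1 := hD h n hn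
      rw [h0, zero_vecMul, eq_comm, smul_eq_zero] at h1
      rcases h1 with h1 | h1
      · exact mul_ne_zero hk₂ (hs.dFun_ne_zero hη hn (Nat.succ_ne_zero _)) h1
      · exact ih hle h1
  have hle (h : Conf d) (n : Fin N) : (h n : ℕ) ≤ d n := Nat.lt_succ_iff.1 (h n).2
  -- The existing states already exhaust the dimension. Hence a vector whose node would leave its
  -- string is zero, which settles raising at the bottom and lowering at the top.
  have hzero (h : Fin N → ℕ) (hh : ∀ n, h n ≤ d n) (n : Fin N) (y : ℂ)
      (hy : ∀ k ≤ d n, y ≠ xi d η ξ n k) (u : Conf d → ℂ) (hu : ∀ x, u ᵥ* M x 0 1 =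
        (b * ∏ m, (x - Function.update (fun m => xi d η ξ m (h m)) n y m)) • u) : u = 0 := by
    refine eq_zero_of_nodePoly_ne (by simp) (fun x => (M x 0 1).vecMulLinear)
      (fun h : Conf d => Ψ fun n => h n) _ (hs.nodePoly_injective hη hb) (fun h => hne _ (hle h))
      ?_ u _ (hs.nodePoly_update_ne hb hh n y hy) ?_
    · intro x h
      rw [nodePoly_eval]
      exact hB _ x
    · intro x
      rw [nodePoly_eval]
      exact hu x
  refine ⟨Ψ, hB, ?_, fun h hh n => ⟨?_, ?_⟩⟩
  · refine linearIndependent_of_polynomial_eigenvalues (fun x => (M x 0 1).vecMulLinear)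
      (fun h : Conf d => Ψ fun n => h n) _ (hs.nodePoly_injective hη hb)
      (fun h => hne _ (hle h)) fun x h => ?_
    rw [nodePoly_eval]
    exact hB _ x
  · rcases (hh n).lt_or_eq with hn | hn
    · rw [hΨs, smul_smul, mul_inv_cancel₀ (mul_ne_zero hk₁ (hs.aFun_ne_zero hη hn)), one_smul]
    · rw [hn, aFun_xi_top, mul_zero, zero_smul]
      refine hzero h hh n (xi d η ξ n (d n + 1)) (fun k hk e => ?_) _ fun x => ?_
      · have := xi_injective hη n e
        omega
      · have := hM.shift_A hc (z := fun m => xi d η ξ m (h m)) (hB h) n x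
        simp only [hn] at this
        rw [xi_succ]
        exact this
  · rcases Nat.eq_zero_or_pos (h n) with hn | hn
    · rw [hn, dFun_xi_zero, mul_zero, zero_smul]
      refine hzero h hh n (xi d η ξ n 0 + η) (fun k hk e => ?_) _ fun x => ?_
      · have : xi d η ξ n 0 = xi d η ξ n (k + 1) := by rw [xi_succ, ← e, add_sub_cancel_right]
        have := xi_injective hη n this
        omega
      · have := hM.shift_D hc (z := fun m => xi d η ξ m (h m)) (hB h) n x
        simpa only [hn] using this
    · have h1 := hh n
      have := hD (Function.update h n (h n - 1)) n (by rw [Function.update_self]; omega)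
      rwa [Function.update_self, Function.update_idem, Nat.sub_add_cancel hn,
        Function.update_eq_self] at this

end SoV

end HigherSpin

namespace HigherSpin

/-! ### Gauge transformation of the twist and separated bases -/

section Twist

open Matrix

variable {N : ℕ} {d : Fin N → ℕ} {η : ℂ} {ξ : Fin N → ℂ}

theorem det_sub_eq_zero_of_hasEigenvalue {K : Matrix (Fin 2) (Fin 2) ℂ} {k : ℂ}
    (h : Module.End.HasEigenvalue (Matrix.toLin' K) k) : k * k - K.trace * k + K.det = 0 := by
  obtain ⟨v, hv⟩ := h.exists_hasEigenvector
  have h1 : (K - k • (1 : Matrix (Fin 2) (Fin 2) ℂ)).det = 0 := by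
    rw [← Matrix.exists_mulVec_eq_zero_iff]
    refine ⟨v, hv.2, ?_⟩
    have := hv.apply_eq_smul
    rw [Matrix.toLin'_apply] at this
    rw [sub_mulVec, this, smul_mulVec, one_mulVec, sub_self]
  rw [Matrix.det_fin_two] at h1 ⊢
  simp only [Matrix.sub_apply, Matrix.smul_apply, Matrix.one_apply_eq, smul_eq_mul, mul_one,
    Matrix.one_apply_ne (zero_ne_one : (0 : Fin 2) ≠ 1),
    Matrix.one_apply_ne (one_ne_zero : (1 : Fin 2) ≠ 0), mul_zero, sub_zero] at h1
  rw [Matrix.trace_fin_two]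
  linear_combination h1

theorem trace_eq_and_det_eq {K : Matrix (Fin 2) (Fin 2) ℂ} {k₁ k₂ : ℂ} (hk : k₁ ≠ k₂)
    (h₁ : Module.End.HasEigenvalue (Matrix.toLin' K) k₁)
    (h₂ : Module.End.HasEigenvalue (Matrix.toLin' K) k₂) :
    K.trace = k₁ + k₂ ∧ K.det = k₁ * k₂ := by
  have e1 := det_sub_eq_zero_of_hasEigenvalue h₁
  have e2 := det_sub_eq_zero_of_hasEigenvalue h₂
  have ht : K.trace = k₁ + k₂ := by
    refine mul_left_cancel₀ (sub_ne_zero.2 hk) ?_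
    linear_combination e2 - e1
  refine ⟨ht, ?_⟩
  rw [ht] at e1
  linear_combination e1

variable (d η ξ) in
/-- The monodromy matrix in the gauge `[[1, g], [0, 1]]`. -/
noncomputable def gauged (K : Matrix (Fin 2) (Fin 2) ℂ) (g x : ℂ) : Matrix (Fin 2) (Fin 2) (Op d) :=
  scalarAux (Op d) !![1, -g; 0, 1] * monodromy d η ξ K x * scalarAux (Op d) !![1, g; 0, 1]

theorem gauged_rtt (K : Matrix (Fin 2) (Fin 2) ℂ) (g : ℂ) : RTT η (gauged d η ξ K g) :=
  ((rtt_scalarAux η _).mul (monodromy_rtt d η ξ K) fun _ _ => entriesCommute_scalarAux _ _).mul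
    (rtt_scalarAux η _) fun _ _ => (entriesCommute_scalarAux _ _).symm

theorem gauged_qminor (hη : η ≠ 0) (K : Matrix (Fin 2) (Fin 2) ℂ) (g x : ℂ) :
    qminor η (gauged d η ξ K g) x 0 1 0 1 =
      (K.det * (aFun d η ξ x * dFun d η ξ (x - η))) • (1 : Op d) := by
  have h1 := RTT.qminor_mul hη (rtt_scalarAux η !![1, g; 0, 1])
    (X := fun x => scalarAux (Op d) !![1, -g; 0, 1] * monodromy d η ξ K x)
    (fun _ _ => (entriesCommute_scalarAux _ _).symm) x
  have h2 := (monodromy_rtt d η ξ K).qminor_mul hη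
    (X := fun _ => scalarAux (Op d) !![1, -g; 0, 1])
    (fun _ _ => entriesCommute_scalarAux _ _) x
  rw [h2, qminor_scalarAux, qminor_scalarAux, monodromy_qminor d η ξ hη] at h1
  refine h1.trans ?_
  simp [Matrix.det_fin_two]

theorem gauged_apply_zero_zero (K : Matrix (Fin 2) (Fin 2) ℂ) (g x : ℂ) :
    gauged d η ξ K g x 0 0 = monodromy d η ξ K x 0 0 - g • monodromy d η ξ K x 1 0 := by
  simp [gauged, Matrix.mul_apply, Fin.sum_univ_two, scalarAux_apply, sub_eq_add_neg]

theorem gauged_apply_one_one (K : Matrix (Fin 2) (Fin 2) ℂ) (g x : ℂ) :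
    gauged d η ξ K g x 1 1 = g • monodromy d η ξ K x 1 0 + monodromy d η ξ K x 1 1 := by
  simp [gauged, Matrix.mul_apply, Fin.sum_univ_two, scalarAux_apply]

theorem gauged_apply_zero_one (K : Matrix (Fin 2) (Fin 2) ℂ) (g x : ℂ) :
    gauged d η ξ K g x 0 1 = (g • monodromy d η ξ K x 0 0 + monodromy d η ξ K x 0 1) -
      g • (g • monodromy d η ξ K x 1 0 + monodromy d η ξ K x 1 1) := by
  simp only [gauged, Matrix.mul_apply, Fin.sum_univ_two, scalarAux_apply, Matrix.of_apply,
    Matrix.cons_val', Matrix.cons_val_zero, Matrix.cons_val_one, Matrix.cons_val_fin_one,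
    smul_mul_assoc, mul_smul_comm, one_mul, mul_one]
  module

theorem gauged_continuous (K : Matrix (Fin 2) (Fin 2) ℂ) (g : ℂ) :
    Continuous fun x => gauged d η ξ K g x 0 1 := by
  have h := monodromy_continuous d η ξ K
  simp only [gauged_apply_zero_one]
  exact (((h 0 0).const_smul g).add (h 0 1)).sub ((((h 1 0).const_smul g).add (h 1 1)).const_smul g)

theorem monodromy_vecMul_ref (K : Matrix (Fin 2) (Fin 2) ℂ) (g x : ℂ) (i : Fin 2) :
    refCovector d g ᵥ* (g • monodromy d η ξ K x i 0 + monodromy d η ξ K x i 1) =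
      (dFun d η ξ x * (K i 0 * g + K i 1)) • refCovector d g := by
  have h := untwisted_vecMul_ref d η ξ g x
  have e : g • monodromy d η ξ K x i 0 + monodromy d η ξ K x i 1 =
      ∑ q, K i q • ∑ p, (![g, 1] : Fin 2 → ℂ) p • untwisted d η ξ x q p := by
    simp only [monodromy_eq, Matrix.mul_apply, Fin.sum_univ_two, scalarAux_apply,
      Matrix.cons_val_zero, Matrix.cons_val_one, Matrix.cons_val_fin_one, smul_mul_assoc, one_mul]
    module
  rw [e, Fin.sum_univ_two, vecMul_add, vecMul_smul, vecMul_smul, h, h]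
  simp only [Matrix.cons_val_zero, Matrix.cons_val_one, Matrix.cons_val_fin_one]
  module

theorem gauged_vecMul_ref (K : Matrix (Fin 2) (Fin 2) ℂ) (g x : ℂ) :
    refCovector d g ᵥ* gauged d η ξ K g x 0 1 =
      ((K 0 0 * g + K 0 1 - g * (K 1 0 * g + K 1 1)) * dFun d η ξ x) • refCovector d g := by
  rw [gauged_apply_zero_one, vecMul_sub, vecMul_smul, monodromy_vecMul_ref, monodromy_vecMul_ref]
  module

/-- The expression is a quadratic polynomial in g. Its vanishing at 0, 1 and -1 forces K 0 1 = 0 and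
equal diagonal entries, hence zero discriminant (k₁ - k₂)². -/
theorem exists_gauge {K : Matrix (Fin 2) (Fin 2) ℂ} {k₁ k₂ : ℂ} (hk : k₁ ≠ k₂)
    (htr : K.trace = k₁ + k₂) (hdet : K.det = k₁ * k₂) :
    ∃ g : ℂ, K 0 0 * g + K 0 1 - g * (K 1 0 * g + K 1 1) ≠ 0 := by
  by_contra! h
  rw [Matrix.trace_fin_two] at htr
  rw [Matrix.det_fin_two] at hdet
  have h0 := h 0
  have h1 := h 1
  have h2 := h (-1)
  refine hk (sub_eq_zero.1 (pow_eq_zero_iff two_ne_zero |>.1 (?_ : (k₁ - k₂) ^ 2 = 0)))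
  have e1 : K 0 1 = 0 := by linear_combination h0
  have e2 : K 1 1 = K 0 0 := by linear_combination (h2 - h1) / 2
  have : (k₁ - k₂) ^ 2 = (K 0 0 + K 1 1) ^ 2 - 4 * (K 0 0 * K 1 1 - K 0 1 * K 1 0) := by
    rw [htr, hdet]; ring
  rw [this, e1, e2]
  ring

/-- A basis of covectors in which the transfer matrix acts by shifts at the points of the
strings. -/
theorem exists_separated_basis (hη : η ≠ 0) (hs : DisjointStrings d η ξ)
    {K : Matrix (Fin 2) (Fin 2) ℂ} {k₁ k₂ : ℂ} (hk : k₁ ≠ k₂) (hk₁ : k₁ ≠ 0) (hk₂ : k₂ ≠ 0)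
    (htr : K.trace = k₁ + k₂) (hdet : K.det = k₁ * k₂) :
    ∃ Ψ : (Fin N → ℕ) → Conf d → ℂ, LinearIndependent ℂ (fun h : Conf d => Ψ fun n => h n) ∧
      ∀ h : Fin N → ℕ, (∀ n, h n ≤ d n) → ∀ n, Ψ h ᵥ* transfer d η ξ K (xi d η ξ n (h n)) =
        (k₁ * aFun d η ξ (xi d η ξ n (h n))) • Ψ (Function.update h n (h n + 1)) +
        (k₂ * dFun d η ξ (xi d η ξ n (h n))) • Ψ (Function.update h n (h n - 1)) := by
  obtain ⟨g, hg⟩ := exists_gauge hk htr hdet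
  obtain ⟨Ψ, -, hli, hΨ⟩ := (gauged_rtt K g).exists_separated_states hη hs (gauged_continuous K g)
    hk₁ hk₂ hg (fun x => by rw [gauged_qminor hη, hdet]) (refCovector_ne_zero d g)
    (gauged_vecMul_ref K g)
  refine ⟨Ψ, hli, fun h hh n => ?_⟩
  obtain ⟨hA, hD⟩ := hΨ h hh n
  rw [← hA, ← hD, ← vecMul_add, gauged_apply_zero_zero, gauged_apply_one_one, transfer,
    Matrix.trace_fin_two]
  congr 1
  abel

/-- Without twist, the `D` operators have a joint left eigenbasis. -/
theorem exists_eigenbasis_D (hη : η ≠ 0) (hs : DisjointStrings d η ξ) :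
    ∃ Ψ : Conf d → Conf d → ℂ, LinearIndependent ℂ Ψ ∧
      ∀ h x, Ψ h ᵥ* untwisted d η ξ x 1 1 = (∏ n, (x - xi d η ξ n (h n : ℕ))) • Ψ h := by
  -- This twist of determinant 1 moves the lower row of the untwisted monodromy matrix to the top,
  -- so that its D becomes a B and the separated states can be reused.
  have hB (x : ℂ) : monodromy d η ξ !![0, 1; -1, 0] x 0 1 = untwisted d η ξ x 1 1 := by
    simp [monodromy_eq, Matrix.mul_apply, Fin.sum_univ_two, scalarAux_apply]
  obtain ⟨Ψ, hΨ, hli, -⟩ := (monodromy_rtt d η ξ !![0, 1; -1, 0]).exists_separated_states hη hs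
    (monodromy_continuous d η ξ _ 0 1) (one_ne_zero (α := ℂ)) (one_ne_zero (α := ℂ))
    (one_ne_zero (α := ℂ)) (fun x => by rw [monodromy_qminor d η ξ hη]; simp [Matrix.det_fin_two])
    (refCovector_ne_zero d 0) (fun x => by
      have := monodromy_vecMul_ref (d := d) (η := η) (ξ := ξ) !![0, 1; -1, 0] 0 x 0
      simpa using this)
  refine ⟨_, hli, fun h x => ?_⟩
  have := hΨ (fun n => h n) x
  rwa [hB, one_mul] at this

end Twist

/-! ### Commutativity of the transfer matrices -/

section Commutation

open Matrix

variable {N : ℕ} {d : Fin N → ℕ} {η : ℂ} {ξ : Fin N → ℂ}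

/-- Two contractions of the exchange relation express the commutator of the traces and the
difference of the traces of the two products through each other. Eliminating the latter leaves the
factor (x - y)² - η². -/
theorem RTT.trace_commute_of_ne {R : Type*} [Ring R] [Algebra ℂ R]
    {M : ℂ → Matrix (Fin 2) (Fin 2) R} (hM : RTT η M) {x y : ℂ} (h : (x - y) ^ 2 ≠ η ^ 2) :
    Commute (M x).trace (M y).trace := by
  have e1 : (x - y) • ((M x).trace * (M y).trace - (M y).trace * (M x).trace) =
      η • ((M y * M x).trace - (M x * M y).trace) := by
    have := Finset.sum_congr (rfl : (Finset.univ : Finset (Fin 2)) = _) fun i _ =>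
      Finset.sum_congr (rfl : (Finset.univ : Finset (Fin 2)) = _) fun k _ => hM x y i i k k
    simp only [Fin.sum_univ_two] at this
    simp only [Matrix.trace_fin_two, Matrix.mul_apply, Fin.sum_univ_two, mul_add, add_mul]
    rw [← sub_eq_zero] at this ⊢
    rw [← this]
    module
  have e2 : (x - y) • ((M y * M x).trace - (M x * M y).trace) =
      η • ((M x).trace * (M y).trace - (M y).trace * (M x).trace) := by
    have := Finset.sum_congr (rfl : (Finset.univ : Finset (Fin 2)) = _) fun i _ =>
      Finset.sum_congr (rfl : (Finset.univ : Finset (Fin 2)) = _) fun k _ => hM x y i k k i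
    simp only [Fin.sum_univ_two] at this
    simp only [Matrix.trace_fin_two, Matrix.mul_apply, Fin.sum_univ_two, mul_add, add_mul]
    rw [← sub_eq_zero] at this ⊢
    rw [← neg_eq_zero, ← this]
    module
  have e3 : ((x - y) ^ 2 - η ^ 2) •
      ((M x).trace * (M y).trace - (M y).trace * (M x).trace) = 0 := by
    rw [sub_smul, pow_two, mul_smul, e1, smul_comm, e2, smul_smul, ← pow_two, sub_self]
  exact sub_eq_zero.1 ((smul_eq_zero.1 e3).resolve_left (sub_ne_zero.2 h))

theorem transfer_continuous (K : Matrix (Fin 2) (Fin 2) ℂ) : Continuous (transfer d η ξ K) := by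
  have h := monodromy_continuous d η ξ K
  have e : transfer d η ξ K = fun x => monodromy d η ξ K x 0 0 + monodromy d η ξ K x 1 1 :=
    funext fun x => Matrix.trace_fin_two _
  rw [e]
  exact (h 0 0).add (h 1 1)

theorem transfer_commute (K : Matrix (Fin 2) (Fin 2) ℂ) (x y : ℂ) :
    Commute (transfer d η ξ K x) (transfer d η ξ K y) := by
  have hT := transfer_continuous (d := d) (η := η) (ξ := ξ) K
  have hd : Dense ({x - η, x + η} : Set ℂ)ᶜ := (Set.toFinite _).countable.dense_compl ℂ
  refine congrFun (Continuous.ext_on hd (continuous_const.mul hT) (hT.mul continuous_const)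
    fun z hz => ?_) y
  refine (monodromy_rtt d η ξ K).trace_commute_of_ne ?_
  intro h
  rw [Set.mem_compl_iff, Set.mem_insert_iff, Set.mem_singleton_iff, not_or] at hz
  rcases sq_eq_sq_iff_eq_or_eq_neg.1 h with h | h
  · exact hz.1 (by linear_combination -h)
  · exact hz.2 (by linear_combination -h)

theorem transfer_commute_fusedTransfer (hη : η ≠ 0) (K : Matrix (Fin 2) (Fin 2) ℂ) (x y : ℂ)
    (l : ℕ) : Commute (transfer d η ξ K y) (fusedTransfer d η ξ K l x) := by
  induction l using Nat.twoStepInduction with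
  | zero => rw [fusedTransfer_zero d η ξ hη]; exact Commute.one_right _
  | one => rw [fusedTransfer_one d η ξ hη]; exact transfer_commute K _ _
  | more l h0 h1 =>
    rw [fusedTransfer_succ_succ d η ξ hη]
    exact ((transfer_commute K _ _).mul_right h1).sub_right (h0.smul_right _)

end Commutation

end HigherSpin

namespace HigherSpin

open Matrix

variable {N : ℕ} {d : Fin N → ℕ} {η : ℂ} {ξ : Fin N → ℂ}

/-! ### The SoV basis generated by the transfer matrices -/

section SoVBasis

/-- The transfer matrix acts on the covectors `Ψ h` by shifts at the points of the strings. -/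
def ActsByShifts (d : Fin N → ℕ) (η : ℂ) (ξ : Fin N → ℂ) (K : Matrix (Fin 2) (Fin 2) ℂ)
    (k₁ k₂ : ℂ) (Ψ : (Fin N → ℕ) → Conf d → ℂ) : Prop :=
  ∀ h : Fin N → ℕ, (∀ n, h n ≤ d n) → ∀ n, Ψ h ᵥ* transfer d η ξ K (xi d η ξ n (h n)) =
    (k₁ * aFun d η ξ (xi d η ξ n (h n))) • Ψ (Function.update h n (h n + 1)) +
    (k₂ * dFun d η ξ (xi d η ξ n (h n))) • Ψ (Function.update h n (h n - 1))

/-- The normalization `k₂^l ∏ d(ξ_n^(d n - k))` of the fused transfer matrices. -/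
noncomputable def sovNorm (d : Fin N → ℕ) (η : ℂ) (ξ : Fin N → ℂ) (k₂ : ℂ) (n : Fin N) (l : ℕ) :
    ℂ :=
  k₂ ^ l * ∏ k ∈ Finset.range l, dFun d η ξ (xi d η ξ n (d n - k))

theorem sovNorm_succ (k₂ : ℂ) (n : Fin N) (l : ℕ) : sovNorm d η ξ k₂ n (l + 1) =
    sovNorm d η ξ k₂ n l * (k₂ * dFun d η ξ (xi d η ξ n (d n - l))) := by
  rw [sovNorm, sovNorm, Finset.prod_range_succ, pow_succ]
  ring

theorem DisjointStrings.sovNorm_ne_zero (hs : DisjointStrings d η ξ) (hη : η ≠ 0) {k₂ : ℂ}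
    (hk₂ : k₂ ≠ 0) (n : Fin N) {l : ℕ} (hl : l ≤ d n) : sovNorm d η ξ k₂ n l ≠ 0 := by
  refine mul_ne_zero (pow_ne_zero _ hk₂) (Finset.prod_ne_zero_iff.2 fun k hk => ?_)
  have := Finset.mem_range.1 hk
  exact hs.dFun_ne_zero hη (Nat.sub_le _ _) (by omega)

theorem xi_top_add (n : Fin N) {l : ℕ} (hl : l ≤ d n) :
    xi d η ξ n (d n) + l * η = xi d η ξ n (d n - l) := by
  simp only [xi]
  rw [Nat.cast_sub hl]
  ring

/-- At the bottom of a string raising is impossible, so the transfer matrix purely lowers. In the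
fusion recursion the raising term of each further factor is cancelled by the quantum determinant
term. -/
theorem vecMul_fusedTransfer (hη : η ≠ 0) {K : Matrix (Fin 2) (Fin 2) ℂ} {k₁ k₂ : ℂ}
    (hdet : K.det = k₁ * k₂) {Ψ : (Fin N → ℕ) → Conf d → ℂ} (hΨ : ActsByShifts d η ξ K k₁ k₂ Ψ)
    {h : Fin N → ℕ} (hh : ∀ n, h n ≤ d n) {n : Fin N} (hn : h n = d n) {l : ℕ} (hl : l ≤ d n) :
    Ψ h ᵥ* fusedTransfer d η ξ K l (xi d η ξ n (d n)) =
      sovNorm d η ξ k₂ n l • Ψ (Function.update h n (d n - l)) := by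
  induction l using Nat.twoStepInduction with
  | zero =>
    rw [fusedTransfer_zero d η ξ hη, vecMul_one, sovNorm, pow_zero, Finset.prod_range_zero, one_mul,
      one_smul, Nat.sub_zero, ← hn, Function.update_eq_self]
  | one =>
    have := hΨ h hh n
    rw [hn, aFun_xi_top, mul_zero, zero_smul, zero_add] at this
    rw [fusedTransfer_one d η ξ hη, this, sovNorm_succ]
    simp [sovNorm]
  | more l h0 h1 =>
    have hle : ∀ m, Function.update h n (d n - (l + 1)) m ≤ d m := by
      intro m
      by_cases hm : m = n
      · subst hm; simp
      · simpa [hm] using hh m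
    have h2 := hΨ _ hle n
    simp only [Function.update_self, Function.update_idem] at h2
    have e1 : d n - (l + 1) + 1 = d n - l := by omega
    have e2 : d n - (l + 1) - 1 = d n - (l + 2) := by omega
    rw [e1, e2] at h2
    rw [fusedTransfer_succ_succ d η ξ hη, (transfer_commute_fusedTransfer hη K _ _ _).eq, vecMul_sub,
      ← vecMul_vecMul, vecMul_smul, h1 (by omega), h0 (by omega), smul_vecMul,
      xi_top_add n (by omega : l + 1 ≤ d n), xi_top_add n (by omega : l ≤ d n), h2, hdet]
    simp only [sovNorm_succ]
    module

theorem vecMul_prod_fusedTransfer (hη : η ≠ 0) (hs : DisjointStrings d η ξ)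
    {K : Matrix (Fin 2) (Fin 2) ℂ} {k₁ k₂ : ℂ} (hk₂ : k₂ ≠ 0) (hdet : K.det = k₁ * k₂)
    {Ψ : (Fin N → ℕ) → Conf d → ℂ} (hΨ : ActsByShifts d η ξ K k₁ k₂ Ψ) (h : Conf d)
    {L : List (Fin N)} (hL : L.Nodup) {g : Fin N → ℕ} (hg : ∀ n, g n ≤ d n)
    (hgL : ∀ n ∈ L, g n = d n) :
    Ψ g ᵥ* (L.map fun n => (sovNorm d η ξ k₂ n (d n - (h n : ℕ)))⁻¹ •
      fusedTransfer d η ξ K (d n - (h n : ℕ)) (xi d η ξ n (d n))).prod =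
      Ψ fun n => if n ∈ L then (h n : ℕ) else g n := by
  induction L generalizing g with
  | nil => simp
  | cons n L ih =>
    rw [List.nodup_cons] at hL
    have hn : (h n : ℕ) ≤ d n := Nat.lt_succ_iff.1 (h n).2
    rw [List.map_cons, List.prod_cons, ← vecMul_vecMul, vecMul_smul,
      vecMul_fusedTransfer hη hdet hΨ hg (hgL n List.mem_cons_self) (Nat.sub_le _ _), smul_smul,
      inv_mul_cancel₀ (hs.sovNorm_ne_zero hη hk₂ n (Nat.sub_le _ _)), one_smul,
      Nat.sub_sub_self hn, ih hL.2]
    · congr 1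
      funext m
      by_cases hm : m = n
      · subst hm; simp [hL.1]
      · simp [hm]
    · intro m
      by_cases hm : m = n
      · subst hm; simpa using hn
      · simpa [hm] using hg m
    · intro m hmL
      have hm : m ≠ n := fun e => hL.1 (e ▸ hmL)
      simpa [hm] using hgL m (List.mem_cons_of_mem _ hmL)

theorem sovCovector_eq (K : Matrix (Fin 2) (Fin 2) ℂ) (k₂ : ℂ) (S : Conf d → ℂ) (h : Conf d) :
    sovCovector d η ξ K k₂ S h =
      S ᵥ* ((List.finRange N).map fun n => (sovNorm d η ξ k₂ n (d n - (h n : ℕ)))⁻¹ •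
        fusedTransfer d η ξ K (d n - (h n : ℕ)) (xi d η ξ n (d n))).prod := by
  rw [sovCovector, List.ofFn_eq_map]
  rfl

theorem exists_isSoVBasis (hη : η ≠ 0) (hs : DisjointStrings d η ξ)
    {K : Matrix (Fin 2) (Fin 2) ℂ} {k₁ k₂ : ℂ} (hk : k₁ ≠ k₂) (hk₁ : k₁ ≠ 0) (hk₂ : k₂ ≠ 0)
    (htr : K.trace = k₁ + k₂) (hdet : K.det = k₁ * k₂) :
    ∃ S : Conf d → ℂ, IsSoVBasis d η ξ K k₂ S := by
  obtain ⟨Ψ, hli, hΨ⟩ := exists_separated_basis (d := d) (ξ := ξ) hη hs hk hk₁ hk₂ htr hdet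
  -- The generating covector is the separated state with every node at the bottom of its string; the
  -- normalized fused transfer matrices then reproduce all the others.
  have e : sovCovector d η ξ K k₂ (Ψ d) = fun h : Conf d => Ψ fun n => h n := by
    funext h
    rw [sovCovector_eq, vecMul_prod_fusedTransfer hη hs hk₂ hdet hΨ h (List.nodup_finRange N)
      (fun _ => le_rfl) fun _ _ => rfl]
    simp
  refine ⟨Ψ d, ?_⟩
  rw [IsSoVBasis, e]
  exact ⟨hli, hli.span_eq_top_of_card_eq_finrank' (by simp)⟩

end SoVBasis

/-! ### Factorized wavefunctions -/

section Factorization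

/-- The TQ equation on a string, started at its bottom where a vanishes, is the fusion recursion for
the eigenvalues after normalization by the values of q. -/
theorem fusedTransfer_mulVec (hη : η ≠ 0) {K : Matrix (Fin 2) (Fin 2) ℂ} {k₁ k₂ : ℂ}
    (hdet : K.det = k₁ * k₂) {t q : ℂ → ℂ}
    (hq : ∀ x, t x * q x = k₁ * aFun d η ξ x * q (x - η) + k₂ * dFun d η ξ x * q (x + η))
    {v : Conf d → ℂ} (hv : IsEigenvector d η ξ K t v) (n : Fin N)
    (hn : q (xi d η ξ n (d n)) ≠ 0) {l : ℕ} (hl : l ≤ d n) :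
    fusedTransfer d η ξ K l (xi d η ξ n (d n)) *ᵥ v =
      (sovNorm d η ξ k₂ n l * (q (xi d η ξ n (d n - l)) / q (xi d η ξ n (d n)))) • v := by
  have hpred (k : ℕ) (hk : k ≠ 0) : xi d η ξ n k + η = xi d η ξ n (k - 1) := by
    obtain ⟨k, rfl⟩ := Nat.exists_eq_succ_of_ne_zero hk
    rw [xi_succ, sub_add_cancel, Nat.succ_sub_one]
  induction l using Nat.twoStepInduction with
  | zero =>
    rw [fusedTransfer_zero d η ξ hη, one_mulVec, Nat.sub_zero, div_self hn]
    simp [sovNorm]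
  | one =>
    have h1 := hq (xi d η ξ n (d n))
    rw [aFun_xi_top, hpred _ (by omega)] at h1
    rw [fusedTransfer_one d η ξ hη, hv.2, sovNorm_succ]
    congr 1
    simp only [sovNorm, pow_zero, Finset.prod_range_zero, Nat.sub_zero]
    field_simp
    linear_combination h1
  | more l h0 h1 =>
    have h2 := hq (xi d η ξ n (d n - (l + 1)))
    rw [hpred _ (by omega), ← xi_succ] at h2
    have e1 : d n - (l + 1) + 1 = d n - l := by omega
    have e2 : d n - (l + 1) - 1 = d n - (l + 2) := by omega
    rw [e1, e2] at h2
    rw [fusedTransfer_succ_succ d η ξ hη, sub_mulVec, ← mulVec_mulVec, smul_mulVec, h1 (by omega),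
      h0 (by omega), mulVec_smul, hv.2, smul_smul, smul_smul, ← sub_smul,
      xi_top_add n (by omega : l + 1 ≤ d n), xi_top_add n (by omega : l ≤ d n), hdet]
    simp only [sovNorm_succ]
    congr 1
    field_simp
    linear_combination (sovNorm d η ξ k₂ n l * k₂ * dFun d η ξ (xi d η ξ n (d n - l))) * h2

theorem sovCovector_dotProduct (hη : η ≠ 0) (hs : DisjointStrings d η ξ)
    {K : Matrix (Fin 2) (Fin 2) ℂ} {k₁ k₂ : ℂ} (hk₂ : k₂ ≠ 0)
    (hdet : K.det = k₁ * k₂) {t q : ℂ → ℂ}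
    (hq : ∀ x, t x * q x = k₁ * aFun d η ξ x * q (x - η) + k₂ * dFun d η ξ x * q (x + η))
    {v : Conf d → ℂ} (hv : IsEigenvector d η ξ K t v)
    (hn : ∀ n, q (xi d η ξ n (d n)) ≠ 0) (S : Conf d → ℂ) (h : Conf d) :
    sovCovector d η ξ K k₂ S h ⬝ᵥ v =
      (S ⬝ᵥ v) * ∏ n, (q (xi d η ξ n (h n : ℕ)) / q (xi d η ξ n (d n))) := by
  have hL (L : List (Fin N)) :
      (L.map fun n => (sovNorm d η ξ k₂ n (d n - (h n : ℕ)))⁻¹ •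
        fusedTransfer d η ξ K (d n - (h n : ℕ)) (xi d η ξ n (d n))).prod *ᵥ v =
      (L.map fun n => q (xi d η ξ n (h n : ℕ)) / q (xi d η ξ n (d n))).prod • v := by
    induction L with
    | nil => simp
    | cons n L ih =>
      have hle : (h n : ℕ) ≤ d n := Nat.lt_succ_iff.1 (h n).2
      rw [List.map_cons, List.prod_cons, ← mulVec_mulVec, ih, mulVec_smul, smul_mulVec,
        fusedTransfer_mulVec hη hdet hq hv n (hn n) (Nat.sub_le _ _), Nat.sub_sub_self hle,
        smul_smul, smul_smul, List.map_cons, List.prod_cons]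
      congr 1
      rw [mul_assoc, inv_mul_cancel_left₀ (hs.sovNorm_ne_zero hη hk₂ n (Nat.sub_le _ _)), mul_comm]
  rw [sovCovector_eq, ← dotProduct_mulVec, hL, dotProduct_smul, smul_eq_mul, mul_comm,
    ← List.ofFn_eq_map, List.prod_ofFn]

theorem exists_factorization (hη : η ≠ 0) (hs : DisjointStrings d η ξ)
    {K : Matrix (Fin 2) (Fin 2) ℂ} {k₁ k₂ : ℂ} (hk₂ : k₂ ≠ 0)
    (hdet : K.det = k₁ * k₂) {t q : ℂ → ℂ}
    (hq : ∀ x, t x * q x = k₁ * aFun d η ξ x * q (x - η) + k₂ * dFun d η ξ x * q (x + η))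
    {v : Conf d → ℂ} (hv : IsEigenvector d η ξ K t v)
    (hn : ∀ n, q (xi d η ξ n (d n)) ≠ 0) {S : Conf d → ℂ} (hS : IsSoVBasis d η ξ K k₂ S) :
    ∃ c : ℂ, c ≠ 0 ∧ ∀ h : Conf d,
      sovCovector d η ξ K k₂ S h ⬝ᵥ v = c * ∏ n, q (xi d η ξ n (h n : ℕ)) := by
  have hp := fun h => sovCovector_dotProduct hη hs hk₂ hdet hq hv hn S h
  have hn' : ∏ n, q (xi d η ξ n (d n)) ≠ 0 := Finset.prod_ne_zero_iff.2 fun n _ => hn n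
  refine ⟨(S ⬝ᵥ v) / ∏ n, q (xi d η ξ n (d n)), div_ne_zero (fun h0 => hv.1 ?_) hn', fun h => ?_⟩
  · let φ : (Conf d → ℂ) →ₗ[ℂ] ℂ :=
      { toFun := fun u => u ⬝ᵥ v
        map_add' := fun _ _ => add_dotProduct _ _ _
        map_smul' := fun _ _ => smul_dotProduct _ _ _ }
    have hφ : φ = 0 := LinearMap.ext_on_range hS.2 fun h => by
      change sovCovector d η ξ K k₂ S h ⬝ᵥ v = 0
      rw [hp, h0, zero_mul]
    ext i
    have := LinearMap.congr_fun hφ (Pi.single i 1)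
    simpa [φ] using this
  · rw [hp, Finset.prod_div_distrib]
    ring

end Factorization

/-! ### Characterization of the spectrum by difference equations on the strings -/

section Spectrum

/-- The second-order difference equation with coefficient `t` on the `n`-th string. -/
def StringEq (d : Fin N → ℕ) (η : ℂ) (ξ : Fin N → ℂ) (k₁ k₂ : ℂ) (t : ℂ → ℂ) (n : Fin N)
    (r : ℕ → ℂ) : Prop :=
  ∀ j ≤ d n, t (xi d η ξ n j) * r j =
    k₁ * aFun d η ξ (xi d η ξ n j) * r (j + 1) + k₂ * dFun d η ξ (xi d η ξ n j) * r (j - 1)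

/-- The value at the bottom determines all others: the upper neighbour drops out at j = d n, and for
j > 0 the coefficient of r (j - 1) is nonzero. The equation at j = 0 is not needed for this. -/
theorem StringEq.eq_zero (hη : η ≠ 0) (hs : DisjointStrings d η ξ) {k₁ k₂ : ℂ} (hk₂ : k₂ ≠ 0)
    {t : ℂ → ℂ} {n : Fin N} {r : ℕ → ℂ} {m : ℕ}
    (hr : ∀ j ≤ d n, m < j → t (xi d η ξ n j) * r j =
      k₁ * aFun d η ξ (xi d η ξ n j) * r (j + 1) + k₂ * dFun d η ξ (xi d η ξ n j) * r (j - 1))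
    (h0 : r (d n) = 0) (j : ℕ) (hj : j ≤ d n) (hmj : m ≤ j) : r j = 0 := by
  have key : ∀ i, i ≤ d n → m ≤ d n - i → r (d n - i) = 0 := by
    intro i
    induction i using Nat.twoStepInduction with
    | zero => intro _ _; exact h0
    | one =>
      intro hi hm
      have h1 := hr (d n) le_rfl (by omega)
      rw [h0, aFun_xi_top, mul_zero, mul_zero, zero_mul, zero_add, zero_eq_mul] at h1
      exact h1.resolve_left (mul_ne_zero hk₂ (hs.dFun_ne_zero hη le_rfl (by omega)))
    | more i ih0 ih1 =>
      intro hi hm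
      have h1 := hr (d n - (i + 1)) (Nat.sub_le _ _) (by omega)
      have e1 : d n - (i + 1) + 1 = d n - i := by omega
      have e2 : d n - (i + 1) - 1 = d n - (i + 2) := by omega
      rw [e1, e2, ih0 (by omega) (by omega), ih1 (by omega) (by omega), mul_zero, mul_zero,
        zero_add, zero_eq_mul] at h1
      exact h1.resolve_left (mul_ne_zero hk₂ (hs.dFun_ne_zero hη (Nat.sub_le _ _) (by omega)))
  have := key (d n - j) (Nat.sub_le _ _) (by omega)
  rwa [Nat.sub_sub_self hj] at this

theorem eq_zero_of_coeff_eq_zero_of_eval_eq_zero {ι : Type*} [Fintype ι] {m : ℕ}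
    (hm : Fintype.card ι = m) {p : Polynomial ℂ} (hdeg : p.natDegree ≤ m)
    (hcoeff : p.coeff m = 0) {z : ι → ℂ} (hz : Function.Injective z)
    (h : ∀ i, p.eval (z i) = 0) : p = 0 := by
  refine Polynomial.eq_zero_of_degree_lt_of_eval_index_eq_zero (v := z) Finset.univ hz.injOn ?_
    fun n _ => h n
  rw [Finset.card_univ, hm, Polynomial.degree_lt_iff_coeff_zero]
  intro k hk
  rcases hk.eq_or_lt with rfl | hk
  · exact hcoeff
  · exact Polynomial.coeff_eq_zero_of_natDegree_lt (hdeg.trans_lt hk)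

/-- The functions that separation of variables characterizes as transfer matrix eigenvalues. -/
def IsSeparatedEigenvalue (d : Fin N → ℕ) (η : ℂ) (ξ : Fin N → ℂ) (k₁ k₂ : ℂ) (t : ℂ → ℂ) : Prop :=
  (∃ p : Polynomial ℂ, p.natDegree ≤ N ∧ p.coeff N = k₁ + k₂ ∧ ∀ x, t x = p.eval x) ∧
    ∀ n, ∃ r : ℕ → ℂ, r (d n) = 1 ∧ StringEq d η ξ k₁ k₂ t n r

theorem mem_spectrumT_iff (hη : η ≠ 0) (hs : DisjointStrings d η ξ)
    {K : Matrix (Fin 2) (Fin 2) ℂ} {k₁ k₂ : ℂ} (hk : k₁ ≠ k₂) (hk₁ : k₁ ≠ 0) (hk₂ : k₂ ≠ 0)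
    (htr : K.trace = k₁ + k₂) (hdet : K.det = k₁ * k₂) (t : ℂ → ℂ) :
    t ∈ spectrumT d η ξ K ↔ IsSeparatedEigenvalue d η ξ k₁ k₂ t := by
  obtain ⟨Ψ, hli, hΨ⟩ := exists_separated_basis (d := d) (ξ := ξ) hη hs hk hk₁ hk₂ htr hdet
  obtain ⟨A, hA⟩ : ∃ A : Op d, A = Matrix.of fun h : Conf d => Ψ fun n => h n := ⟨_, rfl⟩
  have hAu : IsUnit A := by rw [hA]; exact linearIndependent_rows_iff_isUnit.1 hli
  have hAv (v : Conf d → ℂ) (h : Conf d) : (A *ᵥ v) h = (Ψ fun n => h n) ⬝ᵥ v := by rw [hA]; rfl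
  have hle (h : Conf d) (n : Fin N) : (h n : ℕ) ≤ d n := Nat.lt_succ_iff.1 (h n).2
  have hup {h : Fin N → ℕ} (hh : ∀ n, h n ≤ d n) (n : Fin N) {j : ℕ} (hj : j ≤ d n) (m : Fin N) :
      Function.update h n j m ≤ d m := by
    by_cases hm : m = n
    · subst hm; simpa using hj
    · simpa [hm] using hh m
  constructor
  · rintro ⟨v, hv0, hv⟩
    constructor
    · obtain ⟨i, hi⟩ := Function.ne_iff.1 hv0
      rw [Pi.zero_apply] at hi
      obtain ⟨p, h1, h2, h3⟩ := transfer_exists_polynomial d η ξ K (Pi.single i 1) v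
      refine ⟨Polynomial.C (v i)⁻¹ * p, (Polynomial.natDegree_C_mul_le _ _).trans h1, ?_,
        fun x => ?_⟩
      · rw [Polynomial.coeff_C_mul, h2, htr, single_dotProduct, one_mul]
        field_simp
      · have := h3 x
        rw [hv, dotProduct_smul, single_dotProduct, one_mul, smul_eq_mul] at this
        rw [Polynomial.eval_C_mul, ← this]
        field_simp
    · intro n
      obtain ⟨h, hh⟩ : ∃ h : Conf d, (Ψ fun n => h n) ⬝ᵥ v ≠ 0 := by
        by_contra! hc
        refine hv0 ((mulVec_injective_iff_isUnit.2 hAu) ?_)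
        rw [mulVec_zero]
        ext h
        rw [hAv, hc, Pi.zero_apply]
      -- With all other nodes frozen at a configuration of nonzero overlap, the wavefunction as a
      -- function of the `n`-th node solves the string equation; uniqueness makes its bottom value
      -- nonzero, so it can be normalized.
      obtain ⟨r, hr⟩ : ∃ r : ℕ → ℂ,
          r = fun j => Ψ (Function.update (fun m => (h m : ℕ)) n j) ⬝ᵥ v := ⟨_, rfl⟩
      have hrs : StringEq d η ξ k₁ k₂ t n r := by
        intro j hj
        have := congrArg (· ⬝ᵥ v) (hΨ _ (hup (hle h) n hj) n)
        simp only [Function.update_self, Function.update_idem] at this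
        rw [← dotProduct_mulVec, hv, dotProduct_smul, add_dotProduct, smul_dotProduct,
          smul_dotProduct] at this
        simpa only [hr, smul_eq_mul] using this
      have hrd : r (d n) ≠ 0 := by
        intro h0
        have := StringEq.eq_zero (m := 0) hη hs hk₂ (fun j hj _ => hrs j hj) h0 (h n) (hle h n)
          (Nat.zero_le _)
        rw [hr] at this
        simp only at this
        rw [Function.update_eq_self n fun m => (h m : ℕ)] at this
        exact hh this
      refine ⟨fun j => r j / r (d n), div_self hrd, fun j hj => ?_⟩
      have := hrs j hj
      field_simp
      linear_combination this
  · rintro ⟨⟨p, hp1, hp2, hp3⟩, hr⟩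
    choose r hr1 hr2 using hr
    -- The candidate eigenvector is prescribed by its factorized wavefunction in the separated
    -- basis.
    obtain ⟨v, hv⟩ : ∃ v, A *ᵥ v = fun h : Conf d => ∏ n, r n (h n) :=
      (mulVec_surjective_iff_isUnit.2 hAu) _
    have hv' (h : Fin N → ℕ) (hh : ∀ n, h n ≤ d n) : Ψ h ⬝ᵥ v = ∏ n, r n (h n) := by
      have := congrFun hv fun n => (⟨h n, Nat.lt_succ_of_le (hh n)⟩ : Fin (d n + 1))
      rwa [hAv] at this
    have hprod (h : Fin N → ℕ) (n : Fin N) (j : ℕ) : ∏ m, r m (Function.update h n j m) =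
        r n j * ∏ m ∈ Finset.univ.erase n, r m (h m) := by
      rw [← Finset.mul_prod_erase _ _ (Finset.mem_univ n), Function.update_self]
      congr 1
      refine Finset.prod_congr rfl fun m hm => ?_
      rw [Function.update_of_ne (Finset.ne_of_mem_erase hm)]
    refine ⟨v, ?_, fun x => (mulVec_injective_iff_isUnit.2 hAu) ?_⟩
    · rintro rfl
      have := hv' d fun _ => le_rfl
      rw [dotProduct_zero, Finset.prod_congr rfl fun n _ => hr1 n, Finset.prod_const_one] at this
      exact zero_ne_one this
    · ext h
      rw [hAv, mulVec_smul, Pi.smul_apply, hAv, smul_eq_mul]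
      obtain ⟨q, hq1, hq2, hq3⟩ := transfer_exists_polynomial d η ξ K (Ψ fun n => h n) v
      -- The two sides of the eigenvalue equation, paired with a separated state, are polynomials of
      -- degree at most N with equal coefficients in degree N. It suffices to compare them at the N
      -- nodes of that state, where the shift action is known.
      have hzero : q - Polynomial.C ((Ψ fun n => h n) ⬝ᵥ v) * p = 0 := by
        refine eq_zero_of_coeff_eq_zero_of_eval_eq_zero (Fintype.card_fin N) ?_ ?_
          (z := fun n => xi d η ξ n (h n : ℕ)) (fun a b e =>
            (hs.eq_of_xi_eq hη (hle h a) (hle h b) e).1) fun n => ?_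
        · exact (Polynomial.natDegree_sub_le _ _).trans
            (max_le hq1 ((Polynomial.natDegree_C_mul_le _ _).trans hp1))
        · rw [Polynomial.coeff_sub, Polynomial.coeff_C_mul, hq2, hp2, htr]
          ring
        · have hup1 : k₁ * aFun d η ξ (xi d η ξ n (h n : ℕ)) *
              (Ψ (Function.update (fun n => (h n : ℕ)) n (h n + 1)) ⬝ᵥ v) =
              k₁ * aFun d η ξ (xi d η ξ n (h n : ℕ)) *
                (r n (h n + 1) * ∏ m ∈ Finset.univ.erase n, r m (h m)) := by
            rcases (hle h n).lt_or_eq with hn | hn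
            · rw [hv' _ (hup (hle h) n hn), hprod]
            · rw [hn, aFun_xi_top]
              simp
          have h1 := congrArg (· ⬝ᵥ v) (hΨ _ (hle h) n)
          rw [← dotProduct_mulVec, add_dotProduct, smul_dotProduct, smul_dotProduct, smul_eq_mul,
            smul_eq_mul, hup1, hv' _ (hup (hle h) n ((Nat.sub_le _ 1).trans (hle h n))),
            hprod, hq3] at h1
          have h2 := hv' (fun m => (h m : ℕ)) (hle h)
          have h3 := hprod (fun m => (h m : ℕ)) n (h n)
          rw [Function.update_eq_self n fun m => (h m : ℕ)] at h3
          have h4 := hr2 n (h n) (hle h n)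
          rw [Polynomial.eval_sub, Polynomial.eval_C_mul, ← hp3, h1, h2, h3]
          linear_combination -(∏ m ∈ Finset.univ.erase n, r m (h m)) * h4
      have := congrArg (Polynomial.eval x) hzero
      rw [Polynomial.eval_sub, Polynomial.eval_C_mul, Polynomial.eval_zero, ← hq3, ← hp3,
        sub_eq_zero] at this
      rw [this, mul_comm]

end Spectrum

end HigherSpin

namespace HigherSpin

/-! ### Periodic ratios, division and linear pencils -/

section Polynomials

open Polynomial

/-- The quotient P / R is an η-periodic rational function. Along the points kη beyond the finitely
many zeros of R it is constant, and agreement at infinitely many points suffices. -/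
theorem exists_eq_C_mul_of_periodic_ratio {η : ℂ} (hη : η ≠ 0) {P R : ℂ[X]} (hR : R ≠ 0)
    (h : ∀ x, P.eval x * R.eval (x + η) = R.eval x * P.eval (x + η)) : ∃ c, P = C c * R := by
  have hinj : Function.Injective fun k : ℕ => (k : ℂ) * η := fun k l e => by
    exact_mod_cast mul_right_cancel₀ hη e
  obtain ⟨k₀, hk₀⟩ : ∃ k₀, ∀ k : ℕ, k₀ ≤ k → R.eval (k * η) ≠ 0 := by
    have hfin : {k : ℕ | R.eval (k * η) = 0}.Finite := by
      refine Set.Finite.preimage hinj.injOn (s := {x | R.eval x = 0}) ?_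
      exact (R.roots.toFinset.finite_toSet).subset fun x hx => by
        simpa [hR] using hx
    obtain ⟨b, hb⟩ := hfin.bddAbove
    exact ⟨b + 1, fun k hk h0 => by have := hb h0; omega⟩
  refine ⟨P.eval (k₀ * η) / R.eval (k₀ * η), ?_⟩
  have hz : ∀ k : ℕ, P.eval ((k₀ + k : ℕ) * η) =
      P.eval (k₀ * η) / R.eval (k₀ * η) * R.eval ((k₀ + k : ℕ) * η) := by
    intro k
    induction k with
    | zero => rw [add_zero, div_mul_cancel₀ _ (hk₀ _ le_rfl)]
    | succ k ih =>
      have h1 := h ((k₀ + k : ℕ) * η)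
      have e : ((k₀ + k : ℕ) : ℂ) * η + η = ((k₀ + (k + 1) : ℕ) : ℂ) * η := by push_cast; ring
      rw [e, ih] at h1
      refine mul_left_cancel₀ (hk₀ (k₀ + k) (by omega)) ?_
      linear_combination -h1
  refine Polynomial.eq_of_infinite_eval_eq _ _ ?_
  refine Set.Infinite.mono (s := Set.range fun k : ℕ => ((k₀ + k : ℕ) : ℂ) * η) ?_ ?_
  · rintro _ ⟨k, rfl⟩
    rw [Set.mem_ofPred_eq, eval_mul, eval_C]
    exact hz k
  · refine Set.infinite_range_of_injective fun k l e => ?_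
    have := hinj e
    omega

/-- Each root of Q is a root of P and can be divided out of both; continuity of t restores the
identity at the root. -/
theorem exists_polynomial_of_mul_eq {t : ℂ → ℂ} (ht : Continuous t) {Q : ℂ[X]} (hQ : Q ≠ 0)
    {P : ℂ[X]} (h : ∀ x, t x * Q.eval x = P.eval x) : ∃ S : ℂ[X], ∀ x, t x = S.eval x := by
  induction hn : Q.natDegree generalizing Q P with
  | zero =>
    obtain ⟨c, rfl⟩ := natDegree_eq_zero.1 hn
    have hc : c ≠ 0 := fun h0 => hQ (by rw [h0, C_0])
    refine ⟨P * C c⁻¹, fun x => ?_⟩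
    rw [eval_mul, ← h, eval_C, eval_C, mul_inv_cancel_right₀ hc]
  | succ n ih =>
    obtain ⟨z, hz⟩ := IsAlgClosed.exists_root Q (degree_ne_of_natDegree_ne (by rw [hn]; exact Nat.succ_ne_zero n))
    obtain ⟨Q₁, rfl⟩ := dvd_iff_isRoot.2 hz
    have hP : P.IsRoot z := by rw [IsRoot, ← h, hz.eq_zero, mul_zero]
    obtain ⟨P₁, rfl⟩ := dvd_iff_isRoot.2 hP
    have hQ₁ : Q₁ ≠ 0 := right_ne_zero_of_mul hQ
    refine ih (P := P₁) hQ₁ (fun x => ?_) ?_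
    · refine congrFun (Continuous.ext_on (f := fun x => t x * Q₁.eval x)
        (g := fun x => P₁.eval x) (dense_compl_singleton z) (ht.mul Q₁.continuous) P₁.continuous fun x hx => ?_) x
      have := h x
      simp only [eval_mul, eval_sub, eval_X, eval_C] at this
      refine mul_left_cancel₀ (sub_ne_zero.2 hx) ?_
      linear_combination this
    · rw [natDegree_mul (X_sub_C_ne_zero z) hQ₁, natDegree_X_sub_C] at hn
      omega

theorem coeff_taylor_of_natDegree_le {Q : ℂ[X]} {m : ℕ} (h : Q.natDegree ≤ m) (c : ℂ) :
    (taylor c Q).coeff m = Q.coeff m := by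
  rcases h.eq_or_lt with rfl | h
  · exact coeff_taylor_natDegree _ _
  · rw [coeff_eq_zero_of_natDegree_lt h,
      coeff_eq_zero_of_natDegree_lt (by rwa [natDegree_taylor])]

/-- With a left inverse G of F₀, a kernel vector of F₀ + κ F₁ is an eigenvector of G F₁ for the
eigenvalue -κ⁻¹, and there are finitely many eigenvalues. -/
theorem finite_not_injective_add_smul {V W : Type*} [AddCommGroup V] [Module ℂ V]
    [FiniteDimensional ℂ V] [AddCommGroup W] [Module ℂ W] (F₀ F₁ : V →ₗ[ℂ] W)
    (h : Function.Injective F₀) : {κ : ℂ | ¬ Function.Injective (F₀ + κ • F₁)}.Finite := by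
  obtain ⟨G, hG⟩ := F₀.exists_leftInverse_of_injective (LinearMap.ker_eq_bot.2 h)
  refine Set.Finite.subset (Set.Finite.preimage (f := fun κ : ℂ => -κ⁻¹)
    (fun a _ b _ e => by simpa using e) (Module.End.finite_hasEigenvalue (G ∘ₗ F₁))) ?_
  intro κ hκ
  rw [Set.mem_ofPred_eq, ← LinearMap.ker_eq_bot, LinearMap.ker_eq_bot'] at hκ
  push Not at hκ
  obtain ⟨y, hy, hy0⟩ := hκ
  have h1 : y + κ • G (F₁ y) = 0 := by
    have := congrArg G hy
    rw [LinearMap.add_apply, LinearMap.smul_apply, map_add, map_smul, map_zero] at this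
    rwa [← LinearMap.comp_apply, hG, LinearMap.id_apply] at this
  have hκ0 : κ ≠ 0 := by
    rintro rfl
    exact hy0 (by simpa using h1)
  refine Module.End.hasEigenvalue_of_hasEigenvector (x := y)
    ⟨Module.End.mem_eigenspace_iff.2 ?_, hy0⟩
  rw [LinearMap.comp_apply]
  conv_rhs => rw [eq_neg_of_add_eq_zero_left h1, smul_neg, neg_smul, neg_neg, smul_smul,
    inv_mul_cancel₀ hκ0, one_smul]

end Polynomials

/-! ### The TQ equation: uniqueness, sufficiency and the spectral curve -/

section TQ

open Polynomial

variable {N : ℕ} {d : Fin N → ℕ} {η : ℂ} {ξ : Fin N → ℂ}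

/-- The `TQ` equation. -/
def TQ (d : Fin N → ℕ) (η : ℂ) (ξ : Fin N → ℂ) (k₁ k₂ : ℂ) (t : ℂ → ℂ) (Q : ℂ[X]) : Prop :=
  ∀ x, t x * Q.eval x =
    k₁ * aFun d η ξ x * Q.eval (x - η) + k₂ * dFun d η ξ x * Q.eval (x + η)

theorem nodePoly_one_monic (z : Fin N → ℂ) : (nodePoly 1 z).Monic := by
  rw [nodePoly, C_1, one_mul]
  exact monic_prod_of_monic _ _ fun n _ => monic_X_sub_C _

theorem nodePoly_one_natDegree (z : Fin N → ℂ) : (nodePoly 1 z).natDegree = N := by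
  rw [nodePoly, C_1, one_mul, natDegree_prod_of_monic _ _ fun n _ => monic_X_sub_C _]
  simp

theorem nodePoly_one_coeff (z : Fin N → ℂ) : (nodePoly 1 z).coeff N = 1 := by
  have := nodePoly_one_monic z
  rwa [Monic, leadingCoeff, nodePoly_one_natDegree] at this

variable (d η ξ) in
/-- `a(x)` as a polynomial. -/
noncomputable def aPoly : ℂ[X] := nodePoly 1 fun n => xi d η ξ n (d n)

variable (d η ξ) in
/-- `d(x)` as a polynomial. -/
noncomputable def dPoly : ℂ[X] := nodePoly 1 fun n => xi d η ξ n 0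

theorem aPoly_eval (x : ℂ) : (aPoly d η ξ).eval x = aFun d η ξ x := by
  rw [aPoly, nodePoly_eval, aFun_eq, one_mul]

theorem dPoly_eval (x : ℂ) : (dPoly d η ξ).eval x = dFun d η ξ x := by
  rw [dPoly, nodePoly_eval, dFun_eq, one_mul]

theorem aFun_continuous : Continuous (aFun d η ξ) := by
  have := (aPoly d η ξ).continuous
  simpa only [aPoly_eval] using this

theorem dFun_continuous : Continuous (dFun d η ξ) := by
  have := (dPoly d η ξ).continuous
  simpa only [dPoly_eval] using this

variable (d η ξ) in
/-- The right-hand side of the `TQ` equation. -/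
noncomputable def tqPoly (k₁ k₂ : ℂ) (Q : ℂ[X]) : ℂ[X] :=
  C k₁ * (aPoly d η ξ * taylor (-η) Q) + C k₂ * (dPoly d η ξ * taylor η Q)

theorem tqPoly_eval (k₁ k₂ : ℂ) (Q : ℂ[X]) (x : ℂ) : (tqPoly d η ξ k₁ k₂ Q).eval x =
    k₁ * aFun d η ξ x * Q.eval (x - η) + k₂ * dFun d η ξ x * Q.eval (x + η) := by
  simp only [tqPoly, eval_add, eval_mul, eval_C, aPoly_eval, dPoly_eval, taylor_eval,
    sub_eq_add_neg]
  ring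

theorem tqPoly_natDegree_le (k₁ k₂ : ℂ) {Q : ℂ[X]} {m : ℕ} (hQ : Q.natDegree ≤ m) :
    (tqPoly d η ξ k₁ k₂ Q).natDegree ≤ N + m := by
  refine natDegree_add_le_of_degree_le ?_ ?_ <;>
    refine (natDegree_C_mul_le _ _).trans (natDegree_mul_le.trans ?_) <;>
    rw [natDegree_taylor]
  · exact Nat.add_le_add (nodePoly_one_natDegree _).le hQ
  · exact Nat.add_le_add (nodePoly_one_natDegree _).le hQ

theorem tqPoly_coeff (k₁ k₂ : ℂ) {Q : ℂ[X]} {m : ℕ} (hQ : Q.natDegree ≤ m) :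
    (tqPoly d η ξ k₁ k₂ Q).coeff (N + m) = (k₁ + k₂) * Q.coeff m := by
  rw [tqPoly, aPoly, dPoly, coeff_add, coeff_C_mul, coeff_C_mul,
    coeff_mul_add_eq_of_natDegree_le (nodePoly_one_natDegree _).le (by rwa [natDegree_taylor]),
    coeff_mul_add_eq_of_natDegree_le (nodePoly_one_natDegree _).le (by rwa [natDegree_taylor]),
    nodePoly_one_coeff, nodePoly_one_coeff, coeff_taylor_of_natDegree_le hQ,
    coeff_taylor_of_natDegree_le hQ]
  ring

/-- The Casoratian W satisfies k₁ a(x) W(x) = k₂ d(x) W(x + η). As a and d are monic, a nonzero W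
would force k₁ = k₂ on leading coefficients. With W = 0 the ratio of the solutions is η-periodic,
hence constant, and both are monic. -/
theorem TQ.unique (hη : η ≠ 0) {k₁ k₂ : ℂ} (hk : k₁ ≠ k₂) {t : ℂ → ℂ} {Q R : ℂ[X]}
    (hQ : TQ d η ξ k₁ k₂ t Q) (hR : TQ d η ξ k₁ k₂ t R) (hQm : Q.Monic) (hRm : R.Monic) : R = Q := by
  obtain ⟨W, hW⟩ : ∃ W : ℂ[X], W = Q * taylor (-η) R - R * taylor (-η) Q := ⟨_, rfl⟩
  have hWx (x : ℂ) : W.eval x = Q.eval x * R.eval (x - η) - R.eval x * Q.eval (x - η) := by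
    simp only [hW, eval_sub, eval_mul, taylor_eval]
    rw [← sub_eq_add_neg]
  have h1 : C k₁ * (aPoly d η ξ * W) = C k₂ * (dPoly d η ξ * taylor η W) := by
    refine Polynomial.funext fun x => ?_
    simp only [eval_mul, eval_C, aPoly_eval, dPoly_eval, taylor_eval, hWx, add_sub_cancel_right]
    linear_combination R.eval x * hQ x - Q.eval x * hR x
  have hW0 : W = 0 := by
    by_contra h0
    have h2 := congrArg leadingCoeff h1
    simp only [leadingCoeff_mul, leadingCoeff_C, leadingCoeff_taylor,
      (nodePoly_one_monic fun n => xi d η ξ n (d n)).leadingCoeff,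
      (nodePoly_one_monic fun n => xi d η ξ n 0).leadingCoeff, aPoly, dPoly, one_mul] at h2
    exact hk (mul_right_cancel₀ (leadingCoeff_ne_zero.2 h0) h2)
  obtain ⟨c, hc⟩ := exists_eq_C_mul_of_periodic_ratio (P := R) (R := Q) hη hQm.ne_zero fun x => by
    have := hWx (x + η)
    rw [hW0, eval_zero, add_sub_cancel_right] at this
    linear_combination -this
  have := congrArg leadingCoeff hc
  rw [leadingCoeff_mul, leadingCoeff_C, hQm.leadingCoeff, hRm.leadingCoeff, mul_one] at this
  rw [hc, ← this, C_1, one_mul]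

/-- Dividing the TQ equation by Q shows that t is a polynomial and fixes its top coefficient. The
values of Q along a string, normalized at its bottom, solve the string equation. -/
theorem TQ.isSeparatedEigenvalue {k₁ k₂ : ℂ} {t : ℂ → ℂ} (ht : Continuous t) {Q : ℂ[X]}
    (hQ : TQ d η ξ k₁ k₂ t Q) (hQm : Q.Monic) (hQ0 : ∀ n, Q.eval (xi d η ξ n (d n)) ≠ 0) :
    IsSeparatedEigenvalue d η ξ k₁ k₂ t := by
  obtain ⟨S, hS⟩ := exists_polynomial_of_mul_eq ht hQm.ne_zero
    (fun x => (hQ x).trans (tqPoly_eval k₁ k₂ Q x).symm)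
  have hQS : Q * S = tqPoly d η ξ k₁ k₂ Q := by
    refine Polynomial.funext fun x => ?_
    rw [eval_mul, tqPoly_eval, ← hQ, hS, mul_comm]
  have hdeg : S.natDegree ≤ N := by
    by_cases hS0 : S = 0
    · simp [hS0]
    have := congrArg natDegree hQS
    rw [natDegree_mul hQm.ne_zero hS0] at this
    have h2 := tqPoly_natDegree_le (d := d) (η := η) (ξ := ξ) k₁ k₂ (le_refl Q.natDegree)
    omega
  refine ⟨⟨S, hdeg, ?_, hS⟩, fun n => ⟨fun j => Q.eval (xi d η ξ n j) / Q.eval (xi d η ξ n (d n)),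
    div_self (hQ0 n), fun j _ => ?_⟩⟩
  · have h1 := congrArg (fun p => p.coeff (Q.natDegree + N)) hQS
    rw [coeff_mul_add_eq_of_natDegree_le le_rfl hdeg, add_comm, tqPoly_coeff _ _ le_rfl] at h1
    have h2 : Q.coeff Q.natDegree = 1 := hQm
    rwa [h2, one_mul, mul_one] at h1
  · have h1 := hQ (xi d η ξ n j)
    rw [← xi_succ] at h1
    -- For j = 0 the truncated subtraction gives the wrong neighbour, which is harmless because d
    -- vanishes there.
    have h2 : k₂ * dFun d η ξ (xi d η ξ n j) * Q.eval (xi d η ξ n j + η) =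
        k₂ * dFun d η ξ (xi d η ξ n j) * Q.eval (xi d η ξ n (j - 1)) := by
      rcases j with _ | j
      · rw [dFun_xi_zero, mul_zero, zero_mul, zero_mul]
      · rw [xi_succ, sub_add_cancel, Nat.add_sub_cancel]
    rw [h2] at h1
    field_simp [hQ0 n]
    linear_combination h1

/-- The spectral curve is k₁ a(x) times the TQ equation at x - η, up to sign. The zeros of a are
isolated, so the factor can be removed by continuity. -/
theorem spectralCurve_iff (hη : η ≠ 0) {K : Matrix (Fin 2) (Fin 2) ℂ} {k₁ k₂ : ℂ} (hk₁ : k₁ ≠ 0)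
    (hdet : K.det = k₁ * k₂) {t : ℂ → ℂ} (ht : Continuous t) (Q : ℂ[X]) :
    SpectralCurve d η ξ K k₁ t Q ↔ TQ d η ξ k₁ k₂ t Q := by
  have h1 : SpectralCurve d η ξ K k₁ t Q ↔ ∀ x, aFun d η ξ x *
      (k₁ * aFun d η ξ (x - η) * Q.eval (x - 2 * η) - t (x - η) * Q.eval (x - η) +
        k₂ * dFun d η ξ (x - η) * Q.eval x) = 0 := by
    refine forall_congr' fun x => ?_
    rw [qdet_eq d η ξ hη, hdet, smul_smul, ← add_smul, smul_eq_zero,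
      or_iff_left (one_ne_zero : (1 : Op d) ≠ 0)]
    have : alphaFun d η ξ k₁ x * Q.eval (x - 2 * η) -
        betaFun d η ξ k₁ x * t (x - η) * Q.eval (x - η) +
        Q.eval x * (k₁ * k₂ * (aFun d η ξ x * dFun d η ξ (x - η))) = k₁ * (aFun d η ξ x *
      (k₁ * aFun d η ξ (x - η) * Q.eval (x - 2 * η) - t (x - η) * Q.eval (x - η) +
        k₂ * dFun d η ξ (x - η) * Q.eval x)) := by
      simp only [alphaFun, betaFun]
      ring
    rw [this, mul_eq_zero, or_iff_right hk₁]
  rw [h1]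
  constructor
  · intro h y
    have hd : Dense {x : ℂ | aFun d η ξ x ≠ 0} := by
      have hfin : {x : ℂ | aFun d η ξ x = 0}.Finite := by
        refine (Set.finite_range fun n => xi d η ξ n (d n)).subset fun x hx => ?_
        rw [Set.mem_ofPred_eq, aFun_eq, Finset.prod_eq_zero_iff] at hx
        obtain ⟨n, -, hn⟩ := hx
        exact ⟨n, (sub_eq_zero.1 hn).symm⟩
      exact hfin.countable.dense_compl ℂ
    have hcont := aFun_continuous (d := d) (η := η) (ξ := ξ)
    have hcont' := dFun_continuous (d := d) (η := η) (ξ := ξ)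
    have hQc := Q.continuous
    have h2 := congrFun (Continuous.ext_on hd (f := fun x =>
      k₁ * aFun d η ξ (x - η) * Q.eval (x - 2 * η) - t (x - η) * Q.eval (x - η) +
        k₂ * dFun d η ξ (x - η) * Q.eval x) (g := fun _ => 0) (by fun_prop) continuous_const
        fun x hx => (mul_eq_zero.1 (h x)).resolve_left hx) (y + η)
    simp only [add_sub_cancel_right] at h2
    have e : y + η - 2 * η = y - η := by ring
    rw [e] at h2
    linear_combination -h2
  · intro h x
    have h2 := h (x - η)
    have e : x - η - η = x - 2 * η := by ring
    rw [sub_add_cancel, e] at h2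
    rw [h2]
    ring

end TQ

end HigherSpin

/-! ### Existence of Q and the finite set of exceptional twists -/

namespace HigherSpin

open Matrix Polynomial

variable {N : ℕ} {d : Fin N → ℕ} {η : ℂ} {ξ : Fin N → ℂ}

/-- Every solution of the separated equations comes from a polynomial solution of the `TQ`
equation. -/
theorem IsSeparatedEigenvalue.exists_tq (hη : η ≠ 0) (hs : DisjointStrings d η ξ)
    (hd : ∀ n, 0 < d n) {k₁ k₂ : ℂ} (hk₂ : k₂ ≠ 0) {t : ℂ → ℂ}
    (ht : IsSeparatedEigenvalue d η ξ k₁ k₂ t) :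
    ∃ Q : ℂ[X], Q ≠ 0 ∧ Q.natDegree ≤ ∑ n, d n ∧ TQ d η ξ k₁ k₂ t Q := by
  obtain ⟨⟨S, hS1, hS2, hS3⟩, hr⟩ := ht
  choose r hr1 hr2 using hr
  let F : degreeLT ℂ (∑ n, d n + 1) →ₗ[ℂ] ((Σ n, Fin (d n)) → ℂ) :=
    { toFun := fun Q i => (S * Q.1 - tqPoly d η ξ k₁ k₂ Q.1).eval (xi d η ξ i.1 (i.2 + 1))
      map_add' := fun P Q => by
        funext i
        simp only [Pi.add_apply, eval_sub, eval_mul, tqPoly_eval, Submodule.coe_add, eval_add]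
        ring
      map_smul' := fun c Q => by
        funext i
        simp only [Pi.smul_apply, eval_sub, eval_mul, tqPoly_eval, Submodule.coe_smul, eval_smul,
          smul_eq_mul, RingHom.id_apply]
        ring }
  -- There are ∑ d n + 1 coefficients and only ∑ d n conditions, since the TQ equation is imposed at
  -- the string points other than the tops ξ_n^(0).
  obtain ⟨Q, hQF, hQ0⟩ := (Submodule.ne_bot_iff _).1 (LinearMap.ker_ne_bot_of_finrank_lt (f := F) (by
    rw [(degreeLTEquiv ℂ _).finrank_eq]
    simp))
  have hQ0' : Q.1 ≠ 0 := fun h0 => hQ0 (Subtype.ext h0)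
  have hQdeg : Q.1.natDegree ≤ ∑ n, d n := by
    have := (natDegree_lt_iff_degree_lt hQ0').2 (mem_degreeLT.1 Q.2)
    omega
  have hpos (n : Fin N) (j : ℕ) (hj : j ≤ d n) (hj0 : 0 < j) :
      t (xi d η ξ n j) * Q.1.eval (xi d η ξ n j) =
        k₁ * aFun d η ξ (xi d η ξ n j) * Q.1.eval (xi d η ξ n (j + 1)) +
          k₂ * dFun d η ξ (xi d η ξ n j) * Q.1.eval (xi d η ξ n (j - 1)) := by
    obtain ⟨i, rfl⟩ : ∃ i, j = i + 1 := ⟨j - 1, by omega⟩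
    have h1 : (S * Q.1 - tqPoly d η ξ k₁ k₂ Q.1).eval (xi d η ξ n (i + 1)) = 0 :=
      congrFun (LinearMap.mem_ker.1 hQF) ⟨n, ⟨i, hj⟩⟩
    rw [eval_sub, eval_mul, tqPoly_eval, ← hS3, ← xi_succ] at h1
    have e : xi d η ξ n (i + 1) + η = xi d η ξ n i := by rw [xi_succ, sub_add_cancel]
    rw [e] at h1
    rw [Nat.add_sub_cancel]
    linear_combination h1
  -- The conditions imposed already determine a string solution from its bottom value, so Q is
  -- proportional to `r` there and inherits the missing equation at j = 0.
  have hstr (n : Fin N) (j : ℕ) (hj : j ≤ d n) :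
      Q.1.eval (xi d η ξ n j) = Q.1.eval (xi d η ξ n (d n)) * r n j := by
    refine sub_eq_zero.1 (StringEq.eq_zero (m := 0) (k₁ := k₁) (k₂ := k₂) (t := t) hη hs hk₂
      (r := fun j => Q.1.eval (xi d η ξ n j) - Q.1.eval (xi d η ξ n (d n)) * r n j)
      (fun i hi hi0 => ?_) (by simp only [hr1, mul_one, sub_self]) j hj (Nat.zero_le _))
    linear_combination hpos n i hi hi0 - Q.1.eval (xi d η ξ n (d n)) * hr2 n i hi
  -- The defect has degree at most N + ∑ d n, its top coefficient cancels because S has coefficient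
  -- k₁ + k₂ in degree N, and it vanishes at all N + ∑ d n string points.
  have hzero : S * Q.1 - tqPoly d η ξ k₁ k₂ Q.1 = 0 := by
    have hcard : Fintype.card (Σ n, Fin (d n + 1)) = N + ∑ n, d n := by
      simp [Finset.sum_add_distrib, add_comm]
    refine eq_zero_of_coeff_eq_zero_of_eval_eq_zero hcard
      (z := fun i => xi d η ξ i.1 (i.2 : ℕ)) ?_ ?_ ?_ ?_
    · exact (natDegree_sub_le _ _).trans (max_le
        (natDegree_mul_le.trans (Nat.add_le_add hS1 hQdeg)) (tqPoly_natDegree_le _ _ hQdeg))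
    · rw [coeff_sub, coeff_mul_add_eq_of_natDegree_le hS1 hQdeg, tqPoly_coeff _ _ hQdeg,
        hS2, sub_self]
    · rintro ⟨a, h⟩ ⟨b, k⟩ e
      obtain ⟨rfl, hk⟩ := hs.eq_of_xi_eq hη (Nat.lt_succ_iff.1 h.2) (Nat.lt_succ_iff.1 k.2) e
      rw [Fin.ext hk]
    · rintro ⟨n, j⟩
      have hj : (j : ℕ) ≤ d n := Nat.lt_succ_iff.1 j.2
      rw [eval_sub, eval_mul, tqPoly_eval, ← hS3, ← xi_succ, sub_eq_zero]
      rcases Nat.eq_zero_or_pos (j : ℕ) with h0 | h0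
      · have h1 := hr2 n 0 (Nat.zero_le _)
        rw [h0]
        rw [dFun_xi_zero, mul_zero, zero_mul, add_zero] at h1 ⊢
        rw [hstr n 0 (Nat.zero_le _), hstr n (0 + 1) (hd n)]
        linear_combination Q.1.eval (xi d η ξ n (d n)) * h1
      · have h1 := hpos n j hj h0
        have e : xi d η ξ n j + η = xi d η ξ n (j - 1) := by
          obtain ⟨i, hi⟩ : ∃ i, (j : ℕ) = i + 1 := ⟨j - 1, by omega⟩
          rw [hi, xi_succ, sub_add_cancel, Nat.add_sub_cancel]
        rw [e]
        linear_combination h1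
  refine ⟨Q.1, hQ0', hQdeg, fun x => ?_⟩
  rw [← tqPoly_eval, hS3, ← eval_mul, sub_eq_zero.1 hzero]

variable (d) in
/-- The values at `x` of a vector of polynomials. -/
noncomputable def evalVec (m : ℕ) (x : ℂ) : (Conf d → degreeLT ℂ m) →ₗ[ℂ] (Conf d → ℂ) where
  toFun Y c := (Y c).1.eval x
  map_add' Y Z := by
    funext c
    simp only [Pi.add_apply, Submodule.coe_add, eval_add]
  map_smul' a Y := by
    funext c
    simp only [Pi.smul_apply, Submodule.coe_smul, eval_smul, RingHom.id_apply]

variable (d η ξ) in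
/-- The vector-valued `TQ` equation at `k₁ = 0`, `k₂ = 1`, with a zero prescribed at
`ξ_b^(2 s_b)`. -/
noncomputable def degenerateTQ (m : ℕ) (b : Fin N) :
    (Conf d → degreeLT ℂ m) →ₗ[ℂ] (ℂ → Conf d → ℂ) × (Conf d → ℂ) :=
  (LinearMap.pi fun x => (untwisted d η ξ x 1 1).mulVecLin ∘ₗ evalVec d m x -
    dFun d η ξ x • evalVec d m (x + η)).prod (evalVec d m (xi d η ξ b (d b)))

variable (d η ξ) in
/-- The coefficient of `k₁` in the vector-valued `TQ` equation. -/
noncomputable def twistTQ (m : ℕ) :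
    (Conf d → degreeLT ℂ m) →ₗ[ℂ] (ℂ → Conf d → ℂ) × (Conf d → ℂ) :=
  (LinearMap.pi fun x => (untwisted d η ξ x 0 0).mulVecLin ∘ₗ evalVec d m x -
    aFun d η ξ x • evalVec d m (x - η)).prod 0

/-- In the left eigenbasis of the untwisted D the equation decouples into scalar first-order ones.
Their polynomial solutions are multiples of an explicit product that does not vanish at the
prescribed zero. -/
theorem degenerateTQ_injective (hη : η ≠ 0) (hs : DisjointStrings d η ξ) (m : ℕ) (b : Fin N) :
    Function.Injective (degenerateTQ d η ξ m b) := by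
  refine (injective_iff_map_eq_zero _).2 fun Y hY => ?_
  have hY1 (x : ℂ) : untwisted d η ξ x 1 1 *ᵥ evalVec d m x Y =
      dFun d η ξ x • evalVec d m (x + η) Y :=
    sub_eq_zero.1 (congrFun (congrArg Prod.fst hY) x)
  have hY2 : evalVec d m (xi d η ξ b (d b)) Y = 0 := congrArg Prod.snd hY
  obtain ⟨Ψ, hli, hΨ⟩ := exists_eigenbasis_D (d := d) (ξ := ξ) hη hs
  have hAu : IsUnit (Matrix.of Ψ) := linearIndependent_rows_iff_isUnit.1 hli
  have hP (h : Conf d) : ∑ c, C (Ψ h c) * (Y c).1 = 0 := by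
    obtain ⟨P, hPdef⟩ : ∃ P, P = ∑ c, C (Ψ h c) * (Y c).1 := ⟨_, rfl⟩
    have hPx (x : ℂ) : P.eval x = Ψ h ⬝ᵥ evalVec d m x Y := by
      rw [hPdef, eval_finsetSum, dotProduct]
      exact Finset.sum_congr rfl fun c _ => eval_C_mul
    -- The product over the string points above the node telescopes under x ↦ x + η: its top factor
    -- is traded for the factor at the node, which solves the first-order equation.
    obtain ⟨R, hR⟩ : ∃ R : ℂ[X], R = ∏ n, ∏ j ∈ Finset.range (h n), (X - C (xi d η ξ n j)) :=
      ⟨_, rfl⟩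
    have hRx (x : ℂ) : R.eval x = ∏ n, ∏ j ∈ Finset.range (h n), (x - xi d η ξ n j) := by
      simp [hR, eval_prod]
    have hP1 (x : ℂ) : (∏ n, (x - xi d η ξ n (h n : ℕ))) * P.eval x =
        dFun d η ξ x * P.eval (x + η) := by
      have := congrArg (Ψ h ⬝ᵥ ·) (hY1 x)
      rwa [dotProduct_mulVec, hΨ, smul_dotProduct, dotProduct_smul, ← hPx, ← hPx] at this
    have hR1 (x : ℂ) : (∏ n, (x - xi d η ξ n (h n : ℕ))) * R.eval x =
        dFun d η ξ x * R.eval (x + η) := by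
      rw [hRx, hRx, dFun_eq, ← Finset.prod_mul_distrib, ← Finset.prod_mul_distrib]
      refine Finset.prod_congr rfl fun n _ => ?_
      rw [mul_comm, ← Finset.prod_range_succ fun j => x - xi d η ξ n j, Finset.prod_range_succ',
        mul_comm]
      congr 1
      refine Finset.prod_congr rfl fun j _ => ?_
      rw [xi_succ]
      ring
    have hR0 : R.eval (xi d η ξ b (d b)) ≠ 0 := by
      rw [hRx]
      refine Finset.prod_ne_zero_iff.2 fun n _ => Finset.prod_ne_zero_iff.2 fun j hj => ?_
      refine sub_ne_zero.2 fun e => ?_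
      have hj' := Finset.mem_range.1 hj
      have hn := (h n).2
      obtain ⟨rfl, hjb⟩ := hs.eq_of_xi_eq hη le_rfl (by omega) e
      omega
    obtain ⟨c, hc⟩ := exists_eq_C_mul_of_periodic_ratio (P := P) (R := R) hη
      (fun h0 => hR0 (by rw [h0, eval_zero])) fun x => by
        have hz : dPoly d η ξ * (P * taylor η R - R * taylor η P) = 0 := by
          refine Polynomial.funext fun y => ?_
          simp only [eval_mul, eval_sub, dPoly_eval, taylor_eval, eval_zero]
          linear_combination R.eval y * hP1 y - P.eval y * hR1 y
        have hz' := congrArg (eval x) ((mul_eq_zero.1 hz).resolve_left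
          (nodePoly_one_monic fun n => xi d η ξ n 0).ne_zero)
        simp only [eval_mul, eval_sub, taylor_eval, eval_zero] at hz'
        exact sub_eq_zero.1 hz'
    have hc0 := hPx (xi d η ξ b (d b))
    rw [hY2, dotProduct_zero, hc, eval_C_mul] at hc0
    rw [← hPdef, hc, (mul_eq_zero.1 hc0).resolve_right hR0, C_0, zero_mul]
  have hev (x : ℂ) : evalVec d m x Y = 0 := by
    refine mulVec_injective_iff_isUnit.2 hAu ?_
    rw [mulVec_zero]
    funext h
    have := congrArg (eval x) (hP h)
    rw [eval_finsetSum, eval_zero] at this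
    rw [Pi.zero_apply, ← this]
    exact Finset.sum_congr rfl fun c _ => eval_C_mul.symm
  funext c
  refine Subtype.ext (Polynomial.funext fun x => ?_)
  rw [Pi.zero_apply, Submodule.coe_zero, eval_zero]
  exact congrFun (hev x) c

variable (d η ξ) in
/-- The values of `k₁ / k₂` at which a solution of the `TQ` equation may vanish at one of the points
`ξ_b^(2 s_b)`. -/
def exceptionalTwists : Set ℂ :=
  ⋃ b, {κ | ¬ Function.Injective
    (degenerateTQ d η ξ (∑ n, d n + 1) b + κ • twistTQ d η ξ (∑ n, d n + 1))}

theorem exceptionalTwists_finite (hη : η ≠ 0) (hs : DisjointStrings d η ξ) :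
    (exceptionalTwists d η ξ).Finite :=
  Set.finite_iUnion fun b => finite_not_injective_add_smul _ _ (degenerateTQ_injective hη hs _ b)

/-- For an eigenvector v of the twist diag(κ, 1), the vector polynomial v ⊗ Q solves the
vector-valued TQ equation without reference to t. A zero of Q at the prescribed point would put it
into the kernel of the pencil. -/
theorem TQ.eval_ne_zero (hη : η ≠ 0) (hs : DisjointStrings d η ξ) {k₁ k₂ : ℂ} (hk : k₁ ≠ k₂)
    (hk₁ : k₁ ≠ 0) (hk₂ : k₂ ≠ 0) (hE : k₁ / k₂ ∉ exceptionalTwists d η ξ) {t : ℂ → ℂ}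
    (ht : IsSeparatedEigenvalue d η ξ k₁ k₂ t) {Q : ℂ[X]} (hQ0 : Q ≠ 0)
    (hQdeg : Q.natDegree ≤ ∑ n, d n) (hQ : TQ d η ξ k₁ k₂ t Q) (b : Fin N) :
    Q.eval (xi d η ξ b (d b)) ≠ 0 := by
  intro hb
  obtain ⟨κ, hκ⟩ : ∃ κ, κ = k₁ / k₂ := ⟨_, rfl⟩
  have hκ1 : κ ≠ 1 := by rw [hκ]; exact fun h => hk ((div_eq_one_iff_eq hk₂).1 h)
  have hκ0 : κ ≠ 0 := by rw [hκ]; exact div_ne_zero hk₁ hk₂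
  have ht' : IsSeparatedEigenvalue d η ξ κ 1 fun x => k₂⁻¹ * t x := by
    obtain ⟨⟨p, h1, h2, h3⟩, hr⟩ := ht
    refine ⟨⟨C k₂⁻¹ * p, (natDegree_C_mul_le _ _).trans h1, ?_, fun x => ?_⟩, fun n => ?_⟩
    · rw [coeff_C_mul, h2, hκ]
      field_simp
    · rw [eval_C_mul, ← h3]
    · obtain ⟨r, hr1, hr2⟩ := hr n
      refine ⟨r, hr1, fun j hj => ?_⟩
      have := hr2 j hj
      simp only [hκ]
      field_simp
      linear_combination this
  -- The separated description of the spectrum involves the twist through its eigenvalues only, so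
  -- after division by k₂ the function t is also an eigenvalue for diag(κ, 1).
  obtain ⟨v, hv0, hv⟩ := (mem_spectrumT_iff hη hs (K := !![κ, 0; 0, 1]) hκ1 hκ0 one_ne_zero
    (by simp [Matrix.trace_fin_two]) (by simp [Matrix.det_fin_two]) _).2 ht'
  have hv' (x : ℂ) : untwisted d η ξ x 1 1 *ᵥ v + κ • untwisted d η ξ x 0 0 *ᵥ v =
      (k₂⁻¹ * t x) • v := by
    rw [← hv x, transfer, monodromy_eq, Matrix.trace_fin_two, add_comm, ← smul_mulVec, ← add_mulVec]
    simp [Matrix.mul_apply, Fin.sum_univ_two, scalarAux_apply]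
  refine hE (Set.mem_iUnion.2 ⟨b, fun hinj => ?_⟩)
  have hQmem : Q ∈ degreeLT ℂ (∑ n, d n + 1) :=
    mem_degreeLT.2 ((natDegree_lt_iff_degree_lt hQ0).1 (Nat.lt_succ_of_le hQdeg))
  have hev (x : ℂ) : evalVec d _ x (fun c => v c • (⟨Q, hQmem⟩ : degreeLT ℂ (∑ n, d n + 1))) =
      Q.eval x • v := by
    funext c
    exact (eval_smul ..).trans (mul_comm _ _)
  have hker := hinj.eq_iff.1 ((?_ : (degenerateTQ d η ξ (∑ n, d n + 1) b +
    (k₁ / k₂) • twistTQ d η ξ (∑ n, d n + 1))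
      (fun c => v c • (⟨Q, hQmem⟩ : degreeLT ℂ (∑ n, d n + 1))) = 0).trans (map_zero _).symm)
  · obtain ⟨c, hc⟩ := Function.ne_iff.1 hv0
    have := congrArg Subtype.val (congrFun hker c)
    exact (smul_ne_zero hc hQ0) this
  · refine Prod.ext (funext fun x => ?_) ?_
    · change (untwisted d η ξ x 1 1 *ᵥ evalVec d _ x _ - dFun d η ξ x • evalVec d _ (x + η) _) +
        (k₁ / k₂) • (untwisted d η ξ x 0 0 *ᵥ evalVec d _ x _ -
          aFun d η ξ x • evalVec d _ (x - η) _) = 0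
      rw [hev, hev, hev, ← hκ, mulVec_smul, mulVec_smul]
      have h1 : Q.eval x • (untwisted d η ξ x 1 1 *ᵥ v + κ • untwisted d η ξ x 0 0 *ᵥ v) =
          (κ * aFun d η ξ x * Q.eval (x - η) + dFun d η ξ x * Q.eval (x + η)) • v := by
        rw [hv', smul_smul]
        congr 1
        have := hQ x
        rw [hκ]
        field_simp
        linear_combination this
      funext c
      have h2 := congrFun h1 c
      simp only [Pi.add_apply, Pi.sub_apply, Pi.smul_apply, Pi.zero_apply, smul_eq_mul] at h2 ⊢
      linear_combination h2
    · change evalVec d _ _ _ + (k₁ / k₂) • (0 : Conf d → ℂ) = 0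
      rw [hev, hb, zero_smul, smul_zero, add_zero]

end HigherSpin

/-! ### The main theorem -/

theorem theorem5p1 (N : ℕ) (d : Fin N → ℕ) (hd : ∀ n, 0 < d n)
    (η : ℂ) (hη : η ≠ 0) (ξ : Fin N → ℂ)
    (hξ : ∀ a b : Fin N, a ≠ b → ∀ m : ℤ, ξ a - ξ b ≠ (m : ℂ) * η)
    (hξ' : ∀ a b : Fin N, a ≠ b → ∀ h k : ℕ, h ≤ d a → k ≤ d b →
      HigherSpin.xi d η ξ a h ≠ HigherSpin.xi d η ξ b k) :
    ∃ E : Set ℂ, E.Finite ∧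
      ∀ (K : Matrix (Fin 2) (Fin 2) ℂ) (k₁ k₂ : ℂ),
        Module.End.HasEigenvalue (Matrix.toLin' K) k₁ →
        Module.End.HasEigenvalue (Matrix.toLin' K) k₂ →
        k₁ ≠ k₂ → k₁ ≠ 0 → k₂ ≠ 0 →
        -- the characterization of the spectrum, outside finitely many values of `k₁ / k₂`
        (k₁ / k₂ ∉ E → ∀ t : ℂ → ℂ, Differentiable ℂ t →
          (t ∈ HigherSpin.spectrumT d η ξ K ↔
            ∃! Q : Polynomial ℂ, HigherSpin.IsQFunction d η ξ K k₁ t Q)) ∧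
        -- without that restriction: sufficiency and uniqueness
        (∀ t : ℂ → ℂ, Differentiable ℂ t →
          ∀ Q : Polynomial ℂ, HigherSpin.IsQFunction d η ξ K k₁ t Q →
            t ∈ HigherSpin.spectrumT d η ξ K ∧
            ∀ Q' : Polynomial ℂ, HigherSpin.IsQFunction d η ξ K k₁ t Q' → Q' = Q) ∧
        -- without that restriction: SoV bases exist, and in each of them the eigenvector
        -- has the factorized wavefunction
        (∃ S : HigherSpin.Conf d → ℂ, HigherSpin.IsSoVBasis d η ξ K k₂ S) ∧
        (∀ S : HigherSpin.Conf d → ℂ, HigherSpin.IsSoVBasis d η ξ K k₂ S →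
          ∀ t : ℂ → ℂ, Differentiable ℂ t →
          ∀ Q : Polynomial ℂ, HigherSpin.IsQFunction d η ξ K k₁ t Q →
          ∀ v : HigherSpin.Conf d → ℂ, HigherSpin.IsEigenvector d η ξ K t v →
            ∃ c : ℂ, c ≠ 0 ∧ ∀ h : HigherSpin.Conf d,
              dotProduct (HigherSpin.sovCovector d η ξ K k₂ S h) v =
                c * ∏ n : Fin N, Q.eval (HigherSpin.xi d η ξ n (h n : ℕ))) := by
  have hs : HigherSpin.DisjointStrings d η ξ := hξ'
  refine ⟨HigherSpin.exceptionalTwists d η ξ, HigherSpin.exceptionalTwists_finite hη hs, ?_⟩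
  intro K k₁ k₂ he₁ he₂ hk hk₁ hk₂
  obtain ⟨htr, hdet⟩ := HigherSpin.trace_eq_and_det_eq hk he₁ he₂
  have hmem := HigherSpin.mem_spectrumT_iff hη hs hk hk₁ hk₂ htr hdet
  have hcurve {t : ℂ → ℂ} (ht : Differentiable ℂ t) {Q : Polynomial ℂ}
      (hQ : HigherSpin.IsQFunction d η ξ K k₁ t Q) : HigherSpin.TQ d η ξ k₁ k₂ t Q :=
    (HigherSpin.spectralCurve_iff hη hk₁ hdet ht.continuous Q).1 hQ.curve
  have hsuff : ∀ t : ℂ → ℂ, Differentiable ℂ t →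
      ∀ Q : Polynomial ℂ, HigherSpin.IsQFunction d η ξ K k₁ t Q →
        t ∈ HigherSpin.spectrumT d η ξ K ∧
        ∀ Q' : Polynomial ℂ, HigherSpin.IsQFunction d η ξ K k₁ t Q' → Q' = Q := fun t ht Q hQ =>
    ⟨(hmem t).2 ((hcurve ht hQ).isSeparatedEigenvalue ht.continuous hQ.monic hQ.eval_ne_zero),
      fun Q' hQ' => (hcurve ht hQ).unique hη hk (hcurve ht hQ') hQ.monic hQ'.monic⟩
  refine ⟨fun hE t ht => ⟨fun hmt => ?_, fun ⟨Q, hQ, _⟩ => (hsuff t ht Q hQ).1⟩, hsuff,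
    HigherSpin.exists_isSoVBasis hη hs hk hk₁ hk₂ htr hdet, fun S hS t ht Q hQ v hv =>
      HigherSpin.exists_factorization hη hs hk₂ hdet (q := fun x => Q.eval x) (hcurve ht hQ) hv
        hQ.eval_ne_zero hS⟩
  have hsep := (hmem t).1 hmt
  obtain ⟨Q, hQ0, hQdeg, hQ⟩ := hsep.exists_tq hη hs hd hk₂
  have hl : Q.leadingCoeff⁻¹ ≠ 0 := inv_ne_zero (Polynomial.leadingCoeff_ne_zero.2 hQ0)
  have hR : HigherSpin.IsQFunction d η ξ K k₁ t (Polynomial.C Q.leadingCoeff⁻¹ * Q) :=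
    { monic := Polynomial.monic_C_mul_of_mul_leadingCoeff_eq_one
        (inv_mul_cancel₀ (Polynomial.leadingCoeff_ne_zero.2 hQ0))
      natDegree_le := (Polynomial.natDegree_C_mul_le _ _).trans hQdeg
      eval_ne_zero := fun b => by
        rw [Polynomial.eval_C_mul]
        exact mul_ne_zero hl (hQ.eval_ne_zero hη hs hk hk₁ hk₂ hE hsep hQ0 hQdeg b)
      curve := (HigherSpin.spectralCurve_iff hη hk₁ hdet ht.continuous _).2 fun x => by
        simp only [Polynomial.eval_C_mul]
        linear_combination Q.leadingCoeff⁻¹ * hQ x }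
  exact ⟨_, hR, fun Q' hQ' => (hsuff t ht _ hR).2 Q' hQ'⟩
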